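/- Let $n\ge 1$. A variable exponent is a measurable function $p:\mathbb{R}^n\to[1,\infty]$. Write $\|g\|_{p(\cdot)}=\inf\{\lambda>0:\int_{\mathbb{R}^n}(|g(x)|/\lambda)^{p(x)}\,dx\le 1\}$, where $s^\infty=0$ for $0\le s\le 1$ and $s^\infty=\infty$ for $s>1$, and let $L^{p(\cdot)}(\mathbb{R}^n)$ be the space of measurable functions with $\int(|g|/\lambda)^{p(x)}dx<\infty$ for some $\lambda>0$. Let $\mathcal{B}(\mathbb{R}^n)$ be the class of variable exponents $q$ for which the Hardy–Littlewood maximal operator $Mf(x)=\sup_{r>0}|B(x,r)|^{-1}\int_{B(x,r)}|f(y)|\,dy$ is bounded on $L^{q(\cdot)}(\mathbb{R}^n)$. **Theorem 2.1.** Let $p$ be a variable exponent on $\mathbb{R}^n$. Let $\sigma$ be a (positive) compactly supported Borel measure on $\mathbb{R}^n$, let $m(\xi)=\widehat\sigma(\xi)=\int e^{-2\pi i\langle y,\xi\rangle}\,d\sigma(y)$, let $0\le\beta\le n$ and $\alpha>1/2$, and suppose that, with finite constants $C_\beta$, $C$, 1. $\sigma(B(x,R))\le C_\beta R^\beta$ for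 all $x\in\mathbb{R}^n$ and $0<R\le 1$; 2. $\left(\int_1^2|m(t\xi)|^2\,dt\right)^{1/2}\le C(1+|\xi|)^{-\alpha}$ for all $\xi\in\mathbb{R}^n$; 3. $\left(\int_1^2|\nabla m(t\xi)|^2\,dt\right)^{1/2}\le C(1+|\xi|)^{-\alpha}$ for all $\xi\in\mathbb{R}^n$. Suppose that for some $\theta$ with $0<\theta<\frac{2\alpha-1}{2\alpha-1+2n-2\beta}$ we have $(1-\theta)p(x)\le 2$ for all $x$, and the exponent $\frac{2\theta p(\cdot)}{2-(1-\theta)p(\cdot)}$ (equal to $\infty$ where the denominator vanishes) belongs to $\mathcal{B}(\mathbb{R}^n)$. Then the maximal multiplier operator $\mathcal{M}_m$ is bounded on $L^{p(\cdot)}(\mathbb{R}^n)$. Precisely, there is a finite constant $C'$ such that: (a) for every Schwartz function $f$, the function $\mathcal{M}_mf(x)=\sup_{t>0}|M_tf(x)|$, where $(M_tf)^\wedge(\xi)=\widehat f(\xi)\,m(t\xi)$, is measurable and satisfies $\|\mathcal{M}_mf\|_{p(\cdot)}\le C'\|f\|_{p(\cdot)}$; (b) for every $f\in L^{p(\cdot)}(\mathbb{R}^n)$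 and almost every $x$, the function $y\mapsto f(x-ty)$ is $\sigma$-integrable for all $t>0$, and $\mathcal{M}_mf(x):=\sup_{t>0}\left|\int f(x-ty)\,d\sigma(y)\right|$ is measurable with $\|\mathcal{M}_mf\|_{p(\cdot)}\le C'\|f\|_{p(\cdot)}$. -/

import Mathlib

open MeasureTheory Set
open scoped ENNReal NNReal FourierTransform SchwartzMap

namespace VarLp

variable {n : ℕ}

/-- The set `𝓟(ℝⁿ)` of variable exponents: measurable functions `p : ℝⁿ → [1, ∞]`. -/
def IsExponent (p : EuclideanSpace ℝ (Fin n) → ℝ≥0∞) : Prop :=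
  Measurable p ∧ ∀ x, 1 ≤ p x

/-- The power `s ^ p` for `s, p ∈ [0, ∞]`, with the usual convention of variable exponent spaces
at `p = ∞`: `s ^ ∞ = 0` if `s ≤ 1` and `s ^ ∞ = ∞` if `s > 1`. -/
noncomputable def expPow (s p : ℝ≥0∞) : ℝ≥0∞ :=
  if p = ∞ then (if s ≤ 1 then 0 else ∞) else s ^ p.toReal

/-- The modular `∫ g(x) ^ p(x) dx` of a function `g : ℝⁿ → [0, ∞]`. -/
noncomputable def modular (p g : EuclideanSpace ℝ (Fin n) → ℝ≥0∞) : ℝ≥0∞ :=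
  ∫⁻ x, expPow (g x) (p x)

/-- The Luxemburg norm `inf {c > 0 : ∫ (g(x) / c) ^ p(x) dx ≤ 1}` of a function
`g : ℝⁿ → [0, ∞]`; it is `∞` if there is no such `c`. The norm of a complex function `f` is
`luxNorm p (fun x => ‖f x‖ₑ)`. -/
noncomputable def luxNorm (p g : EuclideanSpace ℝ (Fin n) → ℝ≥0∞) : ℝ≥0∞ :=
  ⨅ (c : ℝ≥0) (_ : 0 < c) (_ : modular p (fun x => g x / c) ≤ 1), (c : ℝ≥0∞)

/-- Membership in `L^{p(·)}(ℝⁿ)`. -/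
def MemLpVar (p : EuclideanSpace ℝ (Fin n) → ℝ≥0∞) (f : EuclideanSpace ℝ (Fin n) → ℂ) : Prop :=
  AEMeasurable f ∧ ∃ c : ℝ≥0, 0 < c ∧ modular p (fun x => ‖f x‖ₑ / c) < ∞

/-- The centred Hardy–Littlewood maximal function
`sup_{r > 0} |B(x, r)|⁻¹ ∫_{B(x, r)} |f(y)| dy`. -/
noncomputable def hardyLittlewood (f : EuclideanSpace ℝ (Fin n) → ℂ)
    (x : EuclideanSpace ℝ (Fin n)) : ℝ≥0∞ :=
  ⨆ (r : ℝ) (_ : 0 < r), (∫⁻ y in Metric.ball x r, ‖f y‖ₑ) / volume (Metric.ball x r)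

/-- The class `𝓑(ℝⁿ)`: variable exponents for which the Hardy–Littlewood maximal operator is
bounded on `L^{p(·)}(ℝⁿ)`. -/
def ClassB (p : EuclideanSpace ℝ (Fin n) → ℝ≥0∞) : Prop :=
  IsExponent p ∧ ∃ C : ℝ≥0, ∀ f : EuclideanSpace ℝ (Fin n) → ℂ, MemLpVar p f →
    luxNorm p (hardyLittlewood f) ≤ C * luxNorm p (fun x => ‖f x‖ₑ)

/-- The exponent `2 θ p(·) / (2 - (1 - θ) p(·))`, with value `∞` where the denominator vanishes.
Since subtraction in `[0, ∞]` is truncated, this is only meaningful where `(1 - θ) p(x) ≤ 2`. -/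
noncomputable def interpExponent (θ : ℝ) (p : EuclideanSpace ℝ (Fin n) → ℝ≥0∞)
    (x : EuclideanSpace ℝ (Fin n)) : ℝ≥0∞ :=
  2 * ENNReal.ofReal θ * p x / (2 - ENNReal.ofReal (1 - θ) * p x)

/-- `σ` is carried by a compact set. -/
def CompactlySupported (σ : Measure (EuclideanSpace ℝ (Fin n))) : Prop :=
  ∃ K : Set (EuclideanSpace ℝ (Fin n)), IsCompact K ∧ σ Kᶜ = 0

/-- `σ` is locally (uniformly) `β`-dimensional: `σ(B(x, R)) ≤ C R ^ β` for all balls of radius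
`R ≤ 1`. -/
def LocallyDimensional (β : ℝ) (σ : Measure (EuclideanSpace ℝ (Fin n))) : Prop :=
  ∃ C : ℝ≥0, ∀ (x : EuclideanSpace ℝ (Fin n)) (R : ℝ), 0 < R → R ≤ 1 →
    σ (Metric.ball x R) ≤ C * ENNReal.ofReal (R ^ β)

/-- The Fourier transform `ξ ↦ ∫ exp(-2πi ⟨y, ξ⟩) dσ(y)` of the measure `σ`, in the normalization
of the Fourier transform of functions used by Mathlib. -/
noncomputable def fourierMeasure (σ : Measure (EuclideanSpace ℝ (Fin n)))
    (ξ : EuclideanSpace ℝ (Fin n)) : ℂ :=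
  ∫ y, (Real.fourierChar (-(inner ℝ y ξ)) : ℂ) ∂σ

/-- The gradient `(∂₁ m, …, ∂ₙ m)` of a complex function, as a vector of `ℂⁿ` with its Euclidean
norm. -/
noncomputable def grad (m : EuclideanSpace ℝ (Fin n) → ℂ) (ξ : EuclideanSpace ℝ (Fin n)) :
    EuclideanSpace ℂ (Fin n) :=
  WithLp.toLp 2 fun i => fderiv ℝ m ξ (EuclideanSpace.single i 1)

/-- The multiplier operator `M_t`, given by `(M_t f)^(ξ) = f^(ξ) m(t ξ)`. -/
noncomputable def multiplierOp (m : EuclideanSpace ℝ (Fin n) → ℂ) (t : ℝ)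
    (f : 𝓢(EuclideanSpace ℝ (Fin n), ℂ)) : EuclideanSpace ℝ (Fin n) → ℂ :=
  𝓕⁻ (fun ξ => 𝓕 (f : EuclideanSpace ℝ (Fin n) → ℂ) ξ * m (t • ξ))

/-- The maximal multiplier operator `sup_{t > 0} |M_t f(x)|` on Schwartz functions. -/
noncomputable def maximalMultiplier (m : EuclideanSpace ℝ (Fin n) → ℂ)
    (f : 𝓢(EuclideanSpace ℝ (Fin n), ℂ)) (x : EuclideanSpace ℝ (Fin n)) : ℝ≥0∞ :=
  ⨆ (t : ℝ) (_ : 0 < t), ‖multiplierOp m t f x‖ₑ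

/-- The maximal operator `sup_{t > 0} |∫ f(x - t y) dσ(y)|`, the form which the maximal multiplier
operator of the multiplier `m = σ^` takes on general functions `f`. -/
noncomputable def maximalAverage (σ : Measure (EuclideanSpace ℝ (Fin n)))
    (f : EuclideanSpace ℝ (Fin n) → ℂ) (x : EuclideanSpace ℝ (Fin n)) : ℝ≥0∞ :=
  ⨆ (t : ℝ) (_ : 0 < t), ‖∫ y, f (x - t • y) ∂σ‖ₑ

end VarLp

set_option linter.unusedSectionVars false

/-! The measure is split into frequency-localized pieces by a compactly supported mollifier `φ` of
integral one: the pieces are `σ * φ_0` and `σ * (φ_{j+1} - φ_j)`, where `φ_j` is `φ` rescaled to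
width `2^(-j)`. Two estimates hold for the maximal operator of the `j`-th piece. The ball condition
on `σ` bounds its kernel by `2^(j(n-β))` on a fixed ball, so the operator is dominated pointwise by
`2^(j(n-β))` times the Hardy–Littlewood maximal function. For `j ≥ 1` the decay of `m` and of its
gradient gives a squared `L²` norm of order `2^(-j(2α-1))`, through the inequality `sup |F|² ≤ 2 ∫
|F| |F'| dt`, Cauchy–Schwarz and Plancherel; the piece `j = 0` is bounded on `L²` by the maximal
function (`exists_kernel_decomposition`).

The two estimates are interpolated by hand. With `q = interpExponent θ p`, so that `1/p = (1-θ)/2 +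
θ/q`, write `|f| = a^(1-θ) b^θ` with `a² = b^q = |f|^p` (`b = 1` where `q = ∞`). Cutting `f` along
the dyadic level sets of `a / b` makes it comparable on each set to a multiple of `a` and to a
multiple of `b`; a two-sided geometric sum then gives a pointwise bound by `(M b)^θ u^(1-θ)` with
`u` in `L²` (`exists_kernelMax_le_interpolation`). The sum over `j` converges exactly when `2θ(n-β)
< (1-θ)(2α-1)`, which is the upper bound on `θ` (`exists_tsum_kernelMax_le`). A pointwise Young
inequality turns `(M b)^θ u^(1-θ)` into a modular bound, and `q ∈ ClassB` controls `M b`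
(`exists_modular_maximalAverage_le`).

All this is done for bounded continuous `f`. Since `p ≤ 2/(1-θ)` is bounded, every function in the
unit ball has a lower semicontinuous majorant in a multiple of it, and monotone approximation
extends the bound to averages of arbitrary nonnegative functions (`exists_posAverageBound`). Applied
to `∞` times the indicator of a null set, this bound shows that Lebesgue-null sets are harmless for
almost every `x`, simultaneously for all `t`; integrability follows, and measurability follows from
rapid approximation by bounded continuous functions. -/

namespace VarLp

/-! ### The Hardy–Littlewood maximal function: semicontinuity, weak type (1,1), and the `L²` bound.
-/

section MaximalFunction

open Metric

variable {E : Type*} [NormedAddCommGroup E] [InnerProductSpace ℝ E] [FiniteDimensional ℝ E]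
  [MeasurableSpace E] [BorelSpace E]

/-- The centred Hardy–Littlewood maximal function of a function with values in `[0, ∞]`. -/
noncomputable def maxFn (g : E → ℝ≥0∞) (x : E) : ℝ≥0∞ :=
  ⨆ (r : ℝ) (_ : 0 < r), (∫⁻ y in ball x r, g y) / volume (ball x r)

/-- An open ball is the increasing union of concentric smaller balls, and each smaller one stays
inside the ball of radius `r` around every nearby centre. Working with the measure of density `g`
avoids any measurability of `g`. -/
theorem lowerSemicontinuous_setLIntegral_ball (g : E → ℝ≥0∞) (r : ℝ) :
    LowerSemicontinuous fun x => ∫⁻ y in ball x r, g y := by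
  intro x c hc
  have hU : ball x r = ⋃ k : ℕ, ball x (r - 1 / (k + 1)) := by
    ext y
    simp only [mem_ball, mem_iUnion]
    constructor
    · intro h
      obtain ⟨k, hk⟩ := exists_nat_one_div_lt (sub_pos.2 h)
      exact ⟨k, by linarith⟩
    · rintro ⟨k, hk⟩
      have : (0 : ℝ) < 1 / (k + 1) := by positivity
      linarith
  have hmono : Monotone fun k : ℕ => ball x (r - 1 / ((k : ℝ) + 1)) := by
    intro a b hab
    apply ball_subset_ball
    have : (1 : ℝ) / (b + 1) ≤ 1 / (a + 1) := by gcongr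
    linarith
  have h1 : ∫⁻ y in ball x r, g y = ⨆ k : ℕ, ∫⁻ y in ball x (r - 1 / ((k : ℝ) + 1)), g y := by
    rw [hU, ← withDensity_apply' _ (⋃ k : ℕ, ball x (r - 1 / ((k : ℝ) + 1))),
      hmono.directed_le.measure_iUnion]
    simp [measurableSet_ball]
  simp only at hc
  rw [h1, gt_iff_lt, lt_iSup_iff] at hc
  obtain ⟨k, hk⟩ := hc
  have hpos : (0 : ℝ) < 1 / (k + 1) := by positivity
  filter_upwards [ball_mem_nhds x hpos] with z hz
  refine hk.trans_le (lintegral_mono_set ?_)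
  apply ball_subset_ball'
  rw [mem_ball, dist_comm] at hz
  linarith

theorem lowerSemicontinuous_maxFn (g : E → ℝ≥0∞) : LowerSemicontinuous (maxFn g) := by
  refine lowerSemicontinuous_iSup fun r => lowerSemicontinuous_iSup fun hr => ?_
  have : (fun x => (∫⁻ y in ball x r, g y) / volume (ball x r)) =
      fun x => (volume (ball (0 : E) r))⁻¹ * ∫⁻ y in ball x r, g y := by
    ext x
    rw [Measure.addHaar_ball_center, ENNReal.div_eq_inv_mul]
  rw [this]
  have hv : (volume (ball (0 : E) r))⁻¹ ≠ ∞ := by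
    simpa using (measure_ball_pos volume (0 : E) hr).ne'
  exact (ENNReal.continuous_const_mul hv).comp_lowerSemicontinuous
    (lowerSemicontinuous_setLIntegral_ball g r) fun a b hab => mul_le_mul_right hab _

theorem measurable_maxFn (g : E → ℝ≥0∞) : Measurable (maxFn g) :=
  (lowerSemicontinuous_maxFn g).measurable

theorem setLIntegral_ball_le_maxFn (g : E → ℝ≥0∞) (x : E) {r : ℝ} (hr : 0 < r) :
    ∫⁻ y in ball x r, g y ≤ volume (ball x r) * maxFn g x := by
  have h : (∫⁻ y in ball x r, g y) / volume (ball x r) ≤ maxFn g x :=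
    le_iSup₂_of_le r hr le_rfl
  rw [ENNReal.div_le_iff (measure_ball_pos volume x hr).ne' measure_ball_lt_top.ne] at h
  rwa [mul_comm]

theorem maxFn_mono {f g : E → ℝ≥0∞} (h : ∀ x, f x ≤ g x) (x : E) : maxFn f x ≤ maxFn g x := by
  unfold maxFn
  gcongr
  exact h _

theorem maxFn_const_mul {c : ℝ≥0∞} (hc : c ≠ ∞) (g : E → ℝ≥0∞) (x : E) :
    maxFn (fun y => c * g y) x = c * maxFn g x := by
  simp only [maxFn, lintegral_const_mul' _ _ hc, ENNReal.mul_iSup, mul_div_assoc]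

/-- The weak type `(1, 1)` inequality for the maximal function. -/
theorem mul_meas_lt_maxFn_le [Nontrivial E] (g : E → ℝ≥0∞) (c : ℝ≥0∞) :
    c * volume {x | c < maxFn g x} ≤ 5 ^ Module.finrank ℝ E * ∫⁻ y, g y := by
  rcases eq_or_ne c 0 with rfl | hc0
  · simp
  rcases eq_or_ne (∫⁻ y, g y) ∞ with hg | hg
  · rw [hg, ENNReal.mul_top (by positivity)]; exact le_top
  rcases eq_or_ne c ∞ with rfl | hctop
  · simp
  have hex : ∀ x ∈ {x | c < maxFn g x}, ∃ r : ℝ, 0 < r ∧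
      c * volume (ball x r) ≤ ∫⁻ y in ball x r, g y := by
    intro x hx
    simp only [mem_ofPred_eq, maxFn, lt_iSup_iff] at hx
    obtain ⟨r, hr, h⟩ := hx
    refine ⟨r, hr, ?_⟩
    rw [ENNReal.lt_div_iff_mul_lt (Or.inl (measure_ball_pos volume x hr).ne')
      (Or.inl measure_ball_lt_top.ne)] at h
    exact h.le
  choose! r hr0 hr using hex
  -- The Vitali covering lemma needs bounded radii. A selected ball has volume at most `(∫ g) / c`,
  -- and the volume is at least a constant times the radius once the radius exceeds 1.
  have hbdd : ∃ R : ℝ, ∀ x ∈ {x | c < maxFn g x}, r x ≤ R := by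
    set V := volume (ball (0 : E) 1)
    have hV0 : V ≠ 0 := (measure_ball_pos volume (0 : E) one_pos).ne'
    have hVt : V ≠ ∞ := measure_ball_lt_top.ne
    refine ⟨max 1 ((∫⁻ y, g y) / (c * V)).toReal, fun x hx => ?_⟩
    rcases le_total (r x) 1 with h1 | h1
    · exact h1.trans (le_max_left _ _)
    refine le_trans ?_ (le_max_right _ _)
    have h2 := (hr x hx).trans (setLIntegral_le_lintegral _ _)
    rw [Measure.addHaar_ball _ _ (hr0 x hx).le] at h2
    have h3 : ENNReal.ofReal (r x) ≤ (∫⁻ y, g y) / (c * V) := by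
      rw [ENNReal.le_div_iff_mul_le (Or.inl (mul_ne_zero hc0 hV0))
        (Or.inl (ENNReal.mul_ne_top hctop hVt))]
      refine le_trans ?_ h2
      have : r x ≤ r x ^ Module.finrank ℝ E :=
        le_self_pow₀ h1 (Module.finrank_pos).ne'
      calc ENNReal.ofReal (r x) * (c * V) = c * (ENNReal.ofReal (r x) * V) := by ring
        _ ≤ _ := by gcongr
    rwa [ENNReal.ofReal_le_iff_le_toReal] at h3
    exact ENNReal.div_ne_top hg (mul_ne_zero hc0 hV0)
  obtain ⟨R, hR⟩ := hbdd
  obtain ⟨u, hut, hdisj, hcov⟩ := Vitali.exists_disjoint_subfamily_covering_enlargement_ball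
    {x | c < maxFn g x} id r R hR 5 (by norm_num)
  simp only [id] at hdisj hcov
  have hcount : u.Countable :=
    hdisj.countable_of_isOpen (fun _ _ => isOpen_ball) fun x hx =>
      ⟨x, mem_ball_self (hr0 x (hut hx))⟩
  have hsub : {x | c < maxFn g x} ⊆ ⋃ x ∈ u, ball x (5 * r x) := by
    intro x hx
    obtain ⟨b, hb, hxb⟩ := hcov x hx
    exact mem_iUnion₂.2 ⟨b, hb, hxb (mem_ball_self (hr0 x hx))⟩
  have := hcount.to_subtype
  calc c * volume {x | c < maxFn g x}
      ≤ c * ∑' x : u, volume (ball (x : E) (5 * r x)) := by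
        gcongr
        exact (measure_mono hsub).trans (measure_biUnion_le volume hcount _)
    _ = c * ∑' x : u, 5 ^ Module.finrank ℝ E * volume (ball (x : E) (r x)) := by
        congr 2
        ext x
        rw [Measure.addHaar_ball_mul_of_pos volume (x : E) (by norm_num : (0 : ℝ) < 5),
          ENNReal.ofReal_pow (by norm_num), Measure.addHaar_ball_center,
          Measure.addHaar_ball_center volume (x : E)]
        simp
    _ = 5 ^ Module.finrank ℝ E * ∑' x : u, c * volume (ball (x : E) (r x)) := by
        rw [ENNReal.tsum_mul_left, ENNReal.tsum_mul_left]; ring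
    _ ≤ 5 ^ Module.finrank ℝ E * ∑' x : u, ∫⁻ y in ball (x : E) (r x), g y := by
        gcongr with x
        exact hr x (hut x.2)
    _ = 5 ^ Module.finrank ℝ E * ∫⁻ y in ⋃ x ∈ u, ball x (r x), g y := by
        rw [lintegral_biUnion hcount (fun _ _ => measurableSet_ball) hdisj]
    _ ≤ _ := by
        exact mul_le_mul_right (setLIntegral_le_lintegral _ _) _

/-- Dyadic levels below `s`: their sum is comparable to `s`. -/
theorem tsum_two_zpow_lt_le (s : ℝ≥0∞) :
    ∑' k : ℤ, (if (2 : ℝ≥0∞) ^ k < s then (2 : ℝ≥0∞) ^ k else 0) ≤ 2 * s := by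
  rcases eq_or_ne s 0 with rfl | h0
  · simp
  rcases eq_or_ne s ∞ with rfl | ht
  · simp [ENNReal.mul_top]
  obtain ⟨K, hK1, hK2⟩ := ENNReal.exists_mem_Ioc_zpow h0 ht (y := 2) (by norm_num) (by norm_num)
  have h2 : (2 : ℝ≥0∞) ≠ 0 := by norm_num
  have h2' : (2 : ℝ≥0∞) ≠ ∞ := by norm_num
  calc ∑' k : ℤ, (if (2 : ℝ≥0∞) ^ k < s then (2 : ℝ≥0∞) ^ k else 0)
      ≤ ∑' k : ℤ, (Set.range fun i : ℕ => K - i).indicator (fun k => (2 : ℝ≥0∞) ^ k) k := by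
        refine ENNReal.tsum_le_tsum fun k => ?_
        split_ifs with hk
        · have hkK : k ≤ K := by
            by_contra! hlt
            have : (2 : ℝ≥0∞) ^ (K + 1) ≤ 2 ^ k :=
              ENNReal.zpow_le_of_le (by norm_num) (by omega)
            exact absurd (hK2.trans this) (not_le.2 hk)
          rw [indicator_of_mem]
          exact ⟨(K - k).toNat, by simp only; omega⟩
        · exact zero_le
    _ = ∑' i : ℕ, (2 : ℝ≥0∞) ^ (K - (i : ℤ)) := by
        rw [← tsum_subtype, tsum_range (fun k : ℤ => (2 : ℝ≥0∞) ^ k)]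
        intro a b h
        simp only at h
        omega
    _ = 2 ^ K * ∑' i : ℕ, ((2 : ℝ≥0∞)⁻¹) ^ i := by
        rw [← ENNReal.tsum_mul_left]
        congr 1; ext i
        rw [sub_eq_add_neg, ENNReal.zpow_add h2 h2', ENNReal.zpow_neg, zpow_natCast,
          ENNReal.inv_pow]
    _ = 2 * 2 ^ K := by
        rw [ENNReal.tsum_geometric, ENNReal.one_sub_inv_two, inv_inv, mul_comm]
    _ ≤ 2 * s := by gcongr

/-- A single term suffices when `s` is finite: the largest power of 2 strictly below `s` is at least
`s / 2`. -/
theorem sq_le_tsum_four_zpow (s : ℝ≥0∞) :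
    s ^ 2 ≤ 4 * ∑' k : ℤ, (if (2 : ℝ≥0∞) ^ k < s then ((2 : ℝ≥0∞) ^ k) ^ 2 else 0) := by
  rcases eq_or_ne s 0 with rfl | h0
  · simp
  have h2 : (2 : ℝ≥0∞) ≠ 0 := by norm_num
  have h2' : (2 : ℝ≥0∞) ≠ ∞ := by norm_num
  rcases eq_or_ne s ∞ with rfl | ht
  · have : ∑' k : ℤ, (if (2 : ℝ≥0∞) ^ k < ∞ then ((2 : ℝ≥0∞) ^ k) ^ 2 else 0) = ∞ := by
      rw [eq_top_iff]
      calc ∞ = ∑' _ : ℕ, (1 : ℝ≥0∞) := by simp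
        _ ≤ ∑' i : ℕ, (fun k : ℤ => if (2 : ℝ≥0∞) ^ k < ∞ then ((2 : ℝ≥0∞) ^ k) ^ 2 else 0) i := by
            refine ENNReal.tsum_le_tsum fun i => ?_
            simp only
            rw [if_pos (by simp)]
            exact one_le_pow₀ (by rw [zpow_natCast]; exact one_le_pow₀ (by norm_num))
        _ ≤ _ := ENNReal.tsum_comp_le_tsum_of_injective Nat.cast_injective _
    rw [this]
    simp [ENNReal.mul_top]
  obtain ⟨K, hK1, hK2⟩ := ENNReal.exists_mem_Ioc_zpow h0 ht (y := 2) (by norm_num) (by norm_num)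
  calc s ^ 2 ≤ (2 ^ (K + 1)) ^ 2 := by gcongr
    _ = 4 * (if (2 : ℝ≥0∞) ^ K < s then ((2 : ℝ≥0∞) ^ K) ^ 2 else 0) := by
        rw [if_pos hK1, ENNReal.zpow_add h2 h2', zpow_one]; ring
    _ ≤ _ := by gcongr; exact ENNReal.le_tsum K

/-- The maximal function is bounded on `L²`. -/
theorem lintegral_maxFn_sq_le [Nontrivial E] {g : E → ℝ≥0∞} (hg : Measurable g) :
    ∫⁻ x, maxFn g x ^ 2 ≤ 32 * 5 ^ Module.finrank ℝ E * ∫⁻ x, g x ^ 2 := by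
  set D : ℝ≥0∞ := 5 ^ Module.finrank ℝ E
  have h2 : (2 : ℝ≥0∞) ≠ 0 := by norm_num
  have h2' : (2 : ℝ≥0∞) ≠ ∞ := by norm_num
  have key : ∀ k : ℤ, ((2 : ℝ≥0∞) ^ k) ^ 2 * volume {x | (2 : ℝ≥0∞) ^ k < maxFn g x} ≤
      2 * D * ∫⁻ x, g x * (if (2 : ℝ≥0∞) ^ k < 2 * g x then (2 : ℝ≥0∞) ^ k else 0) := by
    intro k
    set c : ℝ≥0∞ := 2 ^ k
    have hc : c / 2 + c / 2 = c := ENNReal.add_halves c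
    -- Marcinkiewicz truncation at half the level: the part of `g` below `c / 2` adds at most `c /
    -- 2` to the maximal function, so the weak type bound is only needed for the large part `g₁`.
    set g₁ : E → ℝ≥0∞ := fun x => if c < 2 * g x then g x else 0
    have hle : ∀ x, g x ≤ g₁ x + c / 2 := by
      intro x
      simp only [g₁]
      split_ifs with h
      · exact le_self_add
      · rw [zero_add, ENNReal.le_div_iff_mul_le (by simp) (by simp), mul_comm]
        exact not_lt.1 h
    have hM : ∀ x, maxFn g x ≤ maxFn g₁ x + c / 2 := by
      intro x
      refine iSup₂_le fun r hr => ?_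
      rw [ENNReal.div_le_iff (measure_ball_pos volume x hr).ne' measure_ball_lt_top.ne]
      calc ∫⁻ y in ball x r, g y ≤ ∫⁻ y in ball x r, (g₁ y + c / 2) := by
            gcongr with y; exact hle y
        _ = (∫⁻ y in ball x r, g₁ y) + c / 2 * volume (ball x r) := by
            rw [lintegral_add_right _ measurable_const]; simp
        _ ≤ volume (ball x r) * maxFn g₁ x + c / 2 * volume (ball x r) := by
            gcongr; exact setLIntegral_ball_le_maxFn g₁ x hr
        _ = _ := by ring
    have hset : {x | c < maxFn g x} ⊆ {x | c / 2 < maxFn g₁ x} := by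
      intro x hx
      simp only [mem_ofPred_eq] at hx ⊢
      by_contra! hcon
      have := (hM x).trans (add_le_add_left hcon (c / 2))
      rw [hc] at this
      exact absurd this (not_le.2 hx)
    calc c ^ 2 * volume {x | c < maxFn g x}
        ≤ c ^ 2 * volume {x | c / 2 < maxFn g₁ x} := by gcongr
      _ = 2 * c * (c / 2 * volume {x | c / 2 < maxFn g₁ x}) := by
          have h : 2 * (c / 2) = c := by rw [two_mul, hc]
          calc _ = (2 * (c / 2)) * c * volume {x | c / 2 < maxFn g₁ x} := by rw [h, sq]
            _ = _ := by ring
      _ ≤ 2 * c * (D * ∫⁻ x, g₁ x) := by exact mul_le_mul_right (mul_meas_lt_maxFn_le g₁ _) _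
      _ = 2 * D * ∫⁻ x, c * g₁ x := by
          rw [lintegral_const_mul' _ _ (by simp [c, ENNReal.zpow_ne_top])]; ring
      _ = _ := by
          congr 2; ext x; simp only [g₁]; split_ifs <;> ring
  calc ∫⁻ x, maxFn g x ^ 2
      ≤ ∫⁻ x, 4 * ∑' k : ℤ, (if (2 : ℝ≥0∞) ^ k < maxFn g x then ((2 : ℝ≥0∞) ^ k) ^ 2 else 0) := by
        gcongr with x; exact sq_le_tsum_four_zpow _
    _ = 4 * ∑' k : ℤ, ((2 : ℝ≥0∞) ^ k) ^ 2 * volume {x | (2 : ℝ≥0∞) ^ k < maxFn g x} := by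
        have hms : ∀ k : ℤ, MeasurableSet {x | (2 : ℝ≥0∞) ^ k < maxFn g x} := fun k =>
          measurableSet_lt measurable_const (measurable_maxFn g)
        rw [lintegral_const_mul' _ _ (by norm_num), lintegral_tsum]
        · congr 2; ext k
          rw [← setLIntegral_const, ← lintegral_indicator (hms k)]
          simp only [indicator_apply, mem_ofPred_eq]
        · exact fun k => (Measurable.ite (hms k) measurable_const measurable_const).aemeasurable
    _ ≤ 4 * ∑' k : ℤ, 2 * D *
          ∫⁻ x, g x * (if (2 : ℝ≥0∞) ^ k < 2 * g x then (2 : ℝ≥0∞) ^ k else 0) := by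
        exact mul_le_mul_right (ENNReal.tsum_le_tsum key) _
    _ = 8 * D * ∫⁻ x, g x * ∑' k : ℤ, (if (2 : ℝ≥0∞) ^ k < 2 * g x then (2 : ℝ≥0∞) ^ k else 0) := by
        rw [ENNReal.tsum_mul_left, ← lintegral_tsum]
        · simp only [ENNReal.tsum_mul_left]; ring
        · intro k
          exact (hg.mul (Measurable.ite (measurableSet_lt measurable_const (hg.const_mul 2))
            measurable_const measurable_const)).aemeasurable
    _ ≤ 8 * D * ∫⁻ x, g x * (2 * (2 * g x)) := by
        gcongr with x; exact tsum_two_zpow_lt_le _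
    _ = 8 * D * ∫⁻ x, 4 * g x ^ 2 := by congr 2; ext x; ring
    _ = _ := by rw [lintegral_const_mul' _ _ (by norm_num)]; ring

end MaximalFunction

/-! ### Plancherel's identity for the Fourier integral on `L¹ ∩ L²`. -/

section Plancherel

open scoped ContDiff

variable {E : Type*} [NormedAddCommGroup E] [InnerProductSpace ℝ E] [FiniteDimensional ℝ E]
  [MeasurableSpace E] [BorelSpace E]

theorem continuous_fourier_of_integrable {h : E → ℂ} (h1 : Integrable h) : Continuous (𝓕 h) :=
  VectorFourier.fourierIntegral_continuous Real.continuous_fourierChar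
    (by exact continuous_inner) h1

/-- The `L²` transform and the Fourier integral have the same pairing with every smooth compactly
supported function, because in both cases the transform can be moved onto the test function. -/
theorem fourier_toLp_ae_eq {h : E → ℂ} (h1 : Integrable h) (h2 : MemLp h 2) :
    ((𝓕 (h2.toLp h) : Lp (α := E) ℂ 2) : E → ℂ) =ᵐ[volume] 𝓕 h := by
  apply ae_eq_of_integral_contDiff_smul_eq
  · exact (Lp.memLp _).locallyIntegrable (by norm_num)
  · exact (continuous_fourier_of_integrable h1).locallyIntegrable
  · intro g g_smooth g_cpt
    have hg₁ : HasCompactSupport (Complex.ofRealCLM ∘ g) := g_cpt.comp_left rfl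
    have hg₂ : ContDiff ℝ ∞ (Complex.ofRealCLM ∘ g) := by fun_prop
    set H : Lp (α := E) ℂ 2 volume := 𝓕 (h2.toLp h)
    set G : 𝓢(E, ℂ) := hg₁.toSchwartzMap hg₂
    have hG : ∀ x, G x = (g x : ℂ) := fun x => rfl
    have e1 := congrArg (fun T => T G) (Lp.fourier_toTemperedDistribution_eq (h2.toLp h))
    simp only [TemperedDistribution.fourier_apply, Lp.toTemperedDistribution_apply] at e1
    have e2 : ∫ x, 𝓕 G x • (h2.toLp h : E → ℂ) x = ∫ x, (𝓕 G x) * h x := by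
      apply integral_congr_ae
      filter_upwards [h2.coeFn_toLp] with x hx
      rw [hx, smul_eq_mul]
    have e3 : ∫ x, 𝓕 h x * G x = ∫ x, h x * 𝓕 (G : E → ℂ) x := by
      simpa using! VectorFourier.integral_bilin_fourierIntegral_eq_flip
        (ContinuousLinearMap.mul ℂ ℂ) (L := innerₗ E)
        Real.continuous_fourierChar continuous_inner h1 G.integrable
    calc ∫ x, g x • H x
        = ∫ x, G x • H x := by simp [hG]
      _ = ∫ x, h x * 𝓕 (G : E → ℂ) x := by
          rw [← e1, e2]; simp only [SchwartzMap.fourier_coe, mul_comm]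
      _ = ∫ x, g x • 𝓕 h x := by rw [← e3]; simp [hG, mul_comm]

/-- Plancherel's theorem on `L¹ ∩ L²`. -/
theorem lintegral_enorm_fourier_sq {h : E → ℂ} (h1 : Integrable h) (h2 : MemLp h 2) :
    ∫⁻ ξ, ‖𝓕 h ξ‖ₑ ^ 2 = ∫⁻ x, ‖h x‖ₑ ^ 2 := by
  have e : eLpNorm (𝓕 h) 2 = eLpNorm h 2 := by
    rw [← eLpNorm_congr_ae (fourier_toLp_ae_eq h1 h2), ← eLpNorm_congr_ae h2.coeFn_toLp]
    have := Lp.norm_fourier_eq (h2.toLp h)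
    rw [Lp.norm_def, Lp.norm_def] at this
    exact (ENNReal.toReal_eq_toReal_iff' (Lp.eLpNorm_ne_top _) (Lp.eLpNorm_ne_top _)).1 this
  have := congrArg (fun a => a ^ (2 : ℝ)) e
  have h2 := fun u : E → ℂ => eLpNorm_nnreal_pow_eq_lintegral (μ := (volume : Measure E)) (f := u)
    (p := 2) (by norm_num)
  simp only [NNReal.coe_ofNat, ENNReal.coe_ofNat, ENNReal.rpow_ofNat] at h2 this
  rwa [h2, h2] at this

theorem lintegral_enorm_fourierInv_sq {h : E → ℂ} (h1 : Integrable h) (h2 : MemLp h 2) :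
    ∫⁻ ξ, ‖𝓕⁻ h ξ‖ₑ ^ 2 = ∫⁻ x, ‖h x‖ₑ ^ 2 := by
  rw [← lintegral_enorm_fourier_sq h1 h2, ← lintegral_neg_eq_self]
  simp only [Real.fourierInv_eq_fourier_neg, neg_neg]

end Plancherel

/-! ### A one-dimensional Sobolev inequality on the half line. -/

section OneDim

theorem lintegral_Ioo_inv_eq_top {t : ℝ} (ht : 0 < t) :
    ∫⁻ s in Ioo 0 t, ENNReal.ofReal s⁻¹ = ∞ := by
  by_contra hne
  have h : IntegrableOn (fun s : ℝ => s⁻¹) (Ioo 0 t) := by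
    refine ⟨measurable_inv.aestronglyMeasurable, ?_⟩
    rw [hasFiniteIntegral_iff_ofReal]
    · exact lt_top_iff_ne_top.2 hne
    · filter_upwards [ae_restrict_mem measurableSet_Ioo] with s hs
      exact (inv_pos.2 hs.1).le
  rw [← intervalIntegrable_iff_integrableOn_Ioo_of_le ht.le, intervalIntegrable_inv_iff] at h
  rcases h with h | h
  · exact ht.ne h
  · exact h left_mem_uIcc

/-- The fundamental theorem of calculus for `‖φ‖²` gives the bound up to the term `‖φ s‖²` with `s <
t`. If the claim failed, `‖φ s‖²` would be bounded below by a positive constant on `(0, t)`, and its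
integral against `ds / s` would diverge. -/
theorem enorm_sq_le_two_mul_lintegral {φ φ' : ℝ → ℂ} (hd : ∀ t, HasDerivAt φ (φ' t) t)
    (hc : Continuous φ') (hfin : ∫⁻ s in Ioi 0, ‖φ s‖ₑ ^ 2 * ENNReal.ofReal s⁻¹ ≠ ∞)
    {t : ℝ} (ht : 0 < t) : ‖φ t‖ₑ ^ 2 ≤ 2 * ∫⁻ s in Ioi 0, ‖φ s‖ₑ * ‖φ' s‖ₑ := by
  have hφ : Continuous φ := continuous_iff_continuousAt.2 fun t => (hd t).continuousAt
  set R := 2 * ∫⁻ s in Ioi (0 : ℝ), ‖φ s‖ₑ * ‖φ' s‖ₑ with hR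
  have step : ∀ s ∈ Ioo 0 t, ‖φ t‖ₑ ^ 2 ≤ ‖φ s‖ₑ ^ 2 + R := by
    intro s hs
    have hderiv : ∀ u, HasDerivAt (fun u => ‖φ u‖ ^ 2) (2 * inner ℝ (φ u) (φ' u)) u :=
      fun u => (hd u).norm_sq
    have hcont : Continuous fun u => 2 * inner ℝ (φ u) (φ' u) := by fun_prop
    have hFTC : ∫ u in s..t, 2 * inner ℝ (φ u) (φ' u) = ‖φ t‖ ^ 2 - ‖φ s‖ ^ 2 :=
      intervalIntegral.integral_eq_sub_of_hasDerivAt (fun u _ => hderiv u)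
        (hcont.intervalIntegrable _ _)
    have h1 : ENNReal.ofReal (‖φ t‖ ^ 2 - ‖φ s‖ ^ 2) ≤ R := by
      rw [← hFTC, intervalIntegral.integral_of_le hs.2.le]
      refine (ENNReal.ofReal_le_ofReal (le_abs_self _)).trans ?_
      rw [← Real.enorm_eq_ofReal_abs]
      refine (enorm_integral_le_lintegral_enorm _).trans ?_
      rw [hR, ← lintegral_const_mul' _ _ (by norm_num)]
      refine (lintegral_mono_set (Ioc_subset_Ioi_self.trans (Ioi_subset_Ioi hs.1.le))).trans ?_
      refine lintegral_mono fun u => ?_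
      rw [enorm_mul]
      have e2 : ‖(2 : ℝ)‖ₑ = 2 := by simp [Real.enorm_eq_ofReal_abs]
      rw [e2]
      refine mul_le_mul_right ?_ _
      simpa [enorm, ← NNReal.coe_le_coe, ← ENNReal.coe_mul] using
        norm_inner_le_norm (𝕜 := ℝ) (φ u) (φ' u)
    calc ‖φ t‖ₑ ^ 2 = ENNReal.ofReal (‖φ s‖ ^ 2 + (‖φ t‖ ^ 2 - ‖φ s‖ ^ 2)) := by
          rw [add_sub_cancel, ENNReal.ofReal_pow (norm_nonneg _), ofReal_norm]
      _ ≤ ENNReal.ofReal (‖φ s‖ ^ 2) + ENNReal.ofReal (‖φ t‖ ^ 2 - ‖φ s‖ ^ 2) :=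
          ENNReal.ofReal_add_le
      _ ≤ ‖φ s‖ₑ ^ 2 + R := by
          rw [ENNReal.ofReal_pow (norm_nonneg _), ofReal_norm]; gcongr
  by_contra! hlt
  apply hfin
  rw [eq_top_iff]
  calc ∞ = (‖φ t‖ₑ ^ 2 - R) * ∫⁻ s in Ioo 0 t, ENNReal.ofReal s⁻¹ := by
        rw [lintegral_Ioo_inv_eq_top ht, ENNReal.mul_top]
        exact (tsub_pos_of_lt hlt).ne'
    _ = ∫⁻ s in Ioo 0 t, (‖φ t‖ₑ ^ 2 - R) * ENNReal.ofReal s⁻¹ := by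
        rw [lintegral_const_mul' _ _ (ENNReal.sub_ne_top (by simp))]
    _ ≤ ∫⁻ s in Ioo 0 t, ‖φ s‖ₑ ^ 2 * ENNReal.ofReal s⁻¹ := by
        refine setLIntegral_mono' measurableSet_Ioo fun s hs => ?_
        gcongr
        exact tsub_le_iff_right.2 (step s hs)
    _ ≤ _ := lintegral_mono_set Ioo_subset_Ioi_self

end OneDim

/-! ### Maximal multipliers on `L²` through square functions. -/

section MaximalMultiplier

variable {E : Type*} [NormedAddCommGroup E] [InnerProductSpace ℝ E] [FiniteDimensional ℝ E]
  [MeasurableSpace E] [BorelSpace E]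

theorem continuous_fourierInv_param {X : Type*} [TopologicalSpace X] [FirstCountableTopology X]
    {G : X → E → ℂ} {b : E → ℝ} (hb : Integrable b)
    (hG : ∀ x, Continuous (G x)) (hG' : ∀ ξ, Continuous fun x => G x ξ)
    (hbound : ∀ x ξ, ‖G x ξ‖ ≤ b ξ) : Continuous fun z : X × E => 𝓕⁻ (G z.1) z.2 := by
  simp only [Real.fourierInv_eq]
  refine continuous_of_dominated (bound := b) (fun z => ?_) (fun z => ?_) hb ?_
  · refine Continuous.aestronglyMeasurable ?_
    have := hG z.1
    fun_prop
  · filter_upwards with ξ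
    simpa using hbound z.1 ξ
  · filter_upwards with ξ
    have := hG' ξ
    fun_prop

theorem integrable_norm_mul_schwartz (g : 𝓢(E, ℂ)) : Integrable fun ξ => ‖ξ‖ * ‖g ξ‖ := by
  simpa using g.integrable_pow_mul volume 1

/-- The family `t ↦ 𝓕⁻ (g μ(t ·))` of multiplier transforms. -/
theorem hasDerivAt_fourierInv_dilate {μ : E → ℂ} (hμ : Differentiable ℝ μ)
    (hμ' : Continuous (fderiv ℝ μ)) {A : ℝ} (hA : ∀ ξ, ‖μ ξ‖ ≤ A) (hA' : ∀ ξ, ‖fderiv ℝ μ ξ‖ ≤ A)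
    (g : 𝓢(E, ℂ)) (x : E) (t : ℝ) :
    HasDerivAt (fun t : ℝ => 𝓕⁻ (fun ξ => g ξ * μ (t • ξ)) x)
      (𝓕⁻ (fun ξ => g ξ * fderiv ℝ μ (t • ξ) ξ) x) t := by
  simp only [Real.fourierInv_eq]
  have hc := hμ.continuous
  refine (hasDerivAt_integral_of_dominated_loc_of_deriv_le (μ := volume) (s := univ)
    (bound := fun ξ => A * (‖ξ‖ * ‖g ξ‖))
    (F := fun (t : ℝ) (ξ : E) => (Real.fourierChar (inner ℝ ξ x) : Circle) • (g ξ * μ (t • ξ)))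
    (F' := fun (t : ℝ) (ξ : E) => (Real.fourierChar (inner ℝ ξ x) : Circle) •
      (g ξ * fderiv ℝ μ (t • ξ) ξ)) Filter.univ_mem ?_ ?_ ?_ ?_ ?_ ?_).2
  · filter_upwards with t
    exact Continuous.aestronglyMeasurable (by fun_prop)
  · refine Integrable.mono' ((g.integrable (μ := volume)).norm.const_mul A)
      (Continuous.aestronglyMeasurable (by fun_prop)) ?_
    filter_upwards with ξ
    simp only [Circle.norm_smul, norm_mul]
    rw [mul_comm]
    gcongr
    exact hA _
  · exact Continuous.aestronglyMeasurable (by fun_prop)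
  · filter_upwards with ξ t _
    simp only [Circle.norm_smul, norm_mul]
    calc ‖g ξ‖ * ‖fderiv ℝ μ (t • ξ) ξ‖ ≤ ‖g ξ‖ * (A * ‖ξ‖) := by
          gcongr
          exact (ContinuousLinearMap.le_opNorm _ _).trans (by gcongr; exact hA' _)
      _ = _ := by ring
  · exact (integrable_norm_mul_schwartz g).const_mul A
  · filter_upwards with ξ t _
    have h1 : HasDerivAt (fun t : ℝ => t • ξ) ξ t := by
      simpa using (hasDerivAt_id t).smul_const ξ
    have h2 := (hμ (t • ξ)).hasFDerivAt.comp_hasDerivAt t h1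
    exact (h2.const_mul (g ξ)).const_smul (Real.fourierChar (inner ℝ ξ x) : Circle)

/-- Plancherel in `x` for each fixed `t`, between two applications of Tonelli; what remains is a
bound at each frequency `ξ`. It serves for the multiplier with weight `1 / t` and for its
`t`-derivative with weight `t`. -/
theorem lintegral_lintegral_fourierInv_sq_le {G : ℝ → E → ℂ} {b : E → ℝ} (hb : Integrable b)
    (hb2 : MemLp b 2)
    (hG : Continuous fun z : ℝ × E => G z.1 z.2) (hbound : ∀ t ξ, ‖G t ξ‖ ≤ b ξ)
    {g : E → ℂ} {w : ℝ → ℝ≥0∞} (hw : Measurable w) {I : ℝ≥0∞} (hItop : I ≠ ∞)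
    (hI : ∀ ξ, ∫⁻ t in Ioi 0, ‖G t ξ‖ₑ ^ 2 * w t ≤ I * ‖g ξ‖ₑ ^ 2) :
    ∫⁻ x, ∫⁻ t in Ioi 0, ‖𝓕⁻ (G t) x‖ₑ ^ 2 * w t ≤ I * ∫⁻ ξ, ‖g ξ‖ₑ ^ 2 := by
  have hGt : ∀ t, Continuous (G t) := fun t => hG.comp (Continuous.prodMk_right t)
  have hF : Continuous fun z : ℝ × E => 𝓕⁻ (G z.1) z.2 :=
    continuous_fourierInv_param hb hGt
      (fun ξ => hG.comp (Continuous.prodMk_left ξ)) hbound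
  have hF' : Measurable fun z : E × ℝ => ‖𝓕⁻ (G z.2) z.1‖ₑ ^ 2 * w z.2 :=
    ((hF.comp continuous_swap).measurable.enorm.pow_const 2).mul (hw.comp measurable_snd)
  have hG' : Measurable fun z : ℝ × E => ‖G z.1 z.2‖ₑ ^ 2 * w z.1 :=
    (hG.measurable.enorm.pow_const 2).mul (hw.comp measurable_fst)
  have hPl : ∀ t, ∫⁻ x, ‖𝓕⁻ (G t) x‖ₑ ^ 2 = ∫⁻ ξ, ‖G t ξ‖ₑ ^ 2 := fun t =>
    lintegral_enorm_fourierInv_sq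
      (hb.mono' (hGt t).aestronglyMeasurable (Filter.Eventually.of_forall (hbound t)))
      (hb2.of_le (hGt t).aestronglyMeasurable
        (Filter.Eventually.of_forall fun ξ => (hbound t ξ).trans (le_abs_self _)))
  calc ∫⁻ x, ∫⁻ t in Ioi 0, ‖𝓕⁻ (G t) x‖ₑ ^ 2 * w t
      = ∫⁻ t in Ioi 0, ∫⁻ x, ‖𝓕⁻ (G t) x‖ₑ ^ 2 * w t :=
        lintegral_lintegral_swap hF'.aemeasurable
    _ = ∫⁻ t in Ioi 0, ∫⁻ ξ, ‖G t ξ‖ₑ ^ 2 * w t := by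
        refine lintegral_congr fun t => ?_
        rw [lintegral_mul_const _ ((hGt t).measurable.enorm.pow_const 2), ← hPl,
          lintegral_mul_const]
        exact (hF.comp (Continuous.prodMk_right t)).measurable.enorm.pow_const 2
    _ = ∫⁻ ξ, ∫⁻ t in Ioi 0, ‖G t ξ‖ₑ ^ 2 * w t :=
        lintegral_lintegral_swap hG'.aemeasurable
    _ ≤ ∫⁻ ξ, I * ‖g ξ‖ₑ ^ 2 := lintegral_mono hI
    _ = _ := lintegral_const_mul' _ _ hItop

theorem memLp_two_norm_mul_schwartz (g : 𝓢(E, ℂ)) : MemLp (fun ξ => ‖ξ‖ * ‖g ξ‖) 2 := by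
  have hc : Continuous fun ξ => ‖ξ‖ * ‖g ξ‖ := by fun_prop
  rw [memLp_two_iff_integrable_sq hc.aestronglyMeasurable]
  obtain ⟨C, hC⟩ := g.decay 0 0
  refine ((g.integrable_pow_mul volume 2).const_mul C).mono' (by fun_prop) ?_
  filter_upwards with ξ
  have h := hC.2 ξ
  simp only [pow_zero, norm_iteratedFDeriv_zero, one_mul] at h
  rw [Real.norm_of_nonneg (by positivity)]
  calc (‖ξ‖ * ‖g ξ‖) ^ 2 = ‖g ξ‖ * (‖ξ‖ ^ 2 * ‖g ξ‖) := by ring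
    _ ≤ C * (‖ξ‖ ^ 2 * ‖g ξ‖) := by gcongr

/-- The one-dimensional inequality holds for almost every `x`, namely where the first square
function is finite. Cauchy–Schwarz in `(x, t)`, with the weight 1 split as `t^(-1/2) t^(1/2)`,
finishes the argument. -/
theorem lintegral_iSup_sq_le_of_hasDerivAt {F F' : ℝ → E → ℂ}
    (hcF : Continuous fun z : ℝ × E => F z.1 z.2) (hcF' : Continuous fun z : ℝ × E => F' z.1 z.2)
    (hder : ∀ x t, HasDerivAt (fun t => F t x) (F' t x) t) {S S' : ℝ≥0∞} (hSt : S ≠ ∞)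
    (hS : ∫⁻ x, ∫⁻ t in Ioi 0, ‖F t x‖ₑ ^ 2 * ENNReal.ofReal t⁻¹ ≤ S)
    (hS' : ∫⁻ x, ∫⁻ t in Ioi 0, ‖F' t x‖ₑ ^ 2 * ENNReal.ofReal t ≤ S') :
    ∫⁻ x, (⨆ (t : ℝ) (_ : 0 < t), ‖F t x‖ₑ) ^ 2 ≤
      2 * (S ^ (1 / 2 : ℝ) * S' ^ (1 / 2 : ℝ)) := by
  have hmS : Measurable fun z : E × ℝ => ‖F z.2 z.1‖ₑ := (hcF.comp continuous_swap).measurable.enorm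
  have hmS' : Measurable fun z : E × ℝ => ‖F' z.2 z.1‖ₑ :=
    (hcF'.comp continuous_swap).measurable.enorm
  have hm1 : Measurable fun z : E × ℝ => ‖F z.2 z.1‖ₑ ^ 2 * ENNReal.ofReal z.2⁻¹ := by fun_prop
  have hm2 : Measurable fun z : E × ℝ => ‖F' z.2 z.1‖ₑ ^ 2 * ENNReal.ofReal z.2 := by fun_prop
  have hae : ∀ᵐ x, ∫⁻ t in Ioi 0, ‖F t x‖ₑ ^ 2 * ENNReal.ofReal t⁻¹ < ∞ :=
    ae_lt_top hm1.lintegral_prod_right' (ne_top_of_le_ne_top hSt hS)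
  have hpt : ∀ᵐ x, (⨆ (t : ℝ) (_ : 0 < t), ‖F t x‖ₑ) ^ 2 ≤
      2 * ∫⁻ t in Ioi 0, ‖F t x‖ₑ * ‖F' t x‖ₑ := by
    filter_upwards [hae] with x hx
    have hle : (⨆ (t : ℝ) (_ : 0 < t), ‖F t x‖ₑ) ≤
        (2 * ∫⁻ t in Ioi 0, ‖F t x‖ₑ * ‖F' t x‖ₑ) ^ (1 / 2 : ℝ) := by
      refine iSup₂_le fun t ht => ?_
      have h := enorm_sq_le_two_mul_lintegral (hder x) (hcF'.comp (Continuous.prodMk_left x)) hx.ne ht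
      rw [one_div, ENNReal.le_rpow_inv_iff (by norm_num)]
      simpa using h
    rw [one_div, ENNReal.le_rpow_inv_iff (by norm_num)] at hle
    simpa using hle
  calc ∫⁻ x, (⨆ (t : ℝ) (_ : 0 < t), ‖F t x‖ₑ) ^ 2
      ≤ ∫⁻ x, 2 * ∫⁻ t in Ioi 0, ‖F t x‖ₑ * ‖F' t x‖ₑ := lintegral_mono_ae hpt
    _ = 2 * ∫⁻ x, ∫⁻ t in Ioi 0, ‖F t x‖ₑ * ‖F' t x‖ₑ := lintegral_const_mul' _ _ (by norm_num)
    _ = 2 * ∫⁻ x, ∫⁻ t in Ioi (0 : ℝ), (‖F t x‖ₑ ^ 2 * ENNReal.ofReal t⁻¹) ^ (1 / 2 : ℝ) *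
          (‖F' t x‖ₑ ^ 2 * ENNReal.ofReal t) ^ (1 / 2 : ℝ) := by
        congr 1
        refine lintegral_congr fun x => setLIntegral_congr_fun measurableSet_Ioi fun t ht => ?_
        have h1 : ∀ a : ℝ≥0∞, (a ^ 2) ^ (1 / 2 : ℝ) = a := fun a => by
          rw [← ENNReal.rpow_ofNat, ← ENNReal.rpow_mul]; norm_num
        rw [ENNReal.mul_rpow_of_nonneg _ _ (by norm_num),
          ENNReal.mul_rpow_of_nonneg _ _ (by norm_num), h1, h1, mul_mul_mul_comm,
          ← ENNReal.mul_rpow_of_nonneg _ _ (by norm_num), ← ENNReal.ofReal_mul (inv_pos.2 ht).le,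
          inv_mul_cancel₀ (ne_of_gt ht)]
        simp
    _ ≤ 2 * (S ^ (1 / 2 : ℝ) * S' ^ (1 / 2 : ℝ)) := by
        gcongr
        have hm : Measurable fun z : E × ℝ => (‖F z.2 z.1‖ₑ ^ 2 * ENNReal.ofReal z.2⁻¹) ^ (1 / 2 : ℝ) *
          (‖F' z.2 z.1‖ₑ ^ 2 * ENNReal.ofReal z.2) ^ (1 / 2 : ℝ) := by fun_prop
        rw [← lintegral_prod (μ := volume) (ν := volume.restrict (Ioi 0)) _ hm.aemeasurable]
        refine (ENNReal.lintegral_mul_le_Lp_mul_Lq _ Real.HolderConjugate.two_two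
          (hm1.pow_const _).aemeasurable (hm2.pow_const _).aemeasurable).trans ?_
        have h1 : ∀ a : ℝ≥0∞, (a ^ (1 / 2 : ℝ)) ^ (2 : ℝ) = a := fun a => by
          rw [← ENNReal.rpow_mul]; norm_num
        simp only [h1]
        rw [lintegral_prod _ hm1.aemeasurable, lintegral_prod _ hm2.aemeasurable]
        gcongr

/-- A maximal multiplier theorem on `L²`: the square function estimate. -/
theorem lintegral_iSup_fourierInv_sq_le {μ : E → ℂ} (hμ : Differentiable ℝ μ)
    (hμ' : Continuous (fderiv ℝ μ)) {A : ℝ} (hA : ∀ ξ, ‖μ ξ‖ ≤ A) (hA' : ∀ ξ, ‖fderiv ℝ μ ξ‖ ≤ A)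
    {I₀ I₁ : ℝ≥0∞} (hI₀ : ∀ ξ, ∫⁻ t in Ioi (0 : ℝ), ‖μ (t • ξ)‖ₑ ^ 2 * ENNReal.ofReal t⁻¹ ≤ I₀)
    (hI₁ : ∀ ξ, ∫⁻ t in Ioi (0 : ℝ), ‖fderiv ℝ μ (t • ξ) ξ‖ₑ ^ 2 * ENNReal.ofReal t ≤ I₁)
    (hI₀t : I₀ ≠ ∞) (hI₁t : I₁ ≠ ∞) (g : 𝓢(E, ℂ)) :
    ∫⁻ x, (⨆ (t : ℝ) (_ : 0 < t), ‖𝓕⁻ (fun ξ => g ξ * μ (t • ξ)) x‖ₑ) ^ 2 ≤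
      2 * (I₀ ^ (1 / 2 : ℝ) * I₁ ^ (1 / 2 : ℝ)) * ∫⁻ ξ, ‖g ξ‖ₑ ^ 2 := by
  set F : ℝ → E → ℂ := fun t => 𝓕⁻ fun ξ => g ξ * μ (t • ξ) with hFdef
  set F' : ℝ → E → ℂ := fun t => 𝓕⁻ fun ξ => g ξ * fderiv ℝ μ (t • ξ) ξ with hFdef'
  have hc := hμ.continuous
  have hcG : Continuous fun z : ℝ × E => g z.2 * μ (z.1 • z.2) := by fun_prop
  have hcG' : Continuous fun z : ℝ × E => g z.2 * fderiv ℝ μ (z.1 • z.2) z.2 := by fun_prop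
  have hb : Integrable fun ξ => A * ‖g ξ‖ := (g.integrable (μ := volume)).norm.const_mul A
  have hb2 : MemLp (fun ξ => A * ‖g ξ‖) 2 := ((g.memLp 2 volume).norm).const_mul A
  have hb' : Integrable fun ξ => A * (‖ξ‖ * ‖g ξ‖) := (integrable_norm_mul_schwartz g).const_mul A
  have hb2' : MemLp (fun ξ => A * (‖ξ‖ * ‖g ξ‖)) 2 := (memLp_two_norm_mul_schwartz g).const_mul A
  have hbd : ∀ (t : ℝ) ξ, ‖g ξ * μ (t • ξ)‖ ≤ A * ‖g ξ‖ := fun t ξ => by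
    rw [norm_mul, mul_comm]; gcongr; exact hA _
  have hbd' : ∀ (t : ℝ) ξ, ‖g ξ * fderiv ℝ μ (t • ξ) ξ‖ ≤ A * (‖ξ‖ * ‖g ξ‖) := fun t ξ => by
    rw [norm_mul]
    calc ‖g ξ‖ * ‖fderiv ℝ μ (t • ξ) ξ‖ ≤ ‖g ξ‖ * (A * ‖ξ‖) := by
          gcongr
          exact (ContinuousLinearMap.le_opNorm _ _).trans (by gcongr; exact hA' _)
      _ = _ := by ring
  have hcF : Continuous fun z : ℝ × E => F z.1 z.2 :=
    continuous_fourierInv_param hb (fun t => hcG.comp (Continuous.prodMk_right t))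
      (fun ξ => hcG.comp (Continuous.prodMk_left ξ)) hbd
  have hcF' : Continuous fun z : ℝ × E => F' z.1 z.2 :=
    continuous_fourierInv_param hb' (fun t => hcG'.comp (Continuous.prodMk_right t))
      (fun ξ => hcG'.comp (Continuous.prodMk_left ξ)) hbd'
  have hfin : ∫⁻ ξ, ‖g ξ‖ₑ ^ 2 ≠ ∞ := by
    have h2 := eLpNorm_nnreal_pow_eq_lintegral (μ := (volume : Measure E)) (f := g)
      (p := 2) (by norm_num)
    simp only [NNReal.coe_ofNat, ENNReal.coe_ofNat, ENNReal.rpow_ofNat] at h2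
    rw [← h2]
    exact ENNReal.pow_ne_top (g.memLp 2 volume).eLpNorm_ne_top
  have hS : ∫⁻ x, ∫⁻ t in Ioi 0, ‖F t x‖ₑ ^ 2 * ENNReal.ofReal t⁻¹ ≤ I₀ * ∫⁻ ξ, ‖g ξ‖ₑ ^ 2 := by
    refine lintegral_lintegral_fourierInv_sq_le hb hb2 hcG hbd (by fun_prop) hI₀t fun ξ => ?_
    simp only [enorm_mul, mul_pow, mul_assoc]
    rw [lintegral_const_mul' _ _ (by simp), mul_comm]
    gcongr
    exact hI₀ ξ
  have hS' : ∫⁻ x, ∫⁻ t in Ioi 0, ‖F' t x‖ₑ ^ 2 * ENNReal.ofReal t ≤ I₁ * ∫⁻ ξ, ‖g ξ‖ₑ ^ 2 := by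
    refine lintegral_lintegral_fourierInv_sq_le hb' hb2' hcG' hbd' (by fun_prop) hI₁t fun ξ => ?_
    simp only [enorm_mul, mul_pow, mul_assoc]
    rw [lintegral_const_mul' _ _ (by simp), mul_comm]
    gcongr
    exact hI₁ ξ
  refine (lintegral_iSup_sq_le_of_hasDerivAt hcF hcF'
    (fun x t => hasDerivAt_fourierInv_dilate hμ hμ' hA hA' g x t)
    (ENNReal.mul_ne_top hI₀t hfin) hS hS').trans_eq ?_
  rw [ENNReal.mul_rpow_of_nonneg _ _ (by norm_num),
    ENNReal.mul_rpow_of_nonneg _ _ (by norm_num), mul_mul_mul_comm,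
    ← ENNReal.rpow_add_of_nonneg _ _ (by norm_num) (by norm_num)]
  norm_num
  ring

end MaximalMultiplier

/-! ### Maximal operators given by continuous compactly supported kernels. -/

section KernelMaximal

open Metric Filter

variable {E : Type*} [NormedAddCommGroup E] [InnerProductSpace ℝ E] [FiniteDimensional ℝ E]
  [MeasurableSpace E] [BorelSpace E]

/-- The maximal operator `sup_{t > 0} |∫ f(x - t y) K(y) dy|` with kernel `K`. -/
noncomputable def kernelMax (K f : E → ℂ) (x : E) : ℝ≥0∞ :=
  ⨆ (t : ℝ) (_ : 0 < t), ‖∫ y, f (x - t • y) * K y‖ₑ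

theorem map_sub_smul (x : E) {t : ℝ} (ht : 0 < t) :
    Measure.map (fun y : E => x - t • y) volume =
      ENNReal.ofReal (t ^ Module.finrank ℝ E)⁻¹ • volume := by
  have hx : Measure.map (fun z : E => x - z) volume = volume :=
    (volume.measurePreserving_sub_left x).map_eq
  have h : (fun y : E => x - t • y) = (fun z => x - z) ∘ (fun y => t • y) := rfl
  rw [h, ← Measure.map_map (by fun_prop) (by fun_prop), Measure.map_addHaar_smul _ ht.ne',
    Measure.map_smul, hx, abs_of_nonneg (by positivity)]

theorem lintegral_comp_sub_smul {g : E → ℝ≥0∞} (hg : Measurable g) (x : E) {t : ℝ} (ht : 0 < t) :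
    ∫⁻ y, g (x - t • y) =
      ENNReal.ofReal (t ^ Module.finrank ℝ E)⁻¹ * ∫⁻ z, g z := by
  have h : Measurable fun y : E => x - t • y := by fun_prop
  rw [← lintegral_map hg h, map_sub_smul x ht, lintegral_smul_measure, smul_eq_mul]

/-- Fourier inversion for `f` followed by Fubini. The pair `(ν, k)` is general because both
`(volume, K)`, for the kernels, and `(σ, 1)`, for the measure itself, are needed. -/
theorem fourierInv_mul_fourier_eq (ν : Measure E) [SFinite ν] {k : E → ℂ} (hk : Integrable k ν)
    (f : 𝓢(E, ℂ)) (x : E) (t : ℝ) :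
    𝓕⁻ (fun ξ => 𝓕 (f : E → ℂ) ξ *
      ∫ y, (Real.fourierChar (-(inner ℝ y (t • ξ))) : ℂ) * k y ∂ν) x =
      ∫ y, f (x - t • y) * k y ∂ν := by
  have hinv : ∀ z, f z = ∫ ξ, (Real.fourierChar (inner ℝ ξ z) : ℂ) * 𝓕 f ξ := by
    intro z
    have h := congrArg (fun g : 𝓢(E, ℂ) => g z) (FourierTransform.fourierInv_fourier_eq (F := 𝓢(E, ℂ)) f)
    change _ = f z at h
    rw [← h, SchwartzMap.fourierInv_coe, Real.fourierInv_eq]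
    rfl
  have hint : Integrable (fun z : E × E =>
      ((Real.fourierChar (inner ℝ z.2 (x - t • z.1)) : ℂ) * 𝓕 f z.2) * k z.1)
      (ν.prod volume) := by
    have h1 : Integrable (fun z : E × E => k z.1 * (𝓕 f) z.2) (ν.prod volume) :=
      hk.mul_prod (𝓕 f).integrable
    have hc : Continuous fun z : E × E =>
      (Real.fourierChar (inner ℝ z.2 (x - t • z.1)) : ℂ) := by fun_prop
    refine (h1.bdd_mul hc.aestronglyMeasurable (c := 1) ?_).congr ?_
    · filter_upwards with z
      exact (Circle.norm_coe _).le
    · filter_upwards with z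
      ring
  have hchar : ∀ ξ y : E, (Real.fourierChar (inner ℝ ξ (x - t • y)) : ℂ) =
      (Real.fourierChar (inner ℝ ξ x) : ℂ) * (Real.fourierChar (-(inner ℝ y (t • ξ))) : ℂ) := by
    intro ξ y
    rw [← Circle.coe_mul, ← AddChar.map_add_eq_mul]
    congr 2
    rw [inner_sub_right, inner_smul_right, inner_smul_right, real_inner_comm ξ y, sub_eq_add_neg]
  symm
  calc ∫ y, f (x - t • y) * k y ∂ν
      = ∫ y, (∫ ξ, ((Real.fourierChar (inner ℝ ξ (x - t • y)) : ℂ) * 𝓕 f ξ) * k y) ∂ν := by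
        congr 1; ext y; rw [hinv, integral_mul_const]
    _ = ∫ ξ, ∫ y, ((Real.fourierChar (inner ℝ ξ (x - t • y)) : ℂ) * 𝓕 f ξ) * k y ∂ν :=
        integral_integral_swap hint
    _ = _ := by
        rw [Real.fourierInv_eq]
        congr 1; ext ξ
        rw [Circle.smul_def, smul_eq_mul, ← integral_const_mul, ← integral_const_mul]
        congr 1; ext y
        rw [hchar, SchwartzMap.fourier_coe]
        ring

theorem kernelMax_le_maxFn {K f : E → ℂ} (hf : Measurable f) {B D : ℝ}
    (hD : 0 < D) (hKB : ∀ y, ‖K y‖ ≤ B) (hKD : ∀ y, y ∉ ball 0 D → K y = 0) (x : E) :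
    kernelMax K f x ≤ ENNReal.ofReal B * volume (ball (0 : E) D) * maxFn (fun y => ‖f y‖ₑ) x := by
  refine iSup₂_le fun t ht => ?_
  have htD : 0 < t * D := mul_pos ht hD
  calc ‖∫ y, f (x - t • y) * K y‖ₑ ≤ ∫⁻ y, ‖f (x - t • y) * K y‖ₑ :=
        enorm_integral_le_lintegral_enorm _
    _ ≤ ∫⁻ y, ENNReal.ofReal B * (ball x (t * D)).indicator (fun z => ‖f z‖ₑ) (x - t • y) := by
        refine lintegral_mono fun y => ?_
        simp only [enorm_mul]
        by_cases hy : y ∈ ball 0 D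
        · rw [indicator_of_mem, mul_comm]
          · gcongr
            rw [← ofReal_norm]
            exact ENNReal.ofReal_le_ofReal (hKB y)
          · rw [mem_ball_zero_iff] at hy
            rw [mem_ball, dist_eq_norm, sub_sub_cancel_left, norm_neg, norm_smul,
              Real.norm_of_nonneg ht.le]
            gcongr
        · simp [hKD y hy]
    _ = ENNReal.ofReal B * (ENNReal.ofReal (t ^ Module.finrank ℝ E)⁻¹ *
          ∫⁻ z in ball x (t * D), ‖f z‖ₑ) := by
        rw [lintegral_const_mul' _ _ (by simp), lintegral_comp_sub_smul
          (hf.enorm.indicator measurableSet_ball) x ht, lintegral_indicator measurableSet_ball]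
    _ ≤ ENNReal.ofReal B * (ENNReal.ofReal (t ^ Module.finrank ℝ E)⁻¹ *
          (volume (ball x (t * D)) * maxFn (fun y => ‖f y‖ₑ) x)) := by
        gcongr
        exact setLIntegral_ball_le_maxFn _ x htD
    _ = _ := by
        rw [Measure.addHaar_ball_mul_of_pos volume x ht, ← mul_assoc (ENNReal.ofReal _⁻¹),
          ← mul_assoc (ENNReal.ofReal _⁻¹), ← ENNReal.ofReal_mul (by positivity),
          inv_mul_cancel₀ (by positivity), ENNReal.ofReal_one, one_mul, mul_assoc]

theorem integral_comp_sub_smul_mul_eq_convolution (K f : E → ℂ) (x : E) {t : ℝ} (ht : 0 < t) :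
    ∫ y, f (x - t • y) * K y =
      (convolution f (fun u => ((t ^ Module.finrank ℝ E)⁻¹ : ℝ) • K (t⁻¹ • u))
        (ContinuousLinearMap.mul ℂ ℂ) volume) x := by
  have h1 := Measure.integral_comp_smul (μ := (volume : Measure E))
    (fun u => f (x - u) * K (t⁻¹ • u)) t
  simp only [smul_smul, inv_mul_cancel₀ ht.ne', one_smul] at h1
  rw [h1, convolution, abs_of_nonneg (by positivity), ← integral_smul,
    ← integral_sub_left_eq_self _ _ x]
  congr 1
  ext z
  simp
  ring

theorem lowerSemicontinuous_kernelMax {K f : E → ℂ} (hK : Continuous K) (hKc : HasCompactSupport K)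
    (hf : LocallyIntegrable f) : LowerSemicontinuous (kernelMax K f) := by
  refine lowerSemicontinuous_iSup fun t => lowerSemicontinuous_iSup fun ht => ?_
  refine (Continuous.enorm ?_).lowerSemicontinuous
  simp only [integral_comp_sub_smul_mul_eq_convolution K f _ ht]
  refine HasCompactSupport.continuous_convolution_right _ ?_ hf (by fun_prop)
  exact (hKc.comp_smul (inv_pos.2 ht).ne').smul_left (f := fun _ => ((t ^ Module.finrank ℝ E)⁻¹ : ℝ))

/-- Countable subadditivity of `kernelMax` along disjoint pieces of a bounded function. -/
theorem kernelMax_le_tsum {ι : Type*} [Countable ι] {K f : E → ℂ} (hK : Integrable K)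
    (hf : Measurable f) {M : ℝ} (hM : ∀ x, ‖f x‖ ≤ M) {s : ι → Set E}
    (hs : ∀ i, MeasurableSet (s i)) (hd : Pairwise fun i j => Disjoint (s i) (s j))
    (hsupp : ∀ x, f x ≠ 0 → ∃ i, x ∈ s i) (x : E) :
    kernelMax K f x ≤ ∑' i, kernelMax K ((s i).indicator f) x := by
  refine iSup₂_le fun t ht => ?_
  have hdecomp : ∀ z, HasSum (fun i => (s i).indicator f z) (f z) := by
    intro z
    by_cases hz : ∃ i, z ∈ s i
    · obtain ⟨i, hi⟩ := hz
      have : (s i).indicator f z = f z := indicator_of_mem hi f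
      rw [← this]
      refine hasSum_single i fun j hj => indicator_of_notMem (fun hj' => ?_) f
      exact (hd hj).le_bot ⟨hj', hi⟩
    · have h0 : f z = 0 := by
        by_contra h
        exact hz (hsupp z h)
      have : (fun i => (s i).indicator f z) = fun _ => 0 := by
        ext i; by_cases hi : z ∈ s i <;> simp [hi, h0]
      rw [this, h0]
      exact hasSum_zero
  have hmeas : ∀ i, AEStronglyMeasurable (fun y => (s i).indicator f (x - t • y) * K y) := fun i =>
    (((hf.indicator (hs i)).comp (by fun_prop : Measurable fun y => x - t • y)).aestronglyMeasurable).mul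
      hK.aestronglyMeasurable
  have henorm : ∀ z, ∑' i, ‖(s i).indicator f z‖ₑ = ‖f z‖ₑ := by
    intro z
    by_cases hz : ∃ i, z ∈ s i
    · obtain ⟨i, hi⟩ := hz
      rw [tsum_eq_single i fun j hj => ?_, indicator_of_mem hi]
      rw [indicator_of_notMem fun hj' => (hd hj).le_bot ⟨hj', hi⟩, enorm_zero]
    · have h0 : f z = 0 := by
        by_contra h
        exact hz (hsupp z h)
      have : ∀ i, (s i).indicator f z = 0 := fun i => by
        by_cases hi : z ∈ s i <;> simp [hi, h0]
      simp [this, h0]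
  have hfin : ∑' i, ∫⁻ y, ‖(s i).indicator f (x - t • y) * K y‖ₑ ≠ ∞ := by
    rw [← lintegral_tsum fun i => (hmeas i).enorm]
    simp only [enorm_mul, ENNReal.tsum_mul_right, henorm]
    refine ne_top_of_le_ne_top (ENNReal.mul_ne_top ENNReal.ofReal_ne_top hK.2.ne)
      (b := ENNReal.ofReal M * ∫⁻ y, ‖K y‖ₑ) ?_
    rw [← lintegral_const_mul' _ _ (by simp)]
    gcongr with y
    rw [← ofReal_norm]
    exact ENNReal.ofReal_le_ofReal (hM _)
  calc ‖∫ y, f (x - t • y) * K y‖ₑ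
      = ‖∑' i, ∫ y, (s i).indicator f (x - t • y) * K y‖ₑ := by
        rw [← integral_tsum hmeas hfin]
        congr 2; ext y
        rw [tsum_mul_right, (hdecomp _).tsum_eq]
    _ ≤ ∑' i, ‖∫ y, (s i).indicator f (x - t • y) * K y‖ₑ := enorm_tsum_le_tsum_enorm
    _ ≤ _ := by
        gcongr with i
        exact le_iSup₂_of_le t ht le_rfl

theorem lintegral_enorm_sq_eq_ofReal {f : E → ℂ} (hf : MemLp f 2) :
    ∫⁻ x, ‖f x‖ₑ ^ 2 = ENNReal.ofReal (‖hf.toLp f‖ ^ 2) := by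
  have h2 := eLpNorm_nnreal_pow_eq_lintegral (μ := (volume : Measure E)) (f := f)
    (p := 2) (by norm_num)
  simp only [NNReal.coe_ofNat, ENNReal.coe_ofNat, ENNReal.rpow_ofNat] at h2
  rw [← h2, Lp.norm_toLp, ENNReal.ofReal_pow ENNReal.toReal_nonneg,
    ENNReal.ofReal_toReal hf.eLpNorm_ne_top]

theorem kernelMax_sq_le_iff {K f : E → ℂ} {x : E} {c : ℝ≥0∞} :
    kernelMax K f x ^ 2 ≤ c ↔ ∀ t : ℝ, 0 < t → ‖∫ y, f (x - t • y) * K y‖ₑ ^ 2 ≤ c := by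
  have h : ∀ a : ℝ≥0∞, a ^ 2 ≤ c ↔ a ≤ c ^ (1 / 2 : ℝ) := fun a => by
    rw [one_div, ENNReal.le_rpow_inv_iff (by norm_num)]; simp
  simp only [h, kernelMax, iSup_le_iff]

/-- For fixed `x` and `t` the average is a continuous functional of `f ∈ L²`, by Cauchy–Schwarz
against `K`. This carries the maximal inequality from Schwartz functions to `L²`. -/
theorem tendsto_integral_comp_sub_smul {K f : E → ℂ} (hK : MemLp K 2) (hf : MemLp f 2)
    {F : ℕ → E → ℂ} (hF : ∀ i, MemLp (F i) 2)
    (hlim : Tendsto (fun i => (hF i).toLp (F i)) atTop (nhds (hf.toLp f))) (x : E) {t : ℝ}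
    (ht : 0 < t) :
    Tendsto (fun i => ∫ y, F i (x - t • y) * K y) atTop (nhds (∫ y, f (x - t • y) * K y)) := by
  set c : ℝ≥0∞ := ENNReal.ofReal (t ^ Module.finrank ℝ E)⁻¹
  have hc : c ≠ 0 := by simp only [c, ne_eq, ENNReal.ofReal_eq_zero, not_le]; positivity
  have haesm : ∀ {g : E → ℂ}, MemLp g 2 →
      AEStronglyMeasurable g (Measure.map (fun y => x - t • y) volume) := fun hg => by
    rw [map_sub_smul x ht]
    exact hg.1.smul_measure _
  have hcomp : ∀ {g : E → ℂ}, MemLp g 2 → MemLp (fun y => g (x - t • y)) 2 := fun hg => by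
    refine (memLp_map_measure_iff (haesm hg) (by fun_prop)).1 ?_
    rw [map_sub_smul x ht]
    exact hg.smul_measure ENNReal.ofReal_ne_top
  have hnorm : ∀ {g : E → ℂ}, MemLp g 2 →
      eLpNorm (fun y => g (x - t • y)) 2 = c ^ (1 / 2 : ℝ) * eLpNorm g 2 := fun {g} hg => by
    have h := eLpNorm_map_measure (p := 2) (haesm hg) (by fun_prop)
    rw [map_sub_smul x ht, eLpNorm_smul_measure_of_ne_zero hc] at h
    refine h.symm.trans ?_
    simp
  refine tendsto_integral_of_L1' _ ((hcomp hf).1.mul hK.1)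
    (Eventually.of_forall fun i => (hcomp (hF i)).integrable_mul hK) ?_
  have h0 : Tendsto (fun i => c ^ (1 / 2 : ℝ) * eLpNorm (F i - f) 2 * eLpNorm K 2) atTop
      (nhds 0) := by
    have h1 := (Lp.tendsto_Lp_iff_tendsto_eLpNorm'' F hF f hf).1 hlim
    have h2 := ENNReal.Tendsto.mul_const (ENNReal.Tendsto.const_mul (a := c ^ (1 / 2 : ℝ)) h1
      (Or.inr (by simp [c]))) (Or.inr hK.eLpNorm_ne_top)
    simpa using h2
  refine tendsto_of_tendsto_of_tendsto_of_le_of_le tendsto_const_nhds h0 (fun _ => zero_le)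
    fun i => ?_
  have h3 : (fun y => F i (x - t • y) * K y) - (fun y => f (x - t • y)) * K =
      (fun y => (F i - f) (x - t • y)) • K := by
    ext y; simp [sub_mul]
  simp only
  rw [h3, ← hnorm ((hF i).sub hf)]
  exact eLpNorm_smul_le_mul_eLpNorm hK.1 (hcomp ((hF i).sub hf)).1

/-- The `L²` bound for `kernelMax`. -/
theorem lintegral_kernelMax_sq_le {K : E → ℂ} (hK : Continuous K) (hKc : HasCompactSupport K)
    {I₀ I₁ : ℝ≥0∞} (hI₀t : I₀ ≠ ∞) (hI₁t : I₁ ≠ ∞)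
    (hI₀ : ∀ ξ, ∫⁻ t in Ioi (0 : ℝ), ‖𝓕 K (t • ξ)‖ₑ ^ 2 * ENNReal.ofReal t⁻¹ ≤ I₀)
    (hI₁ : ∀ ξ, ∫⁻ t in Ioi (0 : ℝ), ‖fderiv ℝ (𝓕 K) (t • ξ) ξ‖ₑ ^ 2 * ENNReal.ofReal t ≤ I₁)
    {f : E → ℂ} (hf : MemLp f 2) :
    ∫⁻ x, kernelMax K f x ^ 2 ≤
      2 * (I₀ ^ (1 / 2 : ℝ) * I₁ ^ (1 / 2 : ℝ)) * ∫⁻ x, ‖f x‖ₑ ^ 2 := by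
  set C : ℝ≥0∞ := 2 * (I₀ ^ (1 / 2 : ℝ) * I₁ ^ (1 / 2 : ℝ)) with hC
  have hCt : C ≠ ∞ := ENNReal.mul_ne_top (by norm_num) (ENNReal.mul_ne_top
    (ENNReal.rpow_ne_top_of_nonneg (by norm_num) hI₀t)
    (ENNReal.rpow_ne_top_of_nonneg (by norm_num) hI₁t))
  have hKi : Integrable K := hK.integrable_of_hasCompactSupport hKc
  have hKi' : Integrable fun v => ‖v‖ * ‖K v‖ :=
    (by fun_prop : Continuous fun v => ‖v‖ * ‖K v‖).integrable_of_hasCompactSupport hKc.norm.mul_left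
  have hd : Differentiable ℝ (𝓕 K) := Real.differentiable_fourier hKi hKi'
  have hint : Integrable (VectorFourier.fourierSMulRight (innerSL ℝ) K) := by
    refine (hKi'.const_mul (2 * Real.pi)).mono' ?_ ?_
    · exact hK.aestronglyMeasurable.fourierSMulRight
    · filter_upwards with v
      refine (VectorFourier.norm_fourierSMulRight_le _ _ _).trans ?_
      have : ‖innerSL ℝ (E := E)‖ ≤ 1 := norm_innerSL_le ℝ
      calc 2 * Real.pi * ‖innerSL ℝ (E := E)‖ * ‖v‖ * ‖K v‖
          ≤ 2 * Real.pi * 1 * ‖v‖ * ‖K v‖ := by gcongr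
        _ = _ := by ring
  have hfd := Real.fderiv_fourier hKi hKi'
  have hd' : Continuous (fderiv ℝ (𝓕 K)) := by
    rw [hfd]
    exact VectorFourier.fourierIntegral_continuous Real.continuous_fourierChar
      (by exact continuous_inner) hint
  -- On Schwartz functions the kernel averages are the multiplier transforms of `𝓕 K`, which is of
  -- class `C¹` with bounded derivative since `K` has compact support.
  have hSch : ∀ g : 𝓢(E, ℂ), ∫⁻ x, kernelMax K g x ^ 2 ≤ C * ∫⁻ x, ‖g x‖ₑ ^ 2 := by
    intro g
    have h1 := lintegral_iSup_fourierInv_sq_le hd hd'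
      (A := max (∫ v, ‖K v‖) (∫ v, ‖VectorFourier.fourierSMulRight (innerSL ℝ) K v‖))
      (fun ξ => (VectorFourier.norm_fourierIntegral_le_integral_norm _ _ _ _ _).trans
        (le_max_left _ _))
      (fun ξ => by
        rw [hfd]
        exact (VectorFourier.norm_fourierIntegral_le_integral_norm _ _ _ _ _).trans
          (le_max_right _ _))
      hI₀ hI₁ hI₀t hI₁t (𝓕 g)
    have h2 : ∫⁻ ξ, ‖𝓕 g ξ‖ₑ ^ 2 = ∫⁻ x, ‖g x‖ₑ ^ 2 :=
      lintegral_enorm_fourier_sq g.integrable (g.memLp 2 volume)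
    rw [h2] at h1
    refine le_trans (le_of_eq ?_) h1
    refine lintegral_congr fun x => ?_
    congr 1
    refine iSup_congr fun t => iSup_congr fun _ => ?_
    rw [← fourierInv_mul_fourier_eq volume hKi g x t]
    rfl
  have hdense := SchwartzMap.denseRange_toLpCLM (E := E) (F := ℂ) (p := 2) (μ := volume)
    ENNReal.ofNat_ne_top
  obtain ⟨u, hu, hulim⟩ := mem_closure_iff_seq_limit.1 (hdense (hf.toLp f))
  choose g hg using hu
  have hlim : Tendsto (fun i => ((g i).memLp 2 volume).toLp (g i)) atTop (nhds (hf.toLp f)) := by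
    convert hulim using 2 with i
    rw [← hg i]
    rfl
  have hK2 : MemLp K 2 := hK.memLp_of_hasCompactSupport hKc
  -- Convergence for each individual `t` gives an inequality for the supremum, which is all that
  -- Fatou's lemma requires.
  have hpt : ∀ x, kernelMax K f x ^ 2 ≤ liminf (fun i => kernelMax K (g i) x ^ 2) atTop := by
    intro x
    rw [kernelMax_sq_le_iff]
    intro t ht
    have h1 := tendsto_integral_comp_sub_smul hK2 hf (fun i => (g i).memLp 2 volume) hlim x ht
    have h2 : Tendsto (fun i => ‖∫ y, g i (x - t • y) * K y‖ₑ ^ 2) atTop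
        (nhds (‖∫ y, f (x - t • y) * K y‖ₑ ^ 2)) :=
      ((ENNReal.continuous_pow 2).tendsto _).comp h1.enorm
    rw [← h2.liminf_eq]
    refine liminf_le_liminf (Eventually.of_forall fun i => ?_)
    exact kernelMax_sq_le_iff.1 le_rfl t ht
  have hmeas : ∀ i, Measurable fun x => kernelMax K (g i) x ^ 2 := fun i =>
    (lowerSemicontinuous_kernelMax hK hKc
      ((g i).integrable (μ := volume)).locallyIntegrable).measurable.pow_const 2
  have hR : Tendsto (fun i => C * ∫⁻ x, ‖g i x‖ₑ ^ 2) atTop (nhds (C * ∫⁻ x, ‖f x‖ₑ ^ 2)) := by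
    refine ENNReal.Tendsto.const_mul ?_ (Or.inr hCt)
    rw [lintegral_enorm_sq_eq_ofReal hf]
    simp only [lintegral_enorm_sq_eq_ofReal ((g _).memLp 2 volume)]
    exact (ENNReal.continuous_ofReal.tendsto _).comp (hlim.norm.pow 2)
  calc ∫⁻ x, kernelMax K f x ^ 2
      ≤ ∫⁻ x, liminf (fun i => kernelMax K (g i) x ^ 2) atTop := lintegral_mono hpt
    _ ≤ liminf (fun i => ∫⁻ x, kernelMax K (g i) x ^ 2) atTop := lintegral_liminf_le hmeas
    _ ≤ liminf (fun i => C * ∫⁻ x, ‖g i x‖ₑ ^ 2) atTop :=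
        liminf_le_liminf (Eventually.of_forall fun i => hSch (g i))
    _ = _ := hR.liminf_eq

end KernelMaximal

/-! ### Mollifiers with vanishing moments, and convolution with `σ`. -/

section Mollifier

open Metric Filter
open scoped ContDiff

variable {E : Type*} [NormedAddCommGroup E] [InnerProductSpace ℝ E] [FiniteDimensional ℝ E]
  [MeasurableSpace E] [BorelSpace E]

theorem hasCompactSupport_schwartz_convolution {f g : 𝓢(E, ℂ)} (hf : HasCompactSupport f)
    (hg : HasCompactSupport g) :
    HasCompactSupport (SchwartzMap.convolution (ContinuousLinearMap.mul ℂ ℂ) f g) := by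
  have h : (SchwartzMap.convolution (ContinuousLinearMap.mul ℂ ℂ) f g : E → ℂ) =
      MeasureTheory.convolution f g (ContinuousLinearMap.mul ℂ ℂ) volume :=
    funext fun x => SchwartzMap.convolution_apply _ f g x
  rw [h]
  exact HasCompactSupport.convolution _ hf hg

variable (E) in
theorem exists_schwartz_bump :
    ∃ η : 𝓢(E, ℂ), HasCompactSupport η ∧ ∫ x, η x = 1 := by
  let b : ContDiffBump (0 : E) := ⟨1, 2, one_pos, one_lt_two⟩
  have hc : HasCompactSupport (Complex.ofRealCLM ∘ b.normed volume) :=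
    b.hasCompactSupport_normed.comp_left rfl
  have hs : ContDiff ℝ ∞ (Complex.ofRealCLM ∘ b.normed volume) :=
    Complex.ofRealCLM.contDiff.comp b.contDiff_normed
  refine ⟨hc.toSchwartzMap hs, hc, ?_⟩
  have : ∀ x, hc.toSchwartzMap hs x = ((b.normed volume x : ℝ) : ℂ) := fun x => rfl
  simp only [this]
  rw [integral_complex_ofReal, b.integral_normed, Complex.ofReal_one]

/-- Induction on `1 - (1 - a)(1 - b) = a + b - a b`, the product of transforms being the transform
of a convolution. When `𝓕 η 0 = 1` this makes `1 - 𝓕 φ` vanish to order `N` at the origin while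
keeping compact support. -/
theorem exists_one_sub_fourier_eq_pow {η : 𝓢(E, ℂ)} (hη : HasCompactSupport η) (N : ℕ) :
    ∃ φ : 𝓢(E, ℂ), HasCompactSupport φ ∧ ∀ ξ, 1 - 𝓕 φ ξ = (1 - 𝓕 η ξ) ^ N := by
  induction N with
  | zero => exact ⟨0, HasCompactSupport.zero, fun ξ => by simp [FourierTransform.fourier_zero]⟩
  | succ N ih =>
    obtain ⟨φ, hφ, h⟩ := ih
    refine ⟨η + φ + (-1 : ℂ) • SchwartzMap.convolution (ContinuousLinearMap.mul ℂ ℂ) η φ, ?_, fun ξ => ?_⟩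
    · exact (hη.add hφ).add ((hasCompactSupport_schwartz_convolution hη hφ).smul_left (f := fun _ => -1))
    · rw [pow_succ, ← h, FourierTransform.fourier_add, FourierTransform.fourier_add,
        FourierTransform.fourier_smul,
        SchwartzMap.fourier_convolution]
      simp
      ring

theorem fourier_zero_eq_integral (f : E → ℂ) : 𝓕 f 0 = ∫ x, f x := by
  simp [Real.fourier_eq]

/-- A compactly supported mollifier with vanishing moments, expressed through its
Fourier transform. -/
theorem exists_mollifier (N : ℕ) (hN : 1 ≤ N) :
    ∃ φ : 𝓢(E, ℂ), HasCompactSupport φ ∧ ∫ x, φ x = 1 ∧ ∃ C : ℝ, 0 ≤ C ∧ ∀ ξ,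
      ‖1 - 𝓕 φ ξ‖ ≤ C * ‖ξ‖ ^ N ∧ ‖fderiv ℝ (𝓕 φ : 𝓢(E, ℂ)) ξ‖ ≤ C * ‖ξ‖ ^ (N - 1) ∧
      (1 + ‖ξ‖) * ‖𝓕 φ ξ‖ ≤ C ∧ ‖ξ‖ * ‖fderiv ℝ (𝓕 φ : 𝓢(E, ℂ)) ξ‖ ≤ C := by
  obtain ⟨η, hη, hη1⟩ := exists_schwartz_bump E
  obtain ⟨φ, hφ, h⟩ := exists_one_sub_fourier_eq_pow hη N
  have hη0 : 𝓕 η 0 = 1 := by rw [SchwartzMap.fourier_coe, fourier_zero_eq_integral, hη1]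
  obtain ⟨L, hL⟩ := (𝓕 η).decay 0 1
  have hLd : ∀ ξ, ‖fderiv ℝ (𝓕 η : 𝓢(E, ℂ)) ξ‖ ≤ L := fun ξ => by
    have := hL.2 ξ
    rwa [pow_zero, one_mul, ← norm_iteratedFDeriv_fderiv, norm_iteratedFDeriv_zero] at this
  have hdη : Differentiable ℝ (𝓕 η : 𝓢(E, ℂ)) := (𝓕 η).differentiable
  -- `𝓕 η` equals 1 at the origin and is Lipschitz; the `N`-th power of this bound is the vanishing
  -- of order `N`.
  have hlin : ∀ ξ, ‖1 - 𝓕 η ξ‖ ≤ L * ‖ξ‖ := fun ξ => by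
    have := convex_univ.norm_image_sub_le_of_norm_fderiv_le (𝕜 := ℝ) (f := (𝓕 η : 𝓢(E, ℂ))) (C := L)
      (fun x _ => hdη x) (fun x _ => hLd x) (mem_univ ξ) (mem_univ 0)
    simpa [hη0] using this
  obtain ⟨C₀, hC₀⟩ := (𝓕 φ).decay 0 0
  obtain ⟨C₁, hC₁⟩ := (𝓕 φ).decay 1 0
  obtain ⟨C₂, hC₂⟩ := (𝓕 φ).decay 1 1
  have hL0 := hL.1.le
  refine ⟨φ, hφ, ?_, L ^ N + N * L ^ N + C₀ + C₁ + C₂, ?_, fun ξ => ⟨?_, ?_, ?_, ?_⟩⟩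
  · have := h 0
    rw [hη0, sub_self, zero_pow (by omega), sub_eq_zero] at this
    rw [this, SchwartzMap.fourier_coe, fourier_zero_eq_integral]
  · have := hC₀.1; have := hC₁.1; have := hC₂.1
    positivity
  · have := hC₀.1; have := hC₁.1; have := hC₂.1
    rw [h, norm_pow]
    calc ‖1 - 𝓕 η ξ‖ ^ N ≤ (L * ‖ξ‖) ^ N := by gcongr; exact hlin ξ
      _ = (L ^ N) * ‖ξ‖ ^ N := by ring
      _ ≤ _ := by
        gcongr
        have : (0 : ℝ) ≤ N * L ^ N := by positivity
        linarith
  · have := hC₀.1; have := hC₁.1; have := hC₂.1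
    have hφη : (⇑(𝓕 φ : 𝓢(E, ℂ))) = fun ξ => 1 - (1 - 𝓕 η ξ) ^ N := by
      ext ξ; rw [← h]; ring
    have hd : HasFDerivAt (⇑(𝓕 φ : 𝓢(E, ℂ)))
        (((N : ℂ) * (1 - 𝓕 η ξ) ^ (N - 1)) • fderiv ℝ (𝓕 η : 𝓢(E, ℂ)) ξ) ξ := by
      rw [hφη]
      have h1 : HasFDerivAt (fun ξ => 1 - 𝓕 η ξ) (-fderiv ℝ (𝓕 η : 𝓢(E, ℂ)) ξ) ξ :=
        (hdη ξ).hasFDerivAt.const_sub 1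
      have h2 := (h1.pow N).const_sub 1
      rw [smul_neg, neg_neg, nsmul_eq_mul] at h2
      exact h2
    rw [hd.fderiv, norm_smul, norm_mul, norm_pow, Complex.norm_natCast]
    calc (N : ℝ) * ‖1 - 𝓕 η ξ‖ ^ (N - 1) * ‖fderiv ℝ (𝓕 η : 𝓢(E, ℂ)) ξ‖
        ≤ N * (L * ‖ξ‖) ^ (N - 1) * L := by gcongr; exacts [hlin ξ, hLd ξ]
      _ = N * L ^ N * ‖ξ‖ ^ (N - 1) := by
        obtain ⟨k, rfl⟩ : ∃ k, N = k + 1 := ⟨N - 1, by omega⟩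
        simp only [Nat.add_sub_cancel]; ring
      _ ≤ _ := by
        gcongr
        have : (0 : ℝ) ≤ L ^ N := by positivity
        linarith
  · have h0 := hC₀.2 ξ
    have h1 := hC₁.2 ξ
    simp only [pow_zero, norm_iteratedFDeriv_zero, one_mul, pow_one] at h0 h1
    have : (0 : ℝ) ≤ L ^ N + N * L ^ N := by positivity
    have := hC₂.1
    linarith
  · have h2 := hC₂.2 ξ
    rw [pow_one, ← norm_iteratedFDeriv_fderiv, norm_iteratedFDeriv_zero] at h2
    have := hC₀.1; have := hC₁.1
    have : (0 : ℝ) ≤ L ^ N + N * L ^ N := by positivity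
    linarith

/-- The `L¹`-normalized dilation `x ↦ r ^ d φ(r x)`. -/
noncomputable def dilate (r : ℝ) (φ : E → ℂ) (x : E) : ℂ :=
  (r ^ Module.finrank ℝ E : ℝ) • φ (r • x)

theorem continuous_dilate (r : ℝ) {φ : E → ℂ} (hφ : Continuous φ) : Continuous (dilate r φ) := by
  unfold dilate; fun_prop

theorem integral_mul_dilate {r : ℝ} (hr : 0 < r) (φ F : E → ℂ) :
    ∫ x, F x * dilate r φ x = ∫ x, F (r⁻¹ • x) * φ x := by
  have h := Measure.integral_comp_smul (μ := (volume : Measure E))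
    (fun u => F (r⁻¹ • u) * φ u) r
  simp only [smul_smul, inv_mul_cancel₀ hr.ne', one_smul] at h
  have h2 : ∀ x, F x * dilate r φ x = (r ^ Module.finrank ℝ E : ℝ) • (F x * φ (r • x)) := by
    intro x; simp only [dilate, Complex.real_smul]; ring
  simp only [h2]
  rw [integral_smul, h, smul_smul, abs_of_nonneg (by positivity), mul_inv_cancel₀ (by positivity),
    one_smul]

theorem fourier_dilate {r : ℝ} (hr : 0 < r) (φ : E → ℂ) (ξ : E) :
    𝓕 (dilate r φ) ξ = 𝓕 φ (r⁻¹ • ξ) := by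
  have h := integral_mul_dilate hr φ (fun x => ((Real.fourierChar (-(inner ℝ x ξ)) : Circle) : ℂ))
  simp only [Real.fourier_eq, Circle.smul_def, smul_eq_mul]
  rw [h]
  simp only [inner_smul_left, inner_smul_right]
  rfl

/-- Convolution of a function with a measure. -/
noncomputable def smear (σ : Measure E) (g : E → ℂ) (y : E) : ℂ := ∫ z, g (y - z) ∂σ

variable {σ : Measure E} [IsFiniteMeasure σ]

theorem continuous_smear {g : E → ℂ} (hg : Continuous g) {B : ℝ} (hB : ∀ y, ‖g y‖ ≤ B) :
    Continuous (smear σ g) := by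
  refine continuous_of_dominated (bound := fun _ => B) (fun y => ?_) (fun y => ?_)
    (integrable_const B) ?_
  · exact (by fun_prop : Continuous fun z => g (y - z)).aestronglyMeasurable
  · filter_upwards with z
    exact hB _
  · filter_upwards with z
    fun_prop

theorem norm_smear_le {g : E → ℂ} {B D : ℝ} (hB : ∀ y, ‖g y‖ ≤ B)
    (hD : ∀ y, y ∉ ball 0 D → g y = 0) (y : E) :
    ‖smear σ g y‖ ≤ B * σ.real (ball y D) := by
  have h : ∫ z, g (y - z) ∂σ = ∫ z in ball y D, g (y - z) ∂σ := by
    rw [setIntegral_eq_integral_of_forall_compl_eq_zero]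
    intro z hz
    apply hD
    rwa [mem_ball_zero_iff, ← dist_eq_norm, dist_comm]
  rw [smear, h]
  exact norm_setIntegral_le_of_norm_le_const (measure_lt_top _ _) fun z _ => hB _

theorem smear_eq_zero {g : E → ℂ} {R D : ℝ} (hσ : σ (closedBall 0 R)ᶜ = 0)
    (hD : ∀ y, y ∉ ball 0 D → g y = 0) {y : E} (hy : y ∉ ball 0 (R + D)) : smear σ g y = 0 := by
  refine integral_eq_zero_of_ae ?_
  have h : ∀ᵐ z ∂σ, z ∈ closedBall (0 : E) R := by
    rw [ae_iff]; exact hσ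
  filter_upwards [h] with z hz
  apply hD
  rw [mem_ball_zero_iff, not_lt] at hy ⊢
  rw [mem_closedBall_zero_iff] at hz
  have := norm_sub_norm_le y z
  linarith

theorem smear_sub {g h : E → ℂ} (hg : Continuous g) {B : ℝ} (hB : ∀ y, ‖g y‖ ≤ B)
    (hh : Continuous h) {B' : ℝ} (hB' : ∀ y, ‖h y‖ ≤ B') :
    smear σ (fun y => g y - h y) = fun y => smear σ g y - smear σ h y := by
  ext y
  have hi : ∀ {g : E → ℂ} {B : ℝ}, Continuous g → (∀ y, ‖g y‖ ≤ B) →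
      Integrable (fun z => g (y - z)) σ := fun hg hB =>
    (integrable_const _).mono' (by fun_prop : Continuous _).aestronglyMeasurable
      (Eventually.of_forall fun z => hB _)
  exact integral_sub (hi hg hB) (hi hh hB')

theorem integral_mul_smear {g : E → ℂ} (hg : Continuous g) (hgc : HasCompactSupport g)
    {F : E → ℂ} (hF : Continuous F) {M : ℝ} (hM : ∀ y, ‖F y‖ ≤ M) :
    ∫ y, F y * smear σ g y = ∫ z, ∫ w, F (z + w) * g w ∂volume ∂σ := by
  have hgi : Integrable g := hg.integrable_of_hasCompactSupport hgc
  have h1 : Integrable (fun q : E × E => g (q.1 - q.2)) (volume.prod σ) := by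
    rw [integrable_prod_iff' (by fun_prop : Continuous _).aestronglyMeasurable]
    refine ⟨Eventually.of_forall fun z => hgi.comp_sub_right z, ?_⟩
    have : ∀ z, ∫ y, ‖g (y - z)‖ = ∫ y, ‖g y‖ := fun z => integral_sub_right_eq_self (fun y => ‖g y‖) z
    simp only [this]
    exact integrable_const _
  have h2 : Integrable (fun q : E × E => F q.1 * g (q.1 - q.2)) (volume.prod σ) :=
    h1.bdd_mul (by fun_prop : Continuous fun q : E × E => F q.1).aestronglyMeasurable
      (Eventually.of_forall fun q => hM q.1)
  calc ∫ y, F y * smear σ g y = ∫ y, (∫ z, F y * g (y - z) ∂σ) := by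
        simp only [smear, integral_const_mul]
    _ = ∫ z, (∫ y, F y * g (y - z)) ∂σ := integral_integral_swap h2
    _ = _ := by
        congr 1; ext z
        rw [← integral_add_left_eq_self _ z]
        simp

theorem fourier_smear {g : E → ℂ} (hg : Continuous g) (hgc : HasCompactSupport g) (ξ : E) :
    𝓕 (smear σ g) ξ =
      (∫ y, ((Real.fourierChar (-(inner ℝ y ξ)) : Circle) : ℂ) ∂σ) * 𝓕 g ξ := by
  simp only [Real.fourier_eq, Circle.smul_def, smul_eq_mul]
  rw [integral_mul_smear hg hgc (M := 1) (by fun_prop) (fun y => (Circle.norm_coe _).le),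
    ← integral_mul_const]
  congr 1; ext z
  rw [← integral_const_mul]
  congr 1; ext w
  rw [inner_add_left, neg_add, AddChar.map_add_eq_mul, Circle.coe_mul, mul_assoc]

/-- Approximation of averages over `σ` by averages over mollifications of `σ`. -/
theorem tendsto_integral_mul_smear_dilate {φ : E → ℂ} (hφ : Continuous φ)
    (hφc : HasCompactSupport φ) (h1 : ∫ x, φ x = 1) {F : E → ℂ} (hF : Continuous F) {M : ℝ}
    (hM : ∀ y, ‖F y‖ ≤ M) :
    Tendsto (fun J : ℕ => ∫ y, F y * smear σ (dilate (2 ^ J) φ) y) atTop (nhds (∫ y, F y ∂σ)) := by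
  have hφi : Integrable φ := hφ.integrable_of_hasCompactSupport hφc
  have hpow : ∀ J : ℕ, (0 : ℝ) < 2 ^ J := fun J => by positivity
  have hdc : ∀ J : ℕ, HasCompactSupport (dilate (2 ^ J) φ) := fun J =>
    (hφc.comp_smul (hpow J).ne').smul_left
      (f := fun _ => (((2 : ℝ) ^ J) ^ Module.finrank ℝ E : ℝ))
  have hlim : Tendsto (fun J : ℕ => ((2 : ℝ) ^ J)⁻¹) atTop (nhds 0) := by
    simpa using tendsto_pow_atTop_nhds_zero_of_lt_one (r := (2 : ℝ)⁻¹) (by norm_num) (by norm_num)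
  simp only [integral_mul_smear (continuous_dilate _ hφ) (hdc _) hF hM]
  have hin : ∀ z (J : ℕ), ∫ w, F (z + w) * dilate (2 ^ J) φ w =
      ∫ w, F (z + ((2 : ℝ) ^ J)⁻¹ • w) * φ w := fun z J =>
    integral_mul_dilate (hpow J) φ (fun w => F (z + w))
  simp only [hin]
  have hb : ∀ z (J : ℕ) w, ‖F (z + ((2 : ℝ) ^ J)⁻¹ • w) * φ w‖ ≤ M * ‖φ w‖ := fun z J w => by
    rw [norm_mul]; gcongr; exact hM _
  refine tendsto_integral_of_dominated_convergence (fun _ => ∫ w, M * ‖φ w‖) (fun J => ?_)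
    (integrable_const _) (fun J => ?_) ?_
  · refine Continuous.aestronglyMeasurable ?_
    refine continuous_of_dominated (bound := fun w => M * ‖φ w‖) (fun z => ?_) (fun z => ?_)
      (hφi.norm.const_mul M) ?_
    · exact (by fun_prop : Continuous _).aestronglyMeasurable
    · exact Eventually.of_forall fun w => hb z J w
    · exact Eventually.of_forall fun w => by fun_prop
  · filter_upwards with z
    exact norm_integral_le_of_norm_le (hφi.norm.const_mul M) (Eventually.of_forall fun w => hb z J w)
  · filter_upwards with z
    have : F z = ∫ w, F z * φ w := by rw [integral_const_mul, h1, mul_one]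
    rw [this]
    refine tendsto_integral_of_dominated_convergence (fun w => M * ‖φ w‖) (fun J => ?_)
      (hφi.norm.const_mul M) (fun J => Eventually.of_forall fun w => hb z J w) ?_
    · exact (by fun_prop : Continuous _).aestronglyMeasurable
    · filter_upwards with w
      refine Tendsto.mul_const _ ?_
      have h2 : Tendsto (fun J : ℕ => z + ((2 : ℝ) ^ J)⁻¹ • w) atTop (nhds (z + (0 : ℝ) • w)) :=
        (hlim.smul_const w).const_add z
      rw [zero_smul, add_zero] at h2
      exact (hF.tendsto z).comp h2

end Mollifier

/-! ### Dyadic summation, and the square function bounds for `m(ξ) ψ(ξ / r)`. -/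

section Dyadic

/-- Shifting the index brings `x` into `[1, 2]`; the terms with `k ≥ 0` and with `k < 0` are then
dominated by two convergent geometric series that do not depend on `x`. -/
theorem tsum_min_rpow_le {a b : ℝ} (ha : 0 < a) (hb : 0 < b) : ∃ C : ℝ≥0, ∀ x : ℝ, 0 < x →
    ∑' k : ℤ, ENNReal.ofReal (min (((2 : ℝ) ^ k * x) ^ a) (((2 : ℝ) ^ k * x) ^ (-b))) ≤ C := by
  have hgeo : ∀ {c : ℝ}, 0 < c → ∑' i : ℕ, ENNReal.ofReal (((2 : ℝ) ^ (-c)) ^ i) ≠ ∞ := by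
    intro c hc
    simp only [ENNReal.ofReal_pow (Real.rpow_nonneg zero_le_two _)]
    rw [ENNReal.tsum_geometric, ENNReal.inv_ne_top, ← pos_iff_ne_zero, tsub_pos_iff_lt,
      ENNReal.ofReal_lt_one]
    exact Real.rpow_lt_one_of_one_lt_of_neg one_lt_two (neg_lt_zero.2 hc)
  refine ⟨(∑' i : ℕ, ENNReal.ofReal (((2 : ℝ) ^ (-b)) ^ i) +
    ∑' i : ℕ, ENNReal.ofReal (((2 : ℝ) ^ (-a)) ^ i)).toNNReal, fun x hx => ?_⟩
  rw [ENNReal.coe_toNNReal (ENNReal.add_ne_top.2 ⟨hgeo hb, hgeo ha⟩)]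
  obtain ⟨K, hK1, hK2⟩ := exists_mem_Ico_zpow hx (one_lt_two (α := ℝ))
  set y := x / 2 ^ K
  have h2K : (0 : ℝ) < 2 ^ K := by positivity
  have hy1 : 1 ≤ y := (one_le_div h2K).2 hK1
  have hy2 : y ≤ 2 := by
    rw [div_le_iff₀ h2K]
    rw [zpow_add₀ two_ne_zero, zpow_one] at hK2
    linarith
  rw [← (Equiv.subRight K).tsum_eq]
  have hxy : ∀ k : ℤ, (2 : ℝ) ^ (Equiv.subRight K k) * x = 2 ^ k * y := by
    intro k
    simp only [Equiv.subRight_apply, y, zpow_sub₀ (two_ne_zero (α := ℝ))]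
    ring
  simp only [hxy]
  rw [tsum_of_nat_of_neg_add_one ENNReal.summable ENNReal.summable]
  gcongr with i i
  · refine (min_le_right _ _).trans ?_
    have h : ((2 : ℝ) ^ (-b)) ^ i = ((2 : ℝ) ^ (i : ℤ)) ^ (-b) := by
      rw [zpow_natCast, ← Real.rpow_natCast, ← Real.rpow_natCast, ← Real.rpow_mul zero_le_two,
        ← Real.rpow_mul zero_le_two, mul_comm]
    rw [h]
    exact Real.rpow_le_rpow_of_nonpos (by positivity)
      (le_mul_of_one_le_right (by positivity) hy1) (neg_nonpos.2 hb.le)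
  · refine (min_le_left _ _).trans ?_
    have h : ((2 : ℝ) ^ (-a)) ^ i = ((2 : ℝ) ^ (-(i : ℤ))) ^ a := by
      rw [← Real.rpow_intCast, ← Real.rpow_natCast, ← Real.rpow_mul zero_le_two,
        ← Real.rpow_mul zero_le_two]
      push_cast
      ring_nf
    rw [h]
    refine Real.rpow_le_rpow (by positivity) ?_ ha.le
    calc (2 : ℝ) ^ (-((i : ℤ) + 1)) * y ≤ (2 : ℝ) ^ (-((i : ℤ) + 1)) * 2 := by gcongr
      _ = (2 : ℝ) ^ (-(i : ℤ)) := by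
        rw [neg_add, zpow_add₀ two_ne_zero, mul_assoc]; norm_num

/-- The measure `dt / t` is dilation invariant, so each dyadic interval rescales to `(1, 2]`, the
interval on which the decay of `m` is given. -/
theorem lintegral_Ioi_inv_le_tsum (Φ : ℝ → ℝ≥0∞) :
    ∫⁻ t in Ioi (0 : ℝ), Φ t * ENNReal.ofReal t⁻¹ ≤
      ∑' k : ℤ, ∫⁻ s in Ioc (1 : ℝ) 2, Φ (2 ^ k * s) := by
  have hU : Ioi (0 : ℝ) ⊆ ⋃ k : ℤ, Ioc ((2 : ℝ) ^ k) (2 ^ (k + 1)) := by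
    intro t ht
    exact mem_iUnion.2 (exists_mem_Ioc_zpow ht (one_lt_two (α := ℝ)))
  refine (lintegral_mono_set hU).trans ((lintegral_iUnion_le _ _).trans ?_)
  refine ENNReal.tsum_le_tsum fun k => ?_
  have h2 : (0 : ℝ) < 2 ^ k := by positivity
  have hemb : MeasurableEmbedding fun s : ℝ => 2 ^ k * s :=
    (Homeomorph.mulLeft₀ ((2 : ℝ) ^ k) h2.ne').measurableEmbedding
  have hvol : (volume : Measure ℝ) =
      ENNReal.ofReal (2 ^ k) • Measure.map (fun s : ℝ => 2 ^ k * s) volume := by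
    rw [Real.map_volume_mul_left h2.ne', smul_smul, abs_of_pos (inv_pos.2 h2),
      ← ENNReal.ofReal_mul h2.le, mul_inv_cancel₀ h2.ne', ENNReal.ofReal_one, one_smul]
  have hpre : (fun s : ℝ => 2 ^ k * s) ⁻¹' Ioc ((2 : ℝ) ^ k) (2 ^ (k + 1)) = Ioc 1 2 := by
    ext s
    simp only [mem_preimage, mem_Ioc, zpow_add₀ (two_ne_zero (α := ℝ)), zpow_one]
    rw [mul_le_mul_iff_right₀ h2, lt_mul_iff_one_lt_right h2]
  calc ∫⁻ t in Ioc ((2 : ℝ) ^ k) (2 ^ (k + 1)), Φ t * ENNReal.ofReal t⁻¹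
      ≤ ∫⁻ t in Ioc ((2 : ℝ) ^ k) (2 ^ (k + 1)), Φ t * ENNReal.ofReal (2 ^ k)⁻¹ := by
        refine setLIntegral_mono' measurableSet_Ioc fun t ht => ?_
        gcongr
        exact ht.1.le
    _ = (∫⁻ t in Ioc ((2 : ℝ) ^ k) (2 ^ (k + 1)), Φ t) * ENNReal.ofReal (2 ^ k)⁻¹ :=
        lintegral_mul_const' _ _ (by simp)
    _ = ∫⁻ s in Ioc (1 : ℝ) 2, Φ (2 ^ k * s) := by
        conv_lhs => rw [hvol]
        rw [Measure.restrict_smul, lintegral_smul_measure, hemb.restrict_map, hemb.lintegral_map,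
          hpre, smul_eq_mul, mul_comm, ← mul_assoc, ← ENNReal.ofReal_mul (inv_pos.2 h2).le,
          inv_mul_cancel₀ h2.ne', ENNReal.ofReal_one, one_mul]
    _ ≤ _ := le_rfl

variable {E : Type*} [NormedAddCommGroup E] [InnerProductSpace ℝ E]

theorem enorm_sq_le_ofReal {F : Type*} [NormedAddCommGroup F] {v : F} {a : ℝ} (h : ‖v‖ ≤ a) :
    ‖v‖ₑ ^ 2 ≤ ENNReal.ofReal (a ^ 2) := by
  rw [ENNReal.ofReal_pow ((norm_nonneg v).trans h), ← ofReal_norm]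
  gcongr

/-- Summation over dyadic annuli of a quantity which is controlled, on each annulus, by the
decay of a multiplier and a cutoff at scale `r`. -/
theorem exists_lintegral_dilate_le {α : ℝ} (hα : 0 < α) {N : ℕ} (hN : α < N) :
    ∃ C : ℝ≥0, ∀ (G : E → ℝ≥0∞) (B r : ℝ), 0 ≤ B → 0 < r →
      (∀ η : E, η ≠ 0 → ∫⁻ s in Ioc (1 : ℝ) 2, G (s • η) ≤
        ENNReal.ofReal (B * (min ((‖η‖ / r) ^ N) 1) ^ 2 * (1 + ‖η‖) ^ (-(2 * α)))) →
      ∀ ξ : E, ξ ≠ 0 → ∫⁻ t in Ioi (0 : ℝ), G (t • ξ) * ENNReal.ofReal t⁻¹ ≤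
        C * ENNReal.ofReal (B * r ^ (-(2 * α))) := by
  -- In terms of `ρ = ‖2^k ξ‖ / r` the terms behave like `ρ^(2N - 2α)` for small `ρ`, thanks to the
  -- cutoff, and like `ρ^(-2α)` for large `ρ`, thanks to the decay of `m`. Both exponents help
  -- because `0 < α < N`.
  obtain ⟨C, hC⟩ := tsum_min_rpow_le (a := 2 * N - 2 * α) (b := 2 * α) (by linarith) (by linarith)
  refine ⟨C, fun G B r hB hr hG ξ hξ => ?_⟩
  have hξ' : 0 < ‖ξ‖ := norm_pos_iff.2 hξ
  refine (lintegral_Ioi_inv_le_tsum fun t => G (t • ξ)).trans ?_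
  calc ∑' k : ℤ, ∫⁻ s in Ioc (1 : ℝ) 2, G (((2 : ℝ) ^ k * s) • ξ)
      ≤ ∑' k : ℤ, ENNReal.ofReal (B * r ^ (-(2 * α))) *
          ENNReal.ofReal (min (((2 : ℝ) ^ k * (‖ξ‖ / r)) ^ (2 * N - 2 * α))
            (((2 : ℝ) ^ k * (‖ξ‖ / r)) ^ (-(2 * α)))) := by
        refine ENNReal.tsum_le_tsum fun k => ?_
        have h2 : (0 : ℝ) < 2 ^ k := by positivity
        have h := hG ((2 : ℝ) ^ k • ξ) (smul_ne_zero h2.ne' hξ)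
        have hs : ∀ s : ℝ, ((2 : ℝ) ^ k * s) • ξ = s • ((2 : ℝ) ^ k • ξ) := fun s => by
          rw [smul_smul, mul_comm]
        simp only [hs]
        refine h.trans ?_
        rw [← ENNReal.ofReal_mul (by positivity)]
        refine ENNReal.ofReal_le_ofReal ?_
        set ρ := (2 : ℝ) ^ k * (‖ξ‖ / r) with hρ
        have hρ0 : 0 < ρ := by positivity
        have hn : ‖(2 : ℝ) ^ k • ξ‖ = r * ρ := by
          rw [norm_smul, Real.norm_of_nonneg h2.le, hρ]; field_simp
        have hn' : r * ρ / r = ρ := by field_simp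
        rw [hn, hn']
        have h1 : (1 + r * ρ) ^ (-(2 * α)) ≤ r ^ (-(2 * α)) * ρ ^ (-(2 * α)) := by
          rw [← Real.mul_rpow hr.le hρ0.le]
          refine Real.rpow_le_rpow_of_nonpos (by positivity) (by linarith) (by linarith)
        have h3 : min (ρ ^ N) 1 ^ 2 * ρ ^ (-(2 * α)) ≤
            min (ρ ^ (2 * N - 2 * α)) (ρ ^ (-(2 * α))) := by
          refine le_min ?_ ?_
          · rw [sub_eq_add_neg, Real.rpow_add hρ0]
            gcongr
            calc min (ρ ^ N) 1 ^ 2 ≤ (ρ ^ N) ^ 2 := by gcongr; exact min_le_left _ _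
              _ = ρ ^ (2 * (N : ℝ)) := by
                rw [← pow_mul, ← Real.rpow_natCast]; push_cast; ring_nf
          · refine mul_le_of_le_one_left (by positivity) ?_
            exact pow_le_one₀ (by positivity) (min_le_right _ _)
        calc B * min (ρ ^ N) 1 ^ 2 * (1 + r * ρ) ^ (-(2 * α))
            ≤ B * min (ρ ^ N) 1 ^ 2 * (r ^ (-(2 * α)) * ρ ^ (-(2 * α))) := by gcongr
          _ = B * r ^ (-(2 * α)) * (min (ρ ^ N) 1 ^ 2 * ρ ^ (-(2 * α))) := by ring
          _ ≤ _ := by gcongr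
    _ ≤ _ := by
        rw [ENNReal.tsum_mul_left, mul_comm]
        gcongr
        exact hC _ (by positivity)

/-- The square function bounds for the multipliers `m(ξ) ψ(ξ / r)`. -/
theorem exists_squareFunction_bounds {m ψ : E → ℂ} (hm : Differentiable ℝ m)
    (hψ : Differentiable ℝ ψ) {α : ℝ} (hα : 0 < α) {N : ℕ} (hN : α < N) {A B : ℝ}
    (hA : 0 ≤ A) (hB : 0 ≤ B)
    (hψ1 : ∀ ξ, (1 + ‖ξ‖) * ‖ψ ξ‖ ≤ A * min (‖ξ‖ ^ N) 1)
    (hψ2 : ∀ ξ, ‖ξ‖ * ‖fderiv ℝ ψ ξ‖ ≤ A * min (‖ξ‖ ^ N) 1)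
    (hm1 : ∀ ξ, ∫⁻ s in Ioc (1 : ℝ) 2, ‖m (s • ξ)‖ₑ ^ 2 ≤
      ENNReal.ofReal (B * (1 + ‖ξ‖) ^ (-(2 * α))))
    (hm2 : ∀ ξ, ∫⁻ s in Ioc (1 : ℝ) 2, ‖fderiv ℝ m (s • ξ)‖ₑ ^ 2 ≤
      ENNReal.ofReal (B * (1 + ‖ξ‖) ^ (-(2 * α)))) :
    ∃ C : ℝ≥0, ∀ r : ℝ, 1 ≤ r → ∀ (μ : E → ℂ), (∀ ξ, μ ξ = m ξ * ψ (r⁻¹ • ξ)) → ∀ ξ : E,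
      ∫⁻ t in Ioi (0 : ℝ), ‖μ (t • ξ)‖ₑ ^ 2 * ENNReal.ofReal t⁻¹ ≤
        C * ENNReal.ofReal (r ^ (-(2 * α))) ∧
      ∫⁻ t in Ioi (0 : ℝ), ‖fderiv ℝ μ (t • ξ) ξ‖ₑ ^ 2 * ENNReal.ofReal t ≤
        C * ENNReal.ofReal (r ^ (2 - 2 * α)) := by
  have hN0 : N ≠ 0 := by
    rintro rfl
    norm_num at hN
    linarith
  obtain ⟨C, hC⟩ := exists_lintegral_dilate_le (E := E) hα hN
  -- The factor `2 ^ N` pays for replacing `s • η`, with `s ≤ 2`, by `η` in the cutoff.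
  set A' := A * 2 ^ N
  have hA' : 0 ≤ A' := by positivity
  refine ⟨C * (4 * A' ^ 2 * B).toNNReal, fun r hr μ hμ ξ => ?_⟩
  have hr0 : 0 < r := by linarith
  have hcoe : (((4 * A' ^ 2 * B).toNNReal : ℝ≥0) : ℝ≥0∞) = ENNReal.ofReal (4 * A' ^ 2 * B) := rfl
  rw [ENNReal.coe_mul, hcoe]
  -- The dyadic sum requires `ξ ≠ 0`. At the origin the multiplier vanishes because `ψ 0 = 0`.
  rcases eq_or_ne ξ 0 with rfl | hξ
  · have h0 : μ 0 = 0 := by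
      have := hψ1 0
      simp [hN0] at this
      rw [hμ, smul_zero, this, mul_zero]
    simp [h0]
  have hψr : ∀ (η : E) (s : ℝ), s ∈ Ioc (1 : ℝ) 2 →
      A * min (‖r⁻¹ • s • η‖ ^ N) 1 ≤ A' * min ((‖η‖ / r) ^ N) 1 := by
    intro η s hs
    have hs0 : 0 < s := by linarith [hs.1]
    have h1 : ‖r⁻¹ • s • η‖ = s * (‖η‖ / r) := by
      rw [norm_smul, norm_smul, Real.norm_of_nonneg (by positivity), Real.norm_of_nonneg hs0.le]
      field_simp
    rw [h1, mul_assoc, mul_min_of_nonneg _ _ (by positivity : (0 : ℝ) ≤ 2 ^ N), mul_pow]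
    gcongr
    · exact hs.2
    · exact one_le_mul_of_one_le_of_one_le (one_le_pow₀ one_le_two) le_rfl
  constructor
  · have h := hC (fun ζ => ‖μ ζ‖ₑ ^ 2) (4 * A' ^ 2 * B) r (by positivity) hr0 ?_ ξ hξ
    · refine h.trans_eq ?_
      rw [ENNReal.ofReal_mul (by positivity)]
      ring
    intro η _
    set w := min ((‖η‖ / r) ^ N) 1
    have hw0 : 0 ≤ w := by positivity
    calc ∫⁻ s in Ioc (1 : ℝ) 2, ‖μ (s • η)‖ₑ ^ 2
        ≤ ∫⁻ s in Ioc (1 : ℝ) 2, ENNReal.ofReal ((A' * w) ^ 2) * ‖m (s • η)‖ₑ ^ 2 := by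
          refine setLIntegral_mono' measurableSet_Ioc fun s hs => ?_
          rw [hμ, enorm_mul, mul_pow, mul_comm]
          gcongr
          refine enorm_sq_le_ofReal (le_trans ?_ ((hψ1 _).trans (hψr η s hs)))
          exact le_mul_of_one_le_left (norm_nonneg _) (by linarith [norm_nonneg (r⁻¹ • s • η)])
      _ ≤ ENNReal.ofReal ((A' * w) ^ 2) * ENNReal.ofReal (B * (1 + ‖η‖) ^ (-(2 * α))) := by
          rw [lintegral_const_mul' _ _ (by simp)]
          gcongr
          exact hm1 η
      _ ≤ _ := by
          rw [← ENNReal.ofReal_mul (by positivity)]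
          refine ENNReal.ofReal_le_ofReal ?_
          have : 0 ≤ A' ^ 2 * B * w ^ 2 * (1 + ‖η‖) ^ (-(2 * α)) := by positivity
          linarith
  · have h := hC (fun ζ => ‖fderiv ℝ μ ζ ζ‖ₑ ^ 2) (4 * A' ^ 2 * B * r ^ 2) r (by positivity) hr0 ?_ ξ hξ
    -- Replacing the direction `ξ` by `t • ξ` trades the weight `t` for `1 / t`, so that the radial
    -- derivative becomes a function of the point `t • ξ` alone.
    · have h1 : ∫⁻ t in Ioi (0 : ℝ), ‖fderiv ℝ μ (t • ξ) ξ‖ₑ ^ 2 * ENNReal.ofReal t =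
          ∫⁻ t in Ioi (0 : ℝ), ‖fderiv ℝ μ (t • ξ) (t • ξ)‖ₑ ^ 2 * ENNReal.ofReal t⁻¹ := by
        refine setLIntegral_congr_fun measurableSet_Ioi fun t ht => ?_
        have ht' : (0 : ℝ) < t := ht
        rw [map_smul, enorm_smul, mul_pow, mul_right_comm, mul_comm]
        congr 1
        rw [Real.enorm_of_nonneg ht'.le, ← ENNReal.ofReal_pow ht'.le,
          ← ENNReal.ofReal_mul (by positivity)]
        congr 1
        field_simp
      rw [h1]
      refine h.trans_eq ?_
      rw [mul_assoc _ (r ^ 2), ENNReal.ofReal_mul (by positivity), sub_eq_add_neg,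
        Real.rpow_add hr0, Real.rpow_two]
      ring
    intro η _
    set w := min ((‖η‖ / r) ^ N) 1
    have hw0 : 0 ≤ w := by positivity
    -- When the derivative falls on `m`, the length `‖ζ‖ = r ‖r⁻¹ • ζ‖` costs a factor `r`, whence
    -- `r^(2 - 2α)` instead of `r^(-2α)`. The term with the derivative on `ψ` has no such loss and
    -- is enlarged by `r ≥ 1` to match.
    have hder : ∀ ζ : E, ‖fderiv ℝ μ ζ ζ‖ ≤ ‖fderiv ℝ m ζ‖ * (r * ((1 + ‖r⁻¹ • ζ‖) * ‖ψ (r⁻¹ • ζ)‖)) +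
        ‖m ζ‖ * (r * (‖r⁻¹ • ζ‖ * ‖fderiv ℝ ψ (r⁻¹ • ζ)‖)) := by
      intro ζ
      have hζ : ‖ζ‖ = r * ‖r⁻¹ • ζ‖ := by
        rw [norm_smul, Real.norm_of_nonneg (by positivity)]; field_simp
      have e1 : HasFDerivAt (fun ζ : E => r⁻¹ • ζ) (r⁻¹ • ContinuousLinearMap.id ℝ E) ζ :=
        (hasFDerivAt_id ζ).const_smul r⁻¹
      have e2 : HasFDerivAt (fun ζ => m ζ * ψ (r⁻¹ • ζ)) _ ζ :=
        (hm ζ).hasFDerivAt.mul ((hψ (r⁻¹ • ζ)).hasFDerivAt.comp ζ e1)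
      have e3 : μ = fun ζ => m ζ * ψ (r⁻¹ • ζ) := funext hμ
      have e4 : fderiv ℝ μ ζ ζ = m ζ * fderiv ℝ ψ (r⁻¹ • ζ) (r⁻¹ • ζ) +
          ψ (r⁻¹ • ζ) * fderiv ℝ m ζ ζ := by
        rw [e3]
        have := congrArg (fun T => T ζ) e2.fderiv
        simpa using this
      rw [e4]
      have e5 := (fderiv ℝ ψ (r⁻¹ • ζ)).le_opNorm (r⁻¹ • ζ)
      have e6 := (fderiv ℝ m ζ).le_opNorm ζ
      calc ‖m ζ * fderiv ℝ ψ (r⁻¹ • ζ) (r⁻¹ • ζ) + ψ (r⁻¹ • ζ) * fderiv ℝ m ζ ζ‖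
          ≤ ‖m ζ‖ * (‖fderiv ℝ ψ (r⁻¹ • ζ)‖ * ‖r⁻¹ • ζ‖) +
            ‖ψ (r⁻¹ • ζ)‖ * (‖fderiv ℝ m ζ‖ * ‖ζ‖) := by
              refine (norm_add_le _ _).trans ?_
              rw [norm_mul, norm_mul]
              gcongr
        _ ≤ ‖m ζ‖ * (r * (‖fderiv ℝ ψ (r⁻¹ • ζ)‖ * ‖r⁻¹ • ζ‖)) +
            ‖ψ (r⁻¹ • ζ)‖ * (‖fderiv ℝ m ζ‖ * (r * (1 + ‖r⁻¹ • ζ‖))) := by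
              rw [hζ]
              refine add_le_add (mul_le_mul_of_nonneg_left
                (le_mul_of_one_le_left (by positivity) hr) (norm_nonneg _)) ?_
              gcongr
              linarith
        _ = _ := by ring
    calc ∫⁻ s in Ioc (1 : ℝ) 2, ‖fderiv ℝ μ (s • η) (s • η)‖ₑ ^ 2
        ≤ ∫⁻ s in Ioc (1 : ℝ) 2, ENNReal.ofReal (2 * (r * (A' * w)) ^ 2) *
            (‖fderiv ℝ m (s • η)‖ₑ ^ 2 + ‖m (s • η)‖ₑ ^ 2) := by
          refine setLIntegral_mono' measurableSet_Ioc fun s hs => ?_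
          have h1 : ‖fderiv ℝ μ (s • η) (s • η)‖ ≤
              (r * (A' * w)) * (‖fderiv ℝ m (s • η)‖ + ‖m (s • η)‖) := by
            refine (hder _).trans ?_
            have a1 := (hψ1 (r⁻¹ • s • η)).trans (hψr η s hs)
            have a2 := (hψ2 (r⁻¹ • s • η)).trans (hψr η s hs)
            calc _ ≤ ‖fderiv ℝ m (s • η)‖ * (r * (A' * w)) + ‖m (s • η)‖ * (r * (A' * w)) := by
                  gcongr
              _ = _ := by ring
          refine (enorm_sq_le_ofReal h1).trans ?_
          rw [← ofReal_norm, ← ofReal_norm, ← ENNReal.ofReal_pow (norm_nonneg _),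
            ← ENNReal.ofReal_pow (norm_nonneg _), ← ENNReal.ofReal_add (by positivity)
            (by positivity), ← ENNReal.ofReal_mul (by positivity)]
          refine ENNReal.ofReal_le_ofReal ?_
          rw [mul_pow]
          have := add_sq_le (a := ‖fderiv ℝ m (s • η)‖) (b := ‖m (s • η)‖)
          calc (r * (A' * w)) ^ 2 * (‖fderiv ℝ m (s • η)‖ + ‖m (s • η)‖) ^ 2
              ≤ (r * (A' * w)) ^ 2 * (2 * (‖fderiv ℝ m (s • η)‖ ^ 2 + ‖m (s • η)‖ ^ 2)) := by gcongr
            _ = _ := by ring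
      _ ≤ ENNReal.ofReal (2 * (r * (A' * w)) ^ 2) *
            (ENNReal.ofReal (B * (1 + ‖η‖) ^ (-(2 * α))) +
              ENNReal.ofReal (B * (1 + ‖η‖) ^ (-(2 * α)))) := by
          rw [lintegral_const_mul' _ _ ENNReal.ofReal_ne_top]
          have hmeas : Measurable fun s : ℝ => ‖m (s • η)‖ₑ ^ 2 := by
            have := hm.continuous
            exact (by fun_prop : Continuous fun s : ℝ => m (s • η)).measurable.enorm.pow_const 2
          rw [lintegral_add_right _ hmeas]
          gcongr
          exacts [hm2 η, hm1 η]
      _ ≤ _ := by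
          rw [← ENNReal.ofReal_add (by positivity) (by positivity),
            ← ENNReal.ofReal_mul (by positivity)]
          refine ENNReal.ofReal_le_ofReal (le_of_eq ?_)
          ring

end Dyadic

/-! ### The decomposition of `σ` into frequency-localized kernels. -/

section Decomposition

open Metric Filter

variable {E : Type*} [NormedAddCommGroup E] [InnerProductSpace ℝ E] [FiniteDimensional ℝ E]
  [MeasurableSpace E] [BorelSpace E]

theorem continuous_compactSupport_bounds {φ : E → ℂ} (hφ : Continuous φ)
    (hφc : HasCompactSupport φ) :
    ∃ B D : ℝ, 0 ≤ B ∧ 0 < D ∧ (∀ y, ‖φ y‖ ≤ B) ∧ ∀ y, y ∉ ball 0 D → φ y = 0 := by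
  obtain ⟨B, hB⟩ := hφ.bounded_above_of_compact_support hφc
  obtain ⟨D, hD0, hD⟩ := hφc.isCompact.isBounded.subset_ball_lt 0 0
  exact ⟨B, D, (norm_nonneg _).trans (hB 0), hD0, hB,
    fun y hy => image_eq_zero_of_notMem_tsupport fun h => hy (hD h)⟩

theorem hasCompactSupport_dilate {r : ℝ} (hr : r ≠ 0) {φ : E → ℂ} (hφ : HasCompactSupport φ) :
    HasCompactSupport (dilate r φ) :=
  (hφ.comp_smul hr).smul_left (f := fun _ => (r ^ Module.finrank ℝ E : ℝ))

theorem dilate_bounds {φ : E → ℂ} {B D : ℝ} (hB : ∀ y, ‖φ y‖ ≤ B)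
    (hD : ∀ y, y ∉ ball 0 D → φ y = 0) {r : ℝ} (hr : 0 < r) :
    (∀ y, ‖dilate r φ y‖ ≤ r ^ Module.finrank ℝ E * B) ∧
      ∀ y, y ∉ ball 0 (r⁻¹ * D) → dilate r φ y = 0 := by
  constructor
  · intro y
    rw [dilate, norm_smul, Real.norm_of_nonneg (by positivity)]
    gcongr
    exact hB _
  · intro y hy
    rw [dilate, hD, smul_zero]
    rw [mem_ball_zero_iff, not_lt] at hy ⊢
    rw [norm_smul, Real.norm_of_nonneg hr.le]
    rwa [inv_mul_le_iff₀ hr] at hy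

/-- The pieces of the decomposition of `σ` into frequency-localized kernels. -/
noncomputable def pieceKernel (σ : Measure E) (φ : E → ℂ) : ℕ → E → ℂ
  | 0 => smear σ (dilate (2 ^ 0) φ)
  | j + 1 => smear σ fun y => dilate (2 ^ (j + 1)) φ y - dilate (2 ^ j) φ y

variable {σ : Measure E} [IsFiniteMeasure σ] {φ : E → ℂ}

theorem pieceKernel_succ (hφ : Continuous φ) (hφc : HasCompactSupport φ) (j : ℕ) :
    pieceKernel σ φ (j + 1) = fun y =>
      smear σ (dilate (2 ^ (j + 1)) φ) y - smear σ (dilate (2 ^ j) φ) y := by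
  obtain ⟨B, D, -, -, hB, hD⟩ := continuous_compactSupport_bounds hφ hφc
  exact smear_sub (continuous_dilate _ hφ) (dilate_bounds hB hD (by positivity)).1
    (continuous_dilate _ hφ) (dilate_bounds hB hD (by positivity)).1

theorem sum_pieceKernel (hφ : Continuous φ) (hφc : HasCompactSupport φ) (J : ℕ) (y : E) :
    ∑ j ∈ Finset.range (J + 1), pieceKernel σ φ j y = smear σ (dilate (2 ^ J) φ) y := by
  induction J with
  | zero => simp [pieceKernel]
  | succ J ih => rw [Finset.sum_range_succ, ih, pieceKernel_succ hφ hφc]; ring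

theorem continuous_smear_dilate (hφ : Continuous φ) (hφc : HasCompactSupport φ) (j : ℕ) :
    Continuous (smear σ (dilate (2 ^ j) φ)) := by
  obtain ⟨B, D, -, -, hB, hD⟩ := continuous_compactSupport_bounds hφ hφc
  exact continuous_smear (continuous_dilate _ hφ)
    (dilate_bounds hB hD (by positivity : (0 : ℝ) < 2 ^ j)).1

theorem continuous_pieceKernel (hφ : Continuous φ) (hφc : HasCompactSupport φ) (j : ℕ) :
    Continuous (pieceKernel σ φ j) := by
  cases j with
  | zero => exact continuous_smear_dilate hφ hφc 0
  | succ j =>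
    rw [pieceKernel_succ hφ hφc]
    exact (continuous_smear_dilate hφ hφc _).sub (continuous_smear_dilate hφ hφc _)

theorem hasCompactSupport_of_forall_notMem_ball {K : E → ℂ} {D : ℝ}
    (h : ∀ y, y ∉ ball 0 D → K y = 0) : HasCompactSupport K :=
  HasCompactSupport.intro (isCompact_closedBall 0 D) fun y hy =>
    h y fun hy' => hy (ball_subset_closedBall hy')

/-- The mollifier at scale `2^(-j)` has height of order `2^(j d)` and lives in a ball of radius of
order `2^(-j)`, which has `σ`-measure `O(2^(-j β))`. The support radius `D` does not depend on `j`,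
since the mollifiers only shrink. -/
theorem pieceKernel_bounds (hφ : Continuous φ) (hφc : HasCompactSupport φ) {R : ℝ} (hR : 0 ≤ R)
    (hσ : σ (closedBall 0 R)ᶜ = 0) {β Cβ : ℝ} (hCβ : 0 ≤ Cβ)
    (hdim : ∀ (x : E) (ρ : ℝ), 0 < ρ → σ.real (ball x ρ) ≤ Cβ * ρ ^ β) :
    ∃ A D : ℝ, 0 ≤ A ∧ 0 < D ∧ ∀ j : ℕ,
      (∀ y, ‖pieceKernel σ φ j y‖ ≤ A * 2 ^ ((j : ℝ) * (Module.finrank ℝ E - β))) ∧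
      ∀ y, y ∉ ball 0 D → pieceKernel σ φ j y = 0 := by
  obtain ⟨B, D, hB0, hD0, hB, hD⟩ := continuous_compactSupport_bounds hφ hφc
  set d := Module.finrank ℝ E
  have hDpow : 0 ≤ D ^ β := by positivity
  have h2β : (0 : ℝ) < 2 ^ β := by positivity
  -- The first summand serves `j = 0`. In the second, 2 counts the two dilates, and `2 ^ β` arises
  -- because the difference lives at radius `2^(-j) D` while its height is that of index `j + 1`.
  refine ⟨B * (Cβ * D ^ β) + 2 * B * Cβ * D ^ β * 2 ^ β, R + D, by positivity, by positivity,
    fun j => ?_⟩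
  cases j with
  | zero =>
    have hb := dilate_bounds hB hD (r := 2 ^ 0) (by norm_num)
    refine ⟨fun y => ?_, fun y hy => ?_⟩
    · have h1 := norm_smear_le (σ := σ) hb.1 hb.2 y
      simp only [pow_zero, one_pow, one_mul, inv_one] at h1
      simp only [pieceKernel, pow_zero, Nat.cast_zero, zero_mul, Real.rpow_zero, mul_one]
      have : B * σ.real (ball y D) ≤ B * (Cβ * D ^ β) := by gcongr; exact hdim y D hD0
      have : 0 ≤ 2 * B * Cβ * D ^ β * 2 ^ β := by positivity
      linarith
    · refine smear_eq_zero hσ (D := D) ?_ hy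
      simpa using hb.2
  | succ j =>
    have hj : (0 : ℝ) < 2 ^ j := by positivity
    have hj1 : (0 : ℝ) < 2 ^ (j + 1) := by positivity
    have hb := dilate_bounds hB hD hj
    have hb1 := dilate_bounds hB hD hj1
    have hg : ∀ y, ‖dilate (2 ^ (j + 1)) φ y - dilate (2 ^ j) φ y‖ ≤
        2 * ((2 ^ (j + 1)) ^ d * B) := fun y => by
      refine (norm_sub_le _ _).trans ?_
      have h1 := hb.1 y
      have h2 := hb1.1 y
      have h3 : ((2 : ℝ) ^ j) ^ d * B ≤ (2 ^ (j + 1)) ^ d * B := by gcongr <;> norm_num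
      linarith
    have hg0 : ∀ y, y ∉ ball 0 ((2 ^ j)⁻¹ * D) →
        dilate (2 ^ (j + 1)) φ y - dilate (2 ^ j) φ y = 0 := fun y hy => by
      rw [hb.2 y hy, hb1.2, sub_zero]
      intro h
      refine hy (ball_subset_ball ?_ h)
      gcongr <;> norm_num
    refine ⟨fun y => ?_, fun y hy => ?_⟩
    · refine (norm_smear_le (σ := σ) hg hg0 y).trans ?_
      calc 2 * ((2 ^ (j + 1)) ^ d * B) * σ.real (ball y ((2 ^ j)⁻¹ * D))
          ≤ 2 * ((2 ^ (j + 1)) ^ d * B) * (Cβ * ((2 ^ j)⁻¹ * D) ^ β) := by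
            gcongr; exact hdim y _ (by positivity)
        _ = 2 * B * Cβ * D ^ β * 2 ^ β * 2 ^ (((j + 1 : ℕ) : ℝ) * (d - β)) := by
            rw [Real.mul_rpow (by positivity) hD0.le, mul_sub, Real.rpow_sub two_pos,
              Real.rpow_mul zero_le_two, Real.rpow_mul zero_le_two, Real.rpow_natCast,
              Real.rpow_natCast, pow_succ, Real.mul_rpow hj.le zero_le_two,
              Real.inv_rpow hj.le]
            field_simp
        _ ≤ _ := by
            gcongr
            have : 0 ≤ B * (Cβ * D ^ β) := by positivity
            linarith
    · refine smear_eq_zero hσ (D := D) (fun z hz => hg0 z fun h => hz (ball_subset_ball ?_ h)) hy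
      refine mul_le_of_le_one_left hD0.le (inv_le_one_of_one_le₀ (one_le_pow₀ one_le_two))

/-- Averages over `σ` are dominated by the sum of the pieces. -/
theorem iSup_enorm_integral_le_tsum (hφ : Continuous φ) (hφc : HasCompactSupport φ)
    (h1 : ∫ x, φ x = 1) (hK : ∀ j, HasCompactSupport (pieceKernel σ φ j)) {f : E → ℂ}
    (hf : Continuous f) {M : ℝ} (hM : ∀ y, ‖f y‖ ≤ M) (x : E) :
    (⨆ (t : ℝ) (_ : 0 < t), ‖∫ y, f (x - t • y) ∂σ‖ₑ) ≤
      ∑' j, kernelMax (pieceKernel σ φ j) f x := by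
  refine iSup₂_le fun t ht => ?_
  have hF : Continuous fun y => f (x - t • y) := by fun_prop
  have hlim := (tendsto_integral_mul_smear_dilate (σ := σ) hφ hφc h1 hF (fun y => hM _)).enorm
  refine le_of_tendsto hlim (Eventually.of_forall fun J => ?_)
  have hint : ∀ j, Integrable fun y => f (x - t • y) * pieceKernel σ φ j y := fun j =>
    (hF.mul (continuous_pieceKernel hφ hφc j)).integrable_of_hasCompactSupport (hK j).mul_left
  simp only [← sum_pieceKernel hφ hφc, Finset.mul_sum]
  rw [integral_finsetSum _ fun j _ => hint j]
  refine (enorm_sum_le _ _).trans ((Finset.sum_le_sum fun j _ => ?_).trans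
    (ENNReal.sum_le_tsum (Finset.range (J + 1))))
  exact le_iSup₂_of_le t ht le_rfl

/-- This is the shape `m(ξ) ψ(ξ / r)` with `r = 2 ^ (j + 1)` and `ψ(ξ) = 𝓕 φ ξ - 𝓕 φ (2 ξ)`, to
which the square function bounds apply. -/
theorem fourier_pieceKernel_succ (hφ : Continuous φ) (hφc : HasCompactSupport φ) (j : ℕ) (ξ : E) :
    𝓕 (pieceKernel σ φ (j + 1)) ξ =
      (∫ y, ((Real.fourierChar (-(inner ℝ y ξ)) : Circle) : ℂ) ∂σ) *
        (𝓕 φ (((2 : ℝ) ^ (j + 1))⁻¹ • ξ) - 𝓕 φ ((2 : ℝ) • ((2 : ℝ) ^ (j + 1))⁻¹ • ξ)) := by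
  have hj : (0 : ℝ) < 2 ^ j := by positivity
  have hj1 : (0 : ℝ) < 2 ^ (j + 1) := by positivity
  have hc := continuous_dilate (2 ^ j) hφ
  have hc1 := continuous_dilate (2 ^ (j + 1)) hφ
  have hs := hasCompactSupport_dilate hj.ne' hφc
  have hs1 := hasCompactSupport_dilate hj1.ne' hφc
  refine (fourier_smear (σ := σ) (hc1.sub hc) (hs1.sub hs) ξ).trans ?_
  congr 1
  have h2 : (2 : ℝ) • ((2 : ℝ) ^ (j + 1))⁻¹ • ξ = ((2 : ℝ) ^ j)⁻¹ • ξ := by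
    rw [smul_smul, pow_succ]; congr 1; field_simp
  rw [h2, ← fourier_dilate hj1, ← fourier_dilate hj]
  simp only [Real.fourier_eq, Pi.sub_apply, smul_sub]
  refine integral_sub ?_ ?_
  · exact ((by fun_prop : Continuous fun v => Real.fourierChar (-(inner ℝ v ξ)) •
      dilate (2 ^ (j + 1)) φ v)).integrable_of_hasCompactSupport hs1.smul_left
  · exact ((by fun_prop : Continuous fun v => Real.fourierChar (-(inner ℝ v ξ)) •
      dilate (2 ^ j) φ v)).integrable_of_hasCompactSupport hs.smul_left

/-- Both terms agree with 1 to order `N` at the origin, so the difference is small there; at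
infinity each term decays by itself. The factor 2 in the argument accounts for the powers of 2 in
the constant. -/
theorem mollifier_difference_bounds {φ : 𝓢(E, ℂ)} {N : ℕ} (hN : 1 ≤ N) {C : ℝ} (hC0 : 0 ≤ C)
    (hC : ∀ ξ, ‖1 - 𝓕 φ ξ‖ ≤ C * ‖ξ‖ ^ N ∧
      ‖fderiv ℝ (𝓕 φ : 𝓢(E, ℂ)) ξ‖ ≤ C * ‖ξ‖ ^ (N - 1) ∧
      (1 + ‖ξ‖) * ‖𝓕 φ ξ‖ ≤ C ∧ ‖ξ‖ * ‖fderiv ℝ (𝓕 φ : 𝓢(E, ℂ)) ξ‖ ≤ C) :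
    ∃ A : ℝ, 0 ≤ A ∧ ∀ ξ,
      (1 + ‖ξ‖) * ‖𝓕 φ ξ - 𝓕 φ ((2 : ℝ) • ξ)‖ ≤ A * min (‖ξ‖ ^ N) 1 ∧
      ‖ξ‖ * ‖fderiv ℝ (fun ξ => 𝓕 φ ξ - 𝓕 φ ((2 : ℝ) • ξ)) ξ‖ ≤ A * min (‖ξ‖ ^ N) 1 := by
  set g : 𝓢(E, ℂ) := 𝓕 φ
  have h2 : ∀ ξ : E, ‖(2 : ℝ) • ξ‖ = 2 * ‖ξ‖ := fun ξ => by
    rw [norm_smul, Real.norm_of_nonneg zero_le_two]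
  have h2N : (1 : ℝ) ≤ 2 ^ N := one_le_pow₀ one_le_two
  refine ⟨4 * C * 2 ^ N, by positivity, fun ξ => ⟨?_, ?_⟩⟩
  · rw [mul_min_of_nonneg _ _ (by positivity), mul_one]
    have hdec : (1 + ‖ξ‖) * ‖g ξ - g ((2 : ℝ) • ξ)‖ ≤ 2 * C := by
      have a1 := (hC ξ).2.2.1
      have a2 := (hC ((2 : ℝ) • ξ)).2.2.1
      rw [h2] at a2
      calc (1 + ‖ξ‖) * ‖g ξ - g ((2 : ℝ) • ξ)‖
          ≤ (1 + ‖ξ‖) * (‖g ξ‖ + ‖g ((2 : ℝ) • ξ)‖) := by gcongr; exact norm_sub_le _ _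
        _ ≤ (1 + ‖ξ‖) * ‖g ξ‖ + (1 + 2 * ‖ξ‖) * ‖g ((2 : ℝ) • ξ)‖ := by
          rw [mul_add]; gcongr; linarith [norm_nonneg ξ]
        _ ≤ _ := by linarith
    refine le_min ?_ (hdec.trans (by nlinarith))
    rcases le_total ‖ξ‖ 1 with hξ | hξ
    · have a1 := (hC ξ).1
      have a2 := (hC ((2 : ℝ) • ξ)).1
      rw [h2, mul_pow] at a2
      have a3 : ‖g ξ - g ((2 : ℝ) • ξ)‖ ≤ C * ‖ξ‖ ^ N + C * (2 ^ N * ‖ξ‖ ^ N) := by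
        have : g ξ - g ((2 : ℝ) • ξ) = (1 - g ((2 : ℝ) • ξ)) - (1 - g ξ) := by ring
        rw [this]
        refine (norm_sub_le _ _).trans ?_
        linarith
      have a4 : C * ‖ξ‖ ^ N ≤ C * (2 ^ N * ‖ξ‖ ^ N) := by
        gcongr; exact le_mul_of_one_le_left (by positivity) h2N
      calc (1 + ‖ξ‖) * ‖g ξ - g ((2 : ℝ) • ξ)‖ ≤ 2 * (2 * (C * (2 ^ N * ‖ξ‖ ^ N))) := by
            gcongr <;> linarith
        _ = _ := by ring
    · refine hdec.trans ?_
      have : 1 ≤ ‖ξ‖ ^ N := one_le_pow₀ hξ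
      calc 2 * C = 2 * C * 1 * 1 := by ring
        _ ≤ 4 * C * 2 ^ N * ‖ξ‖ ^ N := by gcongr; norm_num
  · have hd : HasFDerivAt (fun ξ => g ξ - g ((2 : ℝ) • ξ))
        (fderiv ℝ g ξ - (fderiv ℝ g ((2 : ℝ) • ξ)).comp ((2 : ℝ) • ContinuousLinearMap.id ℝ E)) ξ :=
      (g.differentiable ξ).hasFDerivAt.sub
        ((g.differentiable _).hasFDerivAt.comp ξ ((hasFDerivAt_id ξ).const_smul (2 : ℝ)))
    have hn : ‖fderiv ℝ (fun ξ => g ξ - g ((2 : ℝ) • ξ)) ξ‖ ≤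
        ‖fderiv ℝ g ξ‖ + 2 * ‖fderiv ℝ g ((2 : ℝ) • ξ)‖ := by
      rw [hd.fderiv]
      refine (norm_sub_le _ _).trans ?_
      gcongr
      rw [ContinuousLinearMap.comp_smul, norm_smul, Real.norm_of_nonneg zero_le_two]
      simp
    have hb1 := (hC ξ).2.1
    have hb2 := (hC ((2 : ℝ) • ξ)).2.1
    have hb3 := (hC ξ).2.2.2
    have hb4 := (hC ((2 : ℝ) • ξ)).2.2.2
    rw [h2] at hb2 hb4
    rw [mul_min_of_nonneg _ _ (by positivity), mul_one]
    refine le_min ?_ ?_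
    · obtain ⟨k, rfl⟩ : ∃ k, N = k + 1 := ⟨N - 1, by omega⟩
      simp only [Nat.add_sub_cancel] at hb1 hb2
      calc ‖ξ‖ * ‖fderiv ℝ (fun ξ => g ξ - g ((2 : ℝ) • ξ)) ξ‖
          ≤ ‖ξ‖ * (C * ‖ξ‖ ^ k + 2 * (C * (2 * ‖ξ‖) ^ k)) := by
            gcongr; linarith
        _ = (C * 1 + C * 2 ^ (k + 1)) * ‖ξ‖ ^ (k + 1) := by ring
        _ ≤ (C * 2 ^ (k + 1) + C * 2 ^ (k + 1)) * ‖ξ‖ ^ (k + 1) := by gcongr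
        _ = 2 * C * 2 ^ (k + 1) * ‖ξ‖ ^ (k + 1) := by ring
        _ ≤ _ := by gcongr; norm_num
    · calc ‖ξ‖ * ‖fderiv ℝ (fun ξ => g ξ - g ((2 : ℝ) • ξ)) ξ‖
          ≤ ‖ξ‖ * (‖fderiv ℝ g ξ‖ + 2 * ‖fderiv ℝ g ((2 : ℝ) • ξ)‖) := by gcongr
        _ = ‖ξ‖ * ‖fderiv ℝ g ξ‖ + 2 * ‖ξ‖ * ‖fderiv ℝ g ((2 : ℝ) • ξ)‖ := by ring
        _ ≤ 2 * C * 1 := by linarith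
        _ ≤ _ := by gcongr; norm_num

/-- The decomposition of the averaging operator over `σ` into pieces with good pointwise and `L²`
bounds. -/
theorem exists_kernel_decomposition {R : ℝ} (hR : 0 ≤ R)
    (hσ : σ (closedBall 0 R)ᶜ = 0) {β Cβ : ℝ} (hCβ : 0 ≤ Cβ)
    (hdim : ∀ (x : E) (ρ : ℝ), 0 < ρ → σ.real (ball x ρ) ≤ Cβ * ρ ^ β) {m : E → ℂ}
    (hmσ : ∀ ξ, m ξ = ∫ y, ((Real.fourierChar (-(inner ℝ y ξ)) : Circle) : ℂ) ∂σ)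
    (hm : Differentiable ℝ m) {α B : ℝ} (hα : 0 < α) (hB : 0 ≤ B)
    (hm1 : ∀ ξ, ∫⁻ s in Ioc (1 : ℝ) 2, ‖m (s • ξ)‖ₑ ^ 2 ≤
      ENNReal.ofReal (B * (1 + ‖ξ‖) ^ (-(2 * α))))
    (hm2 : ∀ ξ, ∫⁻ s in Ioc (1 : ℝ) 2, ‖fderiv ℝ m (s • ξ)‖ₑ ^ 2 ≤
      ENNReal.ofReal (B * (1 + ‖ξ‖) ^ (-(2 * α)))) :
    ∃ (K : ℕ → E → ℂ) (C : ℝ≥0), (∀ j, Continuous (K j)) ∧ (∀ j, HasCompactSupport (K j)) ∧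
      (∀ j (f : E → ℂ), Measurable f → ∀ x, kernelMax (K j) f x ≤
        C * ENNReal.ofReal (2 ^ ((j : ℝ) * (Module.finrank ℝ E - β))) *
          maxFn (fun y => ‖f y‖ₑ) x) ∧
      (∀ j (f : E → ℂ), MemLp f 2 → ∫⁻ x, kernelMax (K (j + 1)) f x ^ 2 ≤
        C * ENNReal.ofReal (2 ^ (-((j + 1 : ℕ) * (2 * α - 1)))) * ∫⁻ x, ‖f x‖ₑ ^ 2) ∧
      ∀ (f : E → ℂ) (M : ℝ), Continuous f → (∀ y, ‖f y‖ ≤ M) → ∀ x,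
        (⨆ (t : ℝ) (_ : 0 < t), ‖∫ y, f (x - t • y) ∂σ‖ₑ) ≤ ∑' j, kernelMax (K j) f x := by
  -- The order of vanishing must exceed `α` for the low-frequency part of the dyadic sum to
  -- converge.
  obtain ⟨N, hN⟩ := exists_nat_gt α
  have hN1 : 1 ≤ N := by
    rw [Nat.one_le_iff_ne_zero]; rintro rfl; norm_num at hN; linarith
  obtain ⟨φ, hφc, hφ1, Cφ, hCφ0, hCφ⟩ := exists_mollifier (E := E) N hN1
  have hφ : Continuous φ := φ.continuous
  obtain ⟨A, hA0, hA⟩ := mollifier_difference_bounds hN1 hCφ0 hCφ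
  set g : 𝓢(E, ℂ) := 𝓕 φ
  have hg : ∀ ξ, g ξ = 𝓕 (φ : E → ℂ) ξ := fun ξ => by rw [← SchwartzMap.fourier_coe]
  have hψ : Differentiable ℝ fun ξ => g ξ - g ((2 : ℝ) • ξ) := by
    have := g.differentiable
    fun_prop
  obtain ⟨C₁, hC₁⟩ := exists_squareFunction_bounds hm hψ hα hN hA0 hB
    (fun ξ => (hA ξ).1) (fun ξ => (hA ξ).2) hm1 hm2
  obtain ⟨A₂, D, hA₂, hD, hK⟩ := pieceKernel_bounds hφ hφc hR hσ hCβ hdim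
  have hKc : ∀ j, HasCompactSupport (pieceKernel σ φ j) := fun j =>
    hasCompactSupport_of_forall_notMem_ball (hK j).2
  set C₂ : ℝ≥0 := A₂.toNNReal * (volume (ball (0 : E) D)).toNNReal
  refine ⟨pieceKernel σ φ, 2 * C₁ + C₂, continuous_pieceKernel hφ hφc, hKc, fun j f hf x => ?_,
    fun j f hf => ?_, fun f M hf hM x => iSup_enorm_integral_le_tsum hφ hφc hφ1 hKc hf hM x⟩
  · refine (kernelMax_le_maxFn hf hD (hK j).1 (hK j).2 x).trans ?_
    refine mul_le_mul_left ?_ _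
    rw [ENNReal.ofReal_mul hA₂, mul_right_comm]
    refine mul_le_mul_left ?_ _
    have : (C₂ : ℝ≥0∞) = ENNReal.ofReal A₂ * volume (ball (0 : E) D) := by
      rw [ENNReal.coe_mul, ENNReal.coe_toNNReal measure_ball_lt_top.ne]; rfl
    rw [← this]
    push_cast
    exact le_add_self
  · set r : ℝ := 2 ^ (j + 1)
    have hr1 : 1 ≤ r := one_le_pow₀ one_le_two
    have hr0 : 0 < r := by positivity
    have hμ : ∀ ξ, 𝓕 (pieceKernel σ φ (j + 1)) ξ = m ξ *
        (fun ξ => g ξ - g ((2 : ℝ) • ξ)) (r⁻¹ • ξ) := fun ξ => by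
      rw [fourier_pieceKernel_succ hφ hφc, ← hmσ]
      simp only [hg]
      rfl
    have hI := hC₁ r hr1 _ hμ
    refine (lintegral_kernelMax_sq_le (continuous_pieceKernel hφ hφc _) (hKc _)
      (ENNReal.mul_ne_top ENNReal.coe_ne_top ENNReal.ofReal_ne_top)
      (ENNReal.mul_ne_top ENNReal.coe_ne_top ENNReal.ofReal_ne_top)
      (fun ξ => (hI ξ).1) (fun ξ => (hI ξ).2) hf).trans ?_
    refine mul_le_mul_left ?_ _
    -- The geometric mean of the two square function bounds `r^(-2α)` and `r^(2-2α)` is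
    -- `r^(-(2α-1))`.
    have h1 : (C₁ * ENNReal.ofReal (r ^ (-(2 * α)))) ^ (1 / 2 : ℝ) *
        (C₁ * ENNReal.ofReal (r ^ (2 - 2 * α))) ^ (1 / 2 : ℝ) =
        C₁ * ENNReal.ofReal (2 ^ (-((j + 1 : ℕ) * (2 * α - 1)))) := by
      rw [← ENNReal.mul_rpow_of_nonneg _ _ (by norm_num), mul_mul_mul_comm,
        ← ENNReal.ofReal_mul (by positivity), ← Real.rpow_add hr0,
        ENNReal.mul_rpow_of_nonneg _ _ (by norm_num), ENNReal.ofReal_rpow_of_pos (by positivity),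
        ← Real.rpow_mul hr0.le]
      congr 1
      · rw [← sq, ← ENNReal.rpow_ofNat, ← ENNReal.rpow_mul]; norm_num
      · congr 1
        simp only [r]
        rw [← Real.rpow_natCast, ← Real.rpow_mul zero_le_two]
        congr 1
        ring
    rw [h1, ← mul_assoc]
    refine mul_le_mul_left ?_ _
    push_cast
    exact le_self_add

end Decomposition

/-! ### Pointwise interpolation between `L²` and the maximal function. -/

section Interpolation

open Metric

variable {E : Type*} [NormedAddCommGroup E] [InnerProductSpace ℝ E] [FiniteDimensional ℝ E]
  [MeasurableSpace E] [BorelSpace E]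

/-- The two geometric sequences cross at `2^k = Y / X`, where their common value is `X^θ Y^(1-θ)`,
and the minimum decays geometrically on either side. -/
theorem tsum_min_le_rpow_mul_rpow {θ : ℝ} (h0 : 0 < θ) (h1 : θ < 1) :
    ∃ C : ℝ≥0, ∀ X Y : ℝ≥0∞,
      ∑' k : ℤ, min (ENNReal.ofReal (2 ^ ((k : ℝ) * (1 - θ))) * X)
        (ENNReal.ofReal (2 ^ (-((k : ℝ) * θ))) * Y) ≤ C * (X ^ θ * Y ^ (1 - θ)) := by
  have h1' : 0 < 1 - θ := sub_pos.2 h1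
  obtain ⟨C, hC⟩ := tsum_min_rpow_le h1' h0
  -- Adding 1 keeps the constant nonzero, so that the right-hand side is `∞` when one of `X`, `Y` is
  -- infinite and the other nonzero.
  refine ⟨C + 1, fun X Y => ?_⟩
  rcases eq_or_ne X 0 with rfl | hX0
  · simp
  rcases eq_or_ne Y 0 with rfl | hY0
  · simp
  have hC1 : ((C + 1 : ℝ≥0) : ℝ≥0∞) ≠ 0 := by simp
  rcases eq_or_ne X ∞ with rfl | hX
  · rw [ENNReal.top_rpow_of_pos h0, ENNReal.top_mul (by simp [hY0, h1.le]),
      ENNReal.mul_top hC1]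
    exact le_top
  rcases eq_or_ne Y ∞ with rfl | hY
  · rw [ENNReal.top_rpow_of_pos h1', ENNReal.mul_top (by simp [hX0, hX]), ENNReal.mul_top hC1]
    exact le_top
  have hx0 : 0 < X.toReal := ENNReal.toReal_pos hX0 hX
  have hy0 : 0 < Y.toReal := ENNReal.toReal_pos hY0 hY
  lift X to ℝ≥0 using hX
  lift Y to ℝ≥0 using hY
  simp only [ENNReal.coe_toReal] at hx0 hy0
  set x : ℝ := NNReal.toReal X
  set y : ℝ := NNReal.toReal Y
  have hXx : (X : ℝ≥0∞) = ENNReal.ofReal x := ENNReal.ofReal_coe_nnreal.symm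
  have hYy : (Y : ℝ≥0∞) = ENNReal.ofReal y := ENNReal.ofReal_coe_nnreal.symm
  have hprod : (X : ℝ≥0∞) ^ θ * (Y : ℝ≥0∞) ^ (1 - θ) = ENNReal.ofReal (x ^ θ * y ^ (1 - θ)) := by
    rw [hXx, hYy, ENNReal.ofReal_rpow_of_pos hx0, ENNReal.ofReal_rpow_of_pos hy0,
      ENNReal.ofReal_mul (by positivity)]
  calc ∑' k : ℤ, min (ENNReal.ofReal (2 ^ ((k : ℝ) * (1 - θ))) * X)
        (ENNReal.ofReal (2 ^ (-((k : ℝ) * θ))) * Y)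
      = ∑' k : ℤ, ENNReal.ofReal (x ^ θ * y ^ (1 - θ)) *
          ENNReal.ofReal (min ((2 ^ k * (x / y)) ^ (1 - θ)) ((2 ^ k * (x / y)) ^ (-θ))) := by
        congr 1; ext k
        rw [hXx, hYy, ← ENNReal.ofReal_mul (by positivity), ← ENNReal.ofReal_mul (by positivity),
          ← ENNReal.ofReal_min, ← ENNReal.ofReal_mul (by positivity),
          mul_min_of_nonneg _ _ (by positivity)]
        congr 2
        · rw [Real.mul_rpow (by positivity) (by positivity), Real.div_rpow hx0.le hy0.le,
            Real.rpow_mul zero_le_two, Real.rpow_intCast]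
          have : x = x ^ θ * x ^ (1 - θ) := by rw [← Real.rpow_add hx0]; simp
          nth_rw 1 [this]
          field_simp
        · rw [Real.mul_rpow (by positivity) (by positivity), Real.div_rpow hx0.le hy0.le,
            ← mul_neg, Real.rpow_mul zero_le_two, Real.rpow_intCast]
          have : y = y ^ (1 - θ) * y ^ θ := by rw [← Real.rpow_add hy0]; simp
          nth_rw 1 [this]
          rw [Real.rpow_neg hx0.le, Real.rpow_neg hy0.le]
          field_simp
    _ ≤ ENNReal.ofReal (x ^ θ * y ^ (1 - θ)) * C := by
        rw [ENNReal.tsum_mul_left]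
        gcongr
        exact hC _ (div_pos hx0 hy0)
    _ ≤ _ := by
        rw [hprod, mul_comm]
        gcongr
        simp

theorem tsum_ofReal_two_rpow_le {c : ℝ} (hc : c < 0) :
    ∃ C : ℝ≥0, ∑' j : ℕ, ENNReal.ofReal (2 ^ ((j : ℝ) * c)) ≤ C := by
  have h1 : ENNReal.ofReal ((2 : ℝ) ^ c) < 1 := by
    rw [← ENNReal.ofReal_one]
    exact (ENNReal.ofReal_lt_ofReal_iff one_pos).2 (Real.rpow_lt_one_of_one_lt_of_neg one_lt_two hc)
  have h2 : ∀ j : ℕ, ENNReal.ofReal (2 ^ ((j : ℝ) * c)) = ENNReal.ofReal ((2 : ℝ) ^ c) ^ j :=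
    fun j => by
      rw [← ENNReal.ofReal_pow (by positivity), mul_comm, Real.rpow_mul zero_le_two,
        Real.rpow_natCast]
  simp only [h2, ENNReal.tsum_geometric]
  refine ⟨((1 - ENNReal.ofReal ((2 : ℝ) ^ c))⁻¹).toNNReal, (ENNReal.coe_toNNReal ?_).ge⟩
  exact ENNReal.inv_ne_top.2 (tsub_pos_of_lt h1).ne'

/-- A maximal operator which is bounded on `L²` and dominated by the Hardy–Littlewood maximal
operator is estimated pointwise on `a ^ (1 - θ) * b ^ θ` in terms of an `L²` function and the
maximal function of `b`. -/
theorem exists_kernelMax_le_interpolation {θ : ℝ} (h0 : 0 < θ) (h1 : θ < 1) :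
    ∃ C : ℝ≥0, ∀ (K : E → ℂ) (A D : ℝ≥0∞), Continuous K → HasCompactSupport K →
      (∀ f : E → ℂ, Measurable f → ∀ x, kernelMax K f x ≤ A * maxFn (fun y => ‖f y‖ₑ) x) →
      (∀ f : E → ℂ, Measurable f → MemLp f 2 → ∫⁻ x, kernelMax K f x ^ 2 ≤ D * ∫⁻ x, ‖f x‖ₑ ^ 2) →
      ∀ (f : E → ℂ) (M : ℝ) (a b : E → ℝ), Measurable f → (∀ x, ‖f x‖ ≤ M) → Measurable a →
      Measurable b → ∫⁻ x, ENNReal.ofReal (a x) ^ 2 ≠ ∞ →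
      (∀ x, f x ≠ 0 → 0 < a x ∧ 0 < b x ∧ ‖f x‖ = a x ^ (1 - θ) * b x ^ θ) →
      ∃ u : E → ℝ≥0∞, Measurable u ∧ ∫⁻ x, u x ^ 2 ≤ D * ∫⁻ x, ENNReal.ofReal (a x) ^ 2 ∧
        ∀ x, kernelMax K f x ≤
          C * ((A * maxFn (fun y => ENNReal.ofReal (b y)) x) ^ θ * u x ^ (1 - θ)) := by
  obtain ⟨C, hC⟩ := tsum_min_le_rpow_mul_rpow h0 h1
  have h1' : 0 < 1 - θ := sub_pos.2 h1
  refine ⟨C * 2, fun K A D hKc hKs hKA hKD f M a b hf hM ha hb ha2 hfab => ?_⟩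
  -- Since `‖f‖ = a (b / a)^θ = b (a / b)^(1-θ)`, on the `k`-th set `‖f‖` is at most `2^(-kθ) a` and
  -- at most `2 · 2^(k(1-θ)) b`. The first bound feeds the `L²` estimate and the second the maximal
  -- function.
  set s : ℤ → Set E := fun k => {x | f x ≠ 0 ∧ 2 ^ k ≤ a x / b x ∧ a x / b x < 2 ^ (k + 1)}
  have hs : ∀ k, MeasurableSet (s k) := fun k =>
    ((hf (measurableSet_singleton (0 : ℂ)).compl)).inter
      ((measurableSet_le measurable_const (ha.div hb)).inter
        (measurableSet_lt (ha.div hb) measurable_const))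
  have hd : Pairwise fun i j => Disjoint (s i) (s j) := by
    have key : ∀ i j : ℤ, i < j → Disjoint (s i) (s j) := fun i j hij => by
      rw [Set.disjoint_left]
      rintro x ⟨-, -, h⟩ ⟨-, h', -⟩
      have : (2 : ℝ) ^ (i + 1) ≤ 2 ^ j := zpow_le_zpow_right₀ one_le_two (by omega)
      linarith
    intro i j hij
    rcases lt_or_gt_of_ne hij with h | h
    · exact key i j h
    · exact (key j i h).symm
  have hsupp : ∀ x, f x ≠ 0 → ∃ k, x ∈ s k := fun x hx => by
    obtain ⟨k, hk⟩ := exists_mem_Ico_zpow (div_pos (hfab x hx).1 (hfab x hx).2.1)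
      (one_lt_two : (1 : ℝ) < 2)
    exact ⟨k, hx, hk.1, hk.2⟩
  have hfa : ∀ k x, ‖(s k).indicator f x‖ₑ ≤ ENNReal.ofReal (2 ^ (-((k : ℝ) * θ))) *
      (s k).indicator (fun x => ENNReal.ofReal (a x)) x := fun k x => by
    by_cases hx : x ∈ s k
    · rw [indicator_of_mem hx, indicator_of_mem hx, ← ofReal_norm,
        ← ENNReal.ofReal_mul (by positivity)]
      obtain ⟨ha0, hb0, h⟩ := hfab x hx.1
      refine ENNReal.ofReal_le_ofReal ?_
      have hr : (2 : ℝ) ^ ((k : ℝ) * θ) ≤ (a x / b x) ^ θ := by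
        rw [Real.rpow_mul zero_le_two, Real.rpow_intCast]
        exact Real.rpow_le_rpow (by positivity) hx.2.1 h0.le
      rw [Real.div_rpow ha0.le hb0.le, le_div_iff₀ (by positivity)] at hr
      rw [h, Real.rpow_neg zero_le_two, Real.rpow_sub ha0, Real.rpow_one, inv_mul_eq_div,
        div_mul_eq_mul_div, div_le_div_iff₀ (by positivity) (by positivity), mul_assoc]
      gcongr
      linarith
    · simp [indicator_of_notMem hx]
  have hfb : ∀ k x, ‖(s k).indicator f x‖ₑ ≤ ENNReal.ofReal (2 ^ ((k : ℝ) * (1 - θ))) * 2 *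
      ENNReal.ofReal (b x) := fun k x => by
    by_cases hx : x ∈ s k
    · rw [indicator_of_mem hx, ← ofReal_norm]
      have h2 : (2 : ℝ≥0∞) = ENNReal.ofReal 2 := by simp
      rw [h2, ← ENNReal.ofReal_mul (by positivity), ← ENNReal.ofReal_mul (by positivity)]
      obtain ⟨ha0, hb0, h⟩ := hfab x hx.1
      refine ENNReal.ofReal_le_ofReal ?_
      have hr : (a x / b x) ^ (1 - θ) ≤ 2 ^ ((k : ℝ) * (1 - θ)) * 2 := by
        calc (a x / b x) ^ (1 - θ) ≤ (2 ^ (k + 1)) ^ (1 - θ) :=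
              Real.rpow_le_rpow (by positivity) hx.2.2.le h1'.le
          _ = 2 ^ ((k : ℝ) * (1 - θ)) * 2 ^ (1 - θ) := by
              rw [zpow_add₀ two_ne_zero, zpow_one, Real.mul_rpow (by positivity) zero_le_two,
                Real.rpow_mul zero_le_two, Real.rpow_intCast]
          _ ≤ 2 ^ ((k : ℝ) * (1 - θ)) * 2 ^ (1 : ℝ) := by
              gcongr <;> linarith
          _ = _ := by rw [Real.rpow_one]
      rw [Real.div_rpow ha0.le hb0.le, div_le_iff₀ (by positivity)] at hr
      rw [h]
      calc a x ^ (1 - θ) * b x ^ θ ≤ 2 ^ ((k : ℝ) * (1 - θ)) * 2 * b x ^ (1 - θ) * b x ^ θ := by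
            gcongr
        _ = 2 ^ ((k : ℝ) * (1 - θ)) * 2 * b x := by
            rw [mul_assoc _ (b x ^ (1 - θ)), ← Real.rpow_add hb0]; simp
    · simp [indicator_of_notMem hx]
  have hsq : ∀ k, ∫⁻ x, ‖(s k).indicator f x‖ₑ ^ 2 ≤
      ENNReal.ofReal (2 ^ (-((k : ℝ) * θ))) ^ 2 * ∫⁻ x in s k, ENNReal.ofReal (a x) ^ 2 :=
    fun k => by
      rw [← lintegral_const_mul' _ _ (by simp), ← lintegral_indicator (hs k)]
      refine lintegral_mono fun x => ?_
      refine (pow_le_pow_left₀ zero_le (hfa k x) 2).trans ?_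
      by_cases hx : x ∈ s k
      · simp [hx, mul_pow]
      · simp [hx]
  have hL2 : ∀ k, MemLp ((s k).indicator f) 2 := fun k => by
    refine ⟨(hf.indicator (hs k)).aestronglyMeasurable, ?_⟩
    rw [eLpNorm_lt_top_iff_lintegral_rpow_enorm_lt_top (by norm_num) (by norm_num)]
    simp only [ENNReal.toReal_ofNat, ENNReal.rpow_ofNat]
    refine (hsq k).trans_lt (ENNReal.mul_lt_top (by simp) ?_)
    exact (setLIntegral_le_lintegral _ _).trans_lt ha2.lt_top
  have hmeas : ∀ k, Measurable (kernelMax K ((s k).indicator f)) := fun k =>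
    (lowerSemicontinuous_kernelMax hKc hKs ((hL2 k).locallyIntegrable (by norm_num))).measurable
  -- One function `u`, the square root of the sum of the `w k`, dominates all the pieces with their
  -- weights. It stays in `L²` because the weights cancel the factors `2^(-kθ)` and the integrals of
  -- `a²` run over disjoint sets.
  set w : ℤ → E → ℝ≥0∞ := fun k x =>
    (ENNReal.ofReal (2 ^ ((k : ℝ) * θ)) * kernelMax K ((s k).indicator f) x) ^ 2
  have hw : ∀ k, Measurable (w k) := fun k => ((hmeas k).const_mul _).pow_const 2
  have hcan : ∀ k : ℤ, ENNReal.ofReal ((2 : ℝ) ^ ((k : ℝ) * θ)) *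
      ENNReal.ofReal (2 ^ (-((k : ℝ) * θ))) = 1 := fun k => by
    rw [← ENNReal.ofReal_mul (by positivity), ← Real.rpow_add two_pos]; simp
  refine ⟨fun x => (∑' k, w k x) ^ (1 / 2 : ℝ), (Measurable.tsum hw).pow_const _, ?_,
    fun x => ?_⟩
  · have : ∀ x, ((∑' k, w k x) ^ (1 / 2 : ℝ)) ^ 2 = ∑' k, w k x := fun x => by
      rw [← ENNReal.rpow_ofNat, ← ENNReal.rpow_mul]; norm_num
    simp only [this]
    rw [lintegral_tsum fun k => (hw k).aemeasurable]
    calc ∑' k, ∫⁻ x, w k x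
        ≤ ∑' k, D * ∫⁻ x in s k, ENNReal.ofReal (a x) ^ 2 := by
          refine ENNReal.tsum_le_tsum fun k => ?_
          simp only [w, mul_pow]
          rw [lintegral_const_mul' _ _ (by simp)]
          calc ENNReal.ofReal (2 ^ ((k : ℝ) * θ)) ^ 2 * ∫⁻ x, kernelMax K ((s k).indicator f) x ^ 2
              ≤ ENNReal.ofReal (2 ^ ((k : ℝ) * θ)) ^ 2 * (D *
                (ENNReal.ofReal (2 ^ (-((k : ℝ) * θ))) ^ 2 *
                  ∫⁻ x in s k, ENNReal.ofReal (a x) ^ 2)) := by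
                refine mul_le_mul_right ((hKD _ (hf.indicator (hs k)) (hL2 k)).trans (mul_le_mul_right (hsq k) _)) _
            _ = (ENNReal.ofReal (2 ^ ((k : ℝ) * θ)) * ENNReal.ofReal (2 ^ (-((k : ℝ) * θ)))) ^ 2 *
                (D * ∫⁻ x in s k, ENNReal.ofReal (a x) ^ 2) := by ring
            _ = _ := by rw [hcan, one_pow, one_mul]
      _ = D * ∫⁻ x in ⋃ k, s k, ENNReal.ofReal (a x) ^ 2 := by
          rw [ENNReal.tsum_mul_left, lintegral_iUnion hs hd]
      _ ≤ _ := by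
          refine mul_le_mul_right (setLIntegral_le_lintegral _ _) _
  · set u := (∑' k, w k x) ^ (1 / 2 : ℝ)
    have hu : ∀ k, kernelMax K ((s k).indicator f) x ≤ ENNReal.ofReal (2 ^ (-((k : ℝ) * θ))) * u :=
      fun k => by
        have h : ENNReal.ofReal (2 ^ ((k : ℝ) * θ)) * kernelMax K ((s k).indicator f) x ≤ u := by
          simp only [u]
          rw [one_div, ENNReal.le_rpow_inv_iff (by norm_num)]
          simpa [w] using ENNReal.le_tsum (f := fun k => w k x) k
        calc kernelMax K ((s k).indicator f) x
            = ENNReal.ofReal (2 ^ (-((k : ℝ) * θ))) * (ENNReal.ofReal (2 ^ ((k : ℝ) * θ)) *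
              kernelMax K ((s k).indicator f) x) := by
              rw [← mul_assoc, mul_comm (ENNReal.ofReal (2 ^ (-((k : ℝ) * θ)))), hcan, one_mul]
          _ ≤ _ := mul_le_mul_right h _
    set mb := maxFn (fun y => ENNReal.ofReal (b y)) x
    have hv : ∀ k, kernelMax K ((s k).indicator f) x ≤
        ENNReal.ofReal (2 ^ ((k : ℝ) * (1 - θ))) * (2 * (A * mb)) := fun k => by
      calc kernelMax K ((s k).indicator f) x
          ≤ A * maxFn (fun y => ‖(s k).indicator f y‖ₑ) x := hKA _ (hf.indicator (hs k)) x
        _ ≤ A * maxFn (fun y => ENNReal.ofReal (2 ^ ((k : ℝ) * (1 - θ))) * 2 *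
              ENNReal.ofReal (b y)) x := mul_le_mul_right (maxFn_mono (hfb k) x) _
        _ = _ := by
            rw [maxFn_const_mul (ENNReal.mul_ne_top ENNReal.ofReal_ne_top (by norm_num))]
            ring
    calc kernelMax K f x ≤ ∑' k, kernelMax K ((s k).indicator f) x :=
          kernelMax_le_tsum (hKc.integrable_of_hasCompactSupport hKs) hf hM hs hd hsupp x
      _ ≤ _ := (ENNReal.tsum_le_tsum fun k => le_min (hv k) (hu k))
      _ ≤ C * ((2 * (A * mb)) ^ θ * u ^ (1 - θ)) := hC _ _
      _ ≤ C * (2 * (A * mb) ^ θ * u ^ (1 - θ)) := by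
          rw [ENNReal.mul_rpow_of_nonneg _ _ h0.le]
          gcongr
          calc (2 : ℝ≥0∞) ^ θ ≤ 2 ^ (1 : ℝ) :=
                ENNReal.rpow_le_rpow_of_exponent_le (by norm_num) h1.le
            _ = 2 := by simp
      _ = _ := by push_cast; ring

/-- Summation of the pieces: growth of the pointwise bounds is compensated by the decay of the
`L²` bounds. -/
theorem exists_tsum_kernelMax_le {θ γ η : ℝ} (h0 : 0 < θ) (h1 : θ < 1)
    (hγη : 2 * θ * γ < (1 - θ) * η) (K : ℕ → E → ℂ) (C₀ : ℝ≥0) (hKc : ∀ j, Continuous (K j))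
    (hKs : ∀ j, HasCompactSupport (K j))
    (hKA : ∀ j (f : E → ℂ), Measurable f → ∀ x, kernelMax (K j) f x ≤
      C₀ * ENNReal.ofReal (2 ^ ((j : ℝ) * γ)) * maxFn (fun y => ‖f y‖ₑ) x)
    (hKD : ∀ j (f : E → ℂ), Measurable f → MemLp f 2 → ∫⁻ x, kernelMax (K j) f x ^ 2 ≤
      C₀ * ENNReal.ofReal (2 ^ (-((j : ℝ) * η))) * ∫⁻ x, ‖f x‖ₑ ^ 2) :
    ∃ C : ℝ≥0, ∀ (f : E → ℂ) (M : ℝ) (a b : E → ℝ), Measurable f → (∀ x, ‖f x‖ ≤ M) →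
      Measurable a → Measurable b → ∫⁻ x, ENNReal.ofReal (a x) ^ 2 ≠ ∞ →
      (∀ x, f x ≠ 0 → 0 < a x ∧ 0 < b x ∧ ‖f x‖ = a x ^ (1 - θ) * b x ^ θ) →
      ∃ u : E → ℝ≥0∞, Measurable u ∧ ∫⁻ x, u x ^ 2 ≤ C * ∫⁻ x, ENNReal.ofReal (a x) ^ 2 ∧
        ∀ x, ∑' j, kernelMax (K j) f x ≤
          C * (maxFn (fun y => ENNReal.ofReal (b y)) x ^ θ * u x ^ (1 - θ)) := by
  have h1' : 0 < 1 - θ := sub_pos.2 h1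
  -- The weights `2^(jδ)` on the squares `(u j)²` remain summable in `L²` because `δ < η`;
  -- extracting them gains `2^(-jδ(1-θ)/2)` pointwise, which beats the growth `2^(jθγ)` by the lower
  -- bound on `δ`.
  obtain ⟨δ, hδ1, hδ2⟩ : ∃ δ, 2 * θ * γ / (1 - θ) < δ ∧ δ < η := by
    refine exists_between ?_
    rw [div_lt_iff₀ h1']; linarith
  rw [div_lt_iff₀ h1'] at hδ1
  obtain ⟨C₁, hC₁⟩ := exists_kernelMax_le_interpolation (E := E) h0 h1
  obtain ⟨C₂, hC₂⟩ := tsum_ofReal_two_rpow_le (c := θ * γ - δ / 2 * (1 - θ)) (by linarith)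
  obtain ⟨C₃, hC₃⟩ := tsum_ofReal_two_rpow_le (c := δ - η) (by linarith)
  refine ⟨C₀ * C₃ + C₁ * C₀ ^ θ * C₂, fun f M a b hf hM ha hb ha2 hfab => ?_⟩
  choose u hum hu2 hu using fun j => hC₁ (K j) _ _ (hKc j) (hKs j) (hKA j) (hKD j) f M a b hf hM
    ha hb ha2 hfab
  set w : ℕ → E → ℝ≥0∞ := fun j x => (ENNReal.ofReal (2 ^ ((j : ℝ) * (δ / 2))) * u j x) ^ 2
  have hw : ∀ j, Measurable (w j) := fun k => ((hum k).const_mul _).pow_const 2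
  refine ⟨fun x => (∑' j, w j x) ^ (1 / 2 : ℝ), (Measurable.tsum hw).pow_const _, ?_,
    fun x => ?_⟩
  · have : ∀ x, ((∑' k, w k x) ^ (1 / 2 : ℝ)) ^ 2 = ∑' k, w k x := fun x => by
      rw [← ENNReal.rpow_ofNat, ← ENNReal.rpow_mul]; norm_num
    simp only [this]
    rw [lintegral_tsum fun k => (hw k).aemeasurable]
    set I := ∫⁻ x, ENNReal.ofReal (a x) ^ 2
    calc ∑' j, ∫⁻ x, w j x
        ≤ ∑' j : ℕ, ENNReal.ofReal (2 ^ ((j : ℝ) * (δ - η))) * (C₀ * I) := by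
          refine ENNReal.tsum_le_tsum fun j => ?_
          simp only [w, mul_pow]
          rw [lintegral_const_mul' _ _ (by simp)]
          refine (mul_le_mul_right (hu2 j) _).trans_eq ?_
          rw [← ENNReal.ofReal_pow (by positivity), ← Real.rpow_natCast,
            ← Real.rpow_mul zero_le_two]
          have : (2 : ℝ) ^ ((j : ℝ) * (δ - η)) =
              2 ^ ((j : ℝ) * (δ / 2) * ((2 : ℕ) : ℝ)) * 2 ^ (-((j : ℝ) * η)) := by
            rw [← Real.rpow_add two_pos]; congr 1; push_cast; ring
          rw [this, ENNReal.ofReal_mul (by positivity)]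
          ring
      _ ≤ C₃ * (C₀ * I) := by
          rw [ENNReal.tsum_mul_right]; exact mul_le_mul_left hC₃ _
      _ = (C₀ * C₃ : ℝ≥0) * I := by push_cast; ring
      _ ≤ _ := mul_le_mul_left (by push_cast; exact le_self_add) _
  · set U := (∑' j, w j x) ^ (1 / 2 : ℝ)
    set mb := maxFn (fun y => ENNReal.ofReal (b y)) x
    have hU : ∀ j, u j x ≤ ENNReal.ofReal (2 ^ (-((j : ℝ) * (δ / 2)))) * U := fun j => by
      have h : ENNReal.ofReal (2 ^ ((j : ℝ) * (δ / 2))) * u j x ≤ U := by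
        simp only [U]
        rw [one_div, ENNReal.le_rpow_inv_iff (by norm_num)]
        simpa [w] using ENNReal.le_tsum (f := fun k => w k x) j
      calc u j x = ENNReal.ofReal (2 ^ (-((j : ℝ) * (δ / 2)))) *
            (ENNReal.ofReal (2 ^ ((j : ℝ) * (δ / 2))) * u j x) := by
            rw [← mul_assoc, ← ENNReal.ofReal_mul (by positivity), ← Real.rpow_add two_pos]; simp
        _ ≤ _ := mul_le_mul_right h _
    calc ∑' j, kernelMax (K j) f x
        ≤ ∑' j : ℕ, ENNReal.ofReal (2 ^ ((j : ℝ) * (θ * γ - δ / 2 * (1 - θ)))) *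
            (C₁ * C₀ ^ θ * (mb ^ θ * U ^ (1 - θ))) := by
          refine ENNReal.tsum_le_tsum fun j => (hu j x).trans ?_
          calc (C₁ : ℝ≥0∞) * ((C₀ * ENNReal.ofReal (2 ^ ((j : ℝ) * γ)) * mb) ^ θ * u j x ^ (1 - θ))
              ≤ C₁ * ((C₀ * ENNReal.ofReal (2 ^ ((j : ℝ) * γ)) * mb) ^ θ *
                (ENNReal.ofReal (2 ^ (-((j : ℝ) * (δ / 2)))) * U) ^ (1 - θ)) := by
                gcongr
                exact hU j
            _ = _ := by
                rw [ENNReal.mul_rpow_of_nonneg _ _ h0.le, ENNReal.mul_rpow_of_nonneg _ _ h0.le,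
                  ENNReal.mul_rpow_of_nonneg _ _ h1'.le, ENNReal.ofReal_rpow_of_pos (by positivity),
                  ENNReal.ofReal_rpow_of_pos (by positivity), ← Real.rpow_mul zero_le_two,
                  ← Real.rpow_mul zero_le_two]
                have : (2 : ℝ) ^ ((j : ℝ) * (θ * γ - δ / 2 * (1 - θ))) =
                    2 ^ ((j : ℝ) * γ * θ) * 2 ^ (-((j : ℝ) * (δ / 2)) * (1 - θ)) := by
                  rw [← Real.rpow_add two_pos]; congr 1; ring
                rw [this, ENNReal.ofReal_mul (by positivity)]
                ring
      _ ≤ C₂ * (C₁ * C₀ ^ θ * (mb ^ θ * U ^ (1 - θ))) := by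
          rw [ENNReal.tsum_mul_right]; exact mul_le_mul_left hC₂ _
      _ = (C₁ * C₀ ^ θ * C₂ : ℝ≥0) * (mb ^ θ * U ^ (1 - θ)) := by
          push_cast [ENNReal.coe_rpow_of_nonneg _ h0.le]; ring
      _ ≤ _ := mul_le_mul_left (by push_cast; exact le_add_self) _

end Interpolation

/-! ### Interpolation bound for the maximal average over `σ`. -/

section AverageInterpolation

open Metric

variable {E : Type*} [NormedAddCommGroup E] [InnerProductSpace ℝ E] [FiniteDimensional ℝ E]
  [MeasurableSpace E] [BorelSpace E] [Nontrivial E]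

/-- Pointwise interpolation bound for the maximal average over a measure with decaying Fourier
transform. -/
theorem exists_iSup_average_le {σ : Measure E} [IsFiniteMeasure σ] {R : ℝ} (hR : 0 ≤ R)
    (hσ : σ (closedBall 0 R)ᶜ = 0) {β Cβ : ℝ} (hCβ : 0 ≤ Cβ)
    (hdim : ∀ (x : E) (ρ : ℝ), 0 < ρ → σ.real (ball x ρ) ≤ Cβ * ρ ^ β) {m : E → ℂ}
    (hmσ : ∀ ξ, m ξ = ∫ y, ((Real.fourierChar (-(inner ℝ y ξ)) : Circle) : ℂ) ∂σ)
    (hm : Differentiable ℝ m) {α B : ℝ} (hα : 0 < α) (hB : 0 ≤ B)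
    (hm1 : ∀ ξ, ∫⁻ s in Ioc (1 : ℝ) 2, ‖m (s • ξ)‖ₑ ^ 2 ≤
      ENNReal.ofReal (B * (1 + ‖ξ‖) ^ (-(2 * α))))
    (hm2 : ∀ ξ, ∫⁻ s in Ioc (1 : ℝ) 2, ‖fderiv ℝ m (s • ξ)‖ₑ ^ 2 ≤
      ENNReal.ofReal (B * (1 + ‖ξ‖) ^ (-(2 * α)))) {θ : ℝ} (h0 : 0 < θ) (h1 : θ < 1)
    (hθ : 2 * θ * (Module.finrank ℝ E - β) < (1 - θ) * (2 * α - 1)) :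
    ∃ C : ℝ≥0, ∀ (f : E → ℂ) (M : ℝ) (a b : E → ℝ), Continuous f → (∀ x, ‖f x‖ ≤ M) →
      Measurable a → Measurable b → ∫⁻ x, ENNReal.ofReal (a x) ^ 2 ≠ ∞ →
      (∀ x, f x ≠ 0 → 0 < a x ∧ 0 < b x ∧ ‖f x‖ = a x ^ (1 - θ) * b x ^ θ) →
      ∃ u : E → ℝ≥0∞, Measurable u ∧ ∫⁻ x, u x ^ 2 ≤ C * ∫⁻ x, ENNReal.ofReal (a x) ^ 2 ∧
        ∀ x, (⨆ (t : ℝ) (_ : 0 < t), ‖∫ y, f (x - t • y) ∂σ‖ₑ) ≤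
          C * (maxFn (fun y => ENNReal.ofReal (b y)) x ^ θ * u x ^ (1 - θ)) := by
  obtain ⟨K, C₀, hKc, hKs, hKA, hKD, hK⟩ :=
    exists_kernel_decomposition hR hσ hCβ hdim hmσ hm hα hB hm1 hm2
  obtain ⟨C, hC⟩ := exists_tsum_kernelMax_le h0 h1 hθ K
    (C₀ + C₀ ^ 2 * (32 * 5 ^ Module.finrank ℝ E)) hKc hKs
    (fun j f hf x => (hKA j f hf x).trans (by
      refine mul_le_mul_left (mul_le_mul_left ?_ _) _
      push_cast; exact le_self_add))
    (fun j f hfm hf => by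
      cases j with
      | zero =>
        -- The multiplier of the lowest piece need not vanish at the origin, so the square function
        -- argument is not available; the `L²` bound for the maximal function replaces it.
        calc ∫⁻ x, kernelMax (K 0) f x ^ 2 ≤ ∫⁻ x, (C₀ * maxFn (fun y => ‖f y‖ₑ) x) ^ 2 := by
              refine lintegral_mono fun x => pow_le_pow_left₀ zero_le ?_ 2
              simpa using hKA 0 f hfm x
          _ = C₀ ^ 2 * ∫⁻ x, maxFn (fun y => ‖f y‖ₑ) x ^ 2 := by
              simp only [mul_pow]
              rw [lintegral_const_mul' _ _ (by simp)]
          _ ≤ C₀ ^ 2 * (32 * 5 ^ Module.finrank ℝ E * ∫⁻ x, ‖f x‖ₑ ^ 2) :=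
              mul_le_mul_right (lintegral_maxFn_sq_le hfm.enorm) _
          _ ≤ _ := by
              rw [← mul_assoc]
              refine mul_le_mul_left ?_ _
              simp
      | succ j =>
        refine (hKD j f hf).trans (mul_le_mul_left (mul_le_mul_left ?_ _) _)
        push_cast; exact le_self_add)
  refine ⟨C, fun f M a b hf hM ha hb ha2 hfab => ?_⟩
  obtain ⟨u, hum, hu2, hu⟩ := hC f M a b hf.measurable hM ha hb ha2 hfab
  exact ⟨u, hum, hu2, fun x => (hK f M hf hM x).trans (hu x)⟩

end AverageInterpolation

/-! ### From the pointwise bound to modulars with variable exponents. -/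

section Modular

variable {n : ℕ} {p g h : EuclideanSpace ℝ (Fin n) → ℝ≥0∞}

theorem expPow_of_ne_top {s r : ℝ≥0∞} (hr : r ≠ ∞) : expPow s r = s ^ r.toReal := if_neg hr

theorem expPow_mono {s t : ℝ≥0∞} (hst : s ≤ t) (r : ℝ≥0∞) : expPow s r ≤ expPow t r := by
  unfold expPow
  split_ifs with h1 h2 h3 h3
  · exact le_rfl
  · exact le_top
  · exact absurd (hst.trans h3) h2
  · exact le_rfl
  · exact ENNReal.rpow_le_rpow hst ENNReal.toReal_nonneg

theorem modular_mono (hgh : ∀ x, g x ≤ h x) : modular p g ≤ modular p h :=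
  lintegral_mono fun x => expPow_mono (hgh x) _

theorem luxNorm_le_of_modular_le_one {c : ℝ≥0} (hc : 0 < c)
    (h : modular p (fun x => g x / c) ≤ 1) : luxNorm p g ≤ c :=
  iInf₂_le_of_le c hc (iInf_le _ h)

theorem modular_div_le_one_of_luxNorm_lt {c : ℝ≥0} (h : luxNorm p g < c) :
    modular p (fun x => g x / c) ≤ 1 := by
  simp only [luxNorm, iInf_lt_iff] at h
  obtain ⟨d, _, h1, hd⟩ := h
  refine (modular_mono fun x => ?_).trans h1
  exact ENNReal.div_le_div_left hd.le _

/-- If `1 / r = (1 - θ) / 2 + θ / s` then `r ≤ 2 / (1 - θ)`, and `s` is determined by `r`. -/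
theorem interpExponent_eq {θ : ℝ} (h0 : 0 < θ) (h1 : θ < 1)
    {x : EuclideanSpace ℝ (Fin n)} (hp1 : 1 ≤ p x) (hpθ : ENNReal.ofReal (1 - θ) * p x ≤ 2) :
    p x ≠ ∞ ∧ (1 - θ) * (p x).toReal ≤ 2 ∧
      ((1 - θ) * (p x).toReal = 2 → interpExponent θ p x = ∞) ∧
      ((1 - θ) * (p x).toReal < 2 → interpExponent θ p x =
        ENNReal.ofReal (2 * θ * (p x).toReal / (2 - (1 - θ) * (p x).toReal))) := by
  have h1' : 0 < 1 - θ := sub_pos.2 h1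
  have hp : p x ≠ ∞ := by
    intro h
    rw [h, ENNReal.mul_top (by simpa using h1)] at hpθ
    simp at hpθ
  have hP1 : 1 ≤ (p x).toReal := by
    rwa [← ENNReal.ofReal_le_iff_le_toReal hp, ENNReal.ofReal_one]
  have hpe : p x = ENNReal.ofReal (p x).toReal := (ENNReal.ofReal_toReal hp).symm
  have h2 : (2 : ℝ≥0∞) = ENNReal.ofReal 2 := by simp
  set P := (p x).toReal
  have hle : (1 - θ) * P ≤ 2 := by
    rw [hpe, ← ENNReal.ofReal_mul h1'.le, h2] at hpθ
    exact (ENNReal.ofReal_le_ofReal_iff zero_le_two).1 hpθ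
  have hq : interpExponent θ p x =
      ENNReal.ofReal (2 * θ * P) / ENNReal.ofReal (2 - (1 - θ) * P) := by
    rw [interpExponent, hpe, h2, ← ENNReal.ofReal_mul zero_le_two,
      ← ENNReal.ofReal_mul (by positivity), ← ENNReal.ofReal_mul h1'.le,
      ← ENNReal.ofReal_sub _ (by positivity)]
  refine ⟨hp, hle, fun h => ?_, fun h => ?_⟩
  · rw [hq, h, sub_self, ENNReal.ofReal_zero, ENNReal.div_zero]
    simp only [ne_eq, ENNReal.ofReal_eq_zero, not_le]
    positivity
  · rw [hq, ENNReal.ofReal_div_of_pos (by linarith)]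

theorem rpow_mul_rpow_le_add {X Y : ℝ≥0∞} {a b : ℝ} (ha : 0 ≤ a) (hb : 0 ≤ b) (hab : a + b = 1) :
    X ^ a * Y ^ b ≤ X + Y := by
  calc X ^ a * Y ^ b ≤ (X + Y) ^ a * (X + Y) ^ b := by
        gcongr
        · exact le_self_add
        · exact le_add_self
    _ = _ := by rw [← ENNReal.rpow_add_of_nonneg _ _ ha hb, hab, ENNReal.rpow_one]

/-- The pointwise Young inequality behind the interpolation of variable exponents. -/
theorem expPow_rpow_mul_rpow_le {θ : ℝ} (h0 : 0 < θ) (h1 : θ < 1)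
    {x : EuclideanSpace ℝ (Fin n)} (hp1 : 1 ≤ p x) (hpθ : ENNReal.ofReal (1 - θ) * p x ≤ 2)
    (W u : ℝ≥0∞) :
    expPow (W ^ θ * u ^ (1 - θ)) (p x) ≤ expPow W (interpExponent θ p x) + u ^ 2 := by
  have h1' : 0 < 1 - θ := sub_pos.2 h1
  obtain ⟨hp, hle, htop, hfin⟩ := interpExponent_eq h0 h1 hp1 hpθ
  have hP1 : 1 ≤ (p x).toReal := by
    rwa [← ENNReal.ofReal_le_iff_le_toReal hp, ENNReal.ofReal_one]
  rw [expPow_of_ne_top hp]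
  set P := (p x).toReal
  rw [ENNReal.mul_rpow_of_nonneg _ _ (by positivity), ← ENNReal.rpow_mul, ← ENNReal.rpow_mul]
  rcases hle.eq_or_lt with h | h
  -- At the endpoint the interpolating exponent is `∞`: either `W ≤ 1` and the factor `W ^ (θ P)`
  -- may be dropped, or the right-hand side is infinite.
  · rw [htop h, expPow, if_pos rfl, h]
    split_ifs with hW
    · rw [zero_add]
      calc W ^ (θ * P) * u ^ (2 : ℝ) ≤ 1 * u ^ (2 : ℝ) := by
            gcongr
            exact ENNReal.rpow_le_one hW (by positivity)
        _ = _ := by simp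
    · simp
  · have hd : 0 < 2 - (1 - θ) * P := by linarith
    rw [hfin h, expPow_of_ne_top ENNReal.ofReal_ne_top, ENNReal.toReal_ofReal (by positivity)]
    set Q := 2 * θ * P / (2 - (1 - θ) * P)
    -- With `s = (1 - θ) P / 2` the two exponents are `Q (1 - s)` and `2 s`, so the product is a
    -- weighted geometric mean of `W ^ Q` and `u ^ 2`.
    have e1 : θ * P = Q * ((2 - (1 - θ) * P) / 2) := by
      simp only [Q]
      generalize 2 - (1 - θ) * P = D at hd
      field_simp
    have e2 : (1 - θ) * P = 2 * ((1 - θ) * P / 2) := by ring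
    rw [e1, e2, ENNReal.rpow_mul, ENNReal.rpow_mul, ENNReal.rpow_ofNat]
    exact rpow_mul_rpow_le_add (by linarith)
      (div_nonneg (mul_nonneg h1'.le (by positivity)) zero_le_two) (by ring)

theorem expPow_half_le {s r : ℝ≥0∞} (h1 : 1 ≤ r) (hr : r ≠ ∞) :
    expPow (s / 2) r ≤ expPow s r / 2 := by
  have hP1 : 1 ≤ r.toReal := by
    rwa [← ENNReal.ofReal_le_iff_le_toReal hr, ENNReal.ofReal_one]
  rw [expPow_of_ne_top hr, expPow_of_ne_top hr, ENNReal.div_rpow_of_nonneg _ _ (by positivity)]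
  refine ENNReal.div_le_div_left ?_ _
  calc (2 : ℝ≥0∞) = 2 ^ (1 : ℝ) := by simp
    _ ≤ _ := ENNReal.rpow_le_rpow_of_exponent_le (by norm_num) hP1

/-- The bound for maximal averages of bounded continuous functions. -/
theorem exists_modular_maximalAverage_le (hp : IsExponent p) {θ : ℝ} (h0 : 0 < θ) (h1 : θ < 1)
    (hpθ : ∀ x, ENNReal.ofReal (1 - θ) * p x ≤ 2) (hB : ClassB (interpExponent θ p))
    {σ : Measure (EuclideanSpace ℝ (Fin n))} {C : ℝ≥0}
    (hC : ∀ (f : EuclideanSpace ℝ (Fin n) → ℂ) (M : ℝ) (a b : EuclideanSpace ℝ (Fin n) → ℝ),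
      Continuous f → (∀ x, ‖f x‖ ≤ M) →
      Measurable a → Measurable b → ∫⁻ x, ENNReal.ofReal (a x) ^ 2 ≠ ∞ →
      (∀ x, f x ≠ 0 → 0 < a x ∧ 0 < b x ∧ ‖f x‖ = a x ^ (1 - θ) * b x ^ θ) →
      ∃ u : EuclideanSpace ℝ (Fin n) → ℝ≥0∞, Measurable u ∧
        ∫⁻ x, u x ^ 2 ≤ C * ∫⁻ x, ENNReal.ofReal (a x) ^ 2 ∧
        ∀ x, (⨆ (t : ℝ) (_ : 0 < t), ‖∫ y, f (x - t • y) ∂σ‖ₑ) ≤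
          C * (maxFn (fun y => ENNReal.ofReal (b y)) x ^ θ * u x ^ (1 - θ))) :
    ∃ C' : ℝ≥0, 0 < C' ∧ ∀ (f : EuclideanSpace ℝ (Fin n) → ℂ) (M : ℝ), Continuous f →
      (∀ x, ‖f x‖ ≤ M) → modular p (fun x => ‖f x‖ₑ) ≤ 1 →
      modular p (fun x => maximalAverage σ f x / C') ≤ 1 := by
  have h1' : 0 < 1 - θ := sub_pos.2 h1
  obtain ⟨-, C₁, hC₁⟩ := hB
  -- The extra 1 makes the norm of the maximal function strictly less than `c`, so that its modular
  -- after division by `c` is at most 1 without attaining the infimum in the norm.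
  set c : ℝ≥0 := C₁ + 1
  set k : ℝ≥0 := C + 1
  have hc1 : 1 ≤ c := le_add_self
  have hk1 : 1 ≤ k := le_add_self
  have hP := fun x => interpExponent_eq h0 h1 (hp.2 x) (hpθ x)
  have hP1 : ∀ x, 1 ≤ (p x).toReal := fun x => by
    rw [← ENNReal.ofReal_le_iff_le_toReal (hP x).1, ENNReal.ofReal_one]; exact hp.2 x
  -- The Young inequality produces a sum of two modulars, each at most 1; the factor 2 brings the
  -- total back to 1 because `p ≥ 1`. The summand 1 ensures positivity.
  refine ⟨2 * (C * (c * k) + 1), by positivity, fun f M hf hM hf1 => ?_⟩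
  -- This is `p / q` for the interpolating exponent `q`, equal to 0 where `q = ∞`. It gives `a² =
  -- ‖f‖^p`, `b^q = ‖f‖^p` where `q` is finite, and `(1 - θ) p / 2 + θ e = 1`.
  set e : EuclideanSpace ℝ (Fin n) → ℝ := fun x => (2 - (1 - θ) * (p x).toReal) / (2 * θ)
  have he0 : ∀ x, 0 ≤ e x := fun x => by
    have := (hP x).2.1
    simp only [e]
    exact div_nonneg (by linarith) (by positivity)
  set a : EuclideanSpace ℝ (Fin n) → ℝ := fun x => ‖f x‖ ^ ((p x).toReal / 2)
  set b : EuclideanSpace ℝ (Fin n) → ℝ := fun x => ‖f x‖ ^ e x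
  have hpm : Measurable fun x => (p x).toReal := hp.1.ennreal_toReal
  have ha : Measurable a := hf.norm.measurable.pow (hpm.div_const 2)
  have hb : Measurable b := hf.norm.measurable.pow
    (((hpm.const_mul (1 - θ)).const_sub 2).div_const _)
  have hb0 : ∀ x, 0 ≤ b x := fun x => Real.rpow_nonneg (norm_nonneg _) _
  have ha2 : ∫⁻ x, ENNReal.ofReal (a x) ^ 2 ≤ 1 := by
    refine le_trans (le_of_eq (lintegral_congr fun x => ?_)) hf1
    rw [expPow_of_ne_top (hP x).1, ← ENNReal.ofReal_rpow_of_nonneg (norm_nonneg _)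
      (by have := hP1 x; positivity), ← ENNReal.rpow_ofNat, ← ENNReal.rpow_mul, ofReal_norm]
    congr 1
    simp
  have hbq : modular (interpExponent θ p) (fun x => ENNReal.ofReal (b x)) ≤ 1 := by
    refine le_trans (lintegral_mono fun x => ?_) hf1
    have hx1 := hP1 x
    obtain ⟨hp, hle, htop, hfin⟩ := hP x
    rw [expPow_of_ne_top hp]
    rcases hle.eq_or_lt with h | h
    -- Here `b = 1` even at zeros of `f`, as `0 ^ 0 = 1`; this is harmless because `1 ^ ∞ = 0` in
    -- the convention of `expPow`.
    · have : b x = 1 := by simp [b, e, h]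
      simp [htop h, expPow, this]
    · have hd : 0 < 2 - (1 - θ) * (p x).toReal := by linarith
      rw [hfin h, expPow_of_ne_top ENNReal.ofReal_ne_top, ENNReal.toReal_ofReal (by positivity)]
      simp only [b]
      rw [← ENNReal.ofReal_rpow_of_nonneg (norm_nonneg _) (he0 x), ← ENNReal.rpow_mul, ofReal_norm]
      refine le_of_eq ?_
      congr 1
      simp only [e]
      field_simp
  have hbn : ∀ x, ‖(b x : ℂ)‖ₑ = ENNReal.ofReal (b x) := fun x => by
    rw [← ofReal_norm, Complex.norm_real, Real.norm_of_nonneg (hb0 x)]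
  have hlux : luxNorm (interpExponent θ p) (fun x => ENNReal.ofReal (b x)) ≤ 1 := by
    refine luxNorm_le_of_modular_le_one one_pos ?_
    simpa using hbq
  have hW : modular (interpExponent θ p)
      (fun x => maxFn (fun y => ENNReal.ofReal (b y)) x / c) ≤ 1 := by
    refine modular_div_le_one_of_luxNorm_lt ?_
    have := hC₁ (fun x => (b x : ℂ)) ⟨(Complex.measurable_ofReal.comp hb).aemeasurable, 1, one_pos,
      by simpa [hbn] using hbq.trans_lt ENNReal.one_lt_top⟩
    simp only [hbn] at this
    have heq : hardyLittlewood (fun x => (b x : ℂ)) = maxFn fun y => ENNReal.ofReal (b y) := by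
      simp only [← hbn]; rfl
    rw [heq] at this
    calc _ ≤ (C₁ : ℝ≥0∞) * 1 := this.trans (mul_le_mul_right hlux _)
      _ < _ := by
        rw [mul_one]
        exact_mod_cast lt_add_one C₁
  obtain ⟨u, hum, hu2, hu⟩ := hC f M a b hf hM ha hb (ha2.trans_lt ENNReal.one_lt_top).ne
    fun x hx => by
      have hx0 : 0 < ‖f x‖ := norm_pos_iff.2 hx
      refine ⟨Real.rpow_pos_of_pos hx0 _, Real.rpow_pos_of_pos hx0 _, ?_⟩
      simp only [a, b]
      rw [← Real.rpow_mul hx0.le, ← Real.rpow_mul hx0.le, ← Real.rpow_add hx0]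
      have : (p x).toReal / 2 * (1 - θ) + e x * θ = 1 := by
        simp only [e]; field_simp; ring
      rw [this, Real.rpow_one]
  have hk0 : (k : ℝ≥0∞) ≠ 0 := by simp [k]
  have hc0 : (c : ℝ≥0∞) ≠ 0 := by simp [c]
  have hu2' : ∫⁻ x, (u x / k) ^ 2 ≤ 1 := by
    simp only [div_eq_mul_inv, mul_pow]
    rw [lintegral_mul_const' _ _ (by simp [hk0])]
    calc (∫⁻ x, u x ^ 2) * (k : ℝ≥0∞)⁻¹ ^ 2 ≤ (C * 1) * (k : ℝ≥0∞)⁻¹ ^ 2 :=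
          mul_le_mul_left (hu2.trans (mul_le_mul_right ha2 _)) _
      _ ≤ (k * k) * (k : ℝ≥0∞)⁻¹ ^ 2 := by
          refine mul_le_mul_left (mul_le_mul' ?_ ?_) _
          · exact_mod_cast le_self_add
          · exact_mod_cast hk1
      _ = (k * (k : ℝ≥0∞)⁻¹) ^ 2 := by ring
      _ = 1 := by rw [ENNReal.mul_inv_cancel hk0 ENNReal.coe_ne_top, one_pow]
  have hpt : ∀ x, maximalAverage σ f x / (2 * (C * (c * k) + 1) : ℝ≥0) ≤
      ((maxFn (fun y => ENNReal.ofReal (b y)) x / c) ^ θ * (u x / k) ^ (1 - θ)) / 2 := fun x => by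
    set mb := maxFn (fun y => ENNReal.ofReal (b y)) x
    have e1 : mb = c * (mb / c) := (ENNReal.mul_div_cancel hc0 ENNReal.coe_ne_top).symm
    have e2 : u x = k * (u x / k) := (ENNReal.mul_div_cancel hk0 ENNReal.coe_ne_top).symm
    have hle : maximalAverage σ f x ≤
        (C * (c * k) + 1 : ℝ≥0) * ((mb / c) ^ θ * (u x / k) ^ (1 - θ)) := by
      calc maximalAverage σ f x ≤ C * (mb ^ θ * u x ^ (1 - θ)) := hu x
        _ = C * ((c ^ θ * k ^ (1 - θ)) * ((mb / c) ^ θ * (u x / k) ^ (1 - θ))) := by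
            nth_rw 1 [e1]
            nth_rw 1 [e2]
            rw [ENNReal.mul_rpow_of_nonneg _ _ h0.le, ENNReal.mul_rpow_of_nonneg _ _ h1'.le]
            ring
        _ ≤ C * ((c * k) * ((mb / c) ^ θ * (u x / k) ^ (1 - θ))) := by
            refine mul_le_mul_right (mul_le_mul_left (mul_le_mul' ?_ ?_) _) _
            · conv_rhs => rw [← ENNReal.rpow_one (c : ℝ≥0∞)]
              exact ENNReal.rpow_le_rpow_of_exponent_le (by exact_mod_cast hc1) h1.le
            · conv_rhs => rw [← ENNReal.rpow_one (k : ℝ≥0∞)]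
              exact ENNReal.rpow_le_rpow_of_exponent_le (by exact_mod_cast hk1) (by linarith)
        _ = (C * (c * k) : ℝ≥0) * ((mb / c) ^ θ * (u x / k) ^ (1 - θ)) := by push_cast; ring
        _ ≤ _ := mul_le_mul_left (by exact_mod_cast le_self_add) _
    refine ENNReal.div_le_of_le_mul (hle.trans (le_of_eq ?_))
    rw [ENNReal.coe_mul 2, ENNReal.coe_ofNat, ← mul_assoc (_ / 2), ENNReal.div_mul_cancel (by norm_num)
      (by norm_num), mul_comm]
  calc modular p (fun x => maximalAverage σ f x / (2 * (C * (c * k) + 1) : ℝ≥0))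
      ≤ ∫⁻ x, (expPow (maxFn (fun y => ENNReal.ofReal (b y)) x / c) (interpExponent θ p x) +
          (u x / k) ^ 2) / 2 := by
        refine lintegral_mono fun x => (expPow_mono (hpt x) _).trans ?_
        refine (expPow_half_le (hp.2 x) (hP x).1).trans (ENNReal.div_le_div_right ?_ _)
        exact expPow_rpow_mul_rpow_le h0 h1 (hp.2 x) (hpθ x) _ _
    _ = (modular (interpExponent θ p) (fun x => maxFn (fun y => ENNReal.ofReal (b y)) x / c) +
          ∫⁻ x, (u x / k) ^ 2) / 2 := by
        simp only [div_eq_mul_inv (_ + _)]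
        rw [lintegral_mul_const' _ _ (by simp), lintegral_add_right _ ((hum.div_const _).pow_const 2)]
        rfl
    _ ≤ (1 + 1) / 2 := by gcongr
    _ = 1 := by rw [one_add_one_eq_two, ENNReal.div_self (by norm_num) (by norm_num)]

end Modular

/-! ### Monotone Lipschitz approximation of lower semicontinuous functions. -/

section LipschitzApprox

variable {X : Type*} [PseudoEMetricSpace X]

/-- The `N`-Lipschitz regularization of the truncation of `G` at height `N`. -/
noncomputable def lipschitzApprox (G : X → ℝ≥0∞) (N : ℕ) (x : X) : ℝ≥0∞ :=
  ⨅ y, min (G y) N + N * edist x y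

theorem lipschitzApprox_le (G : X → ℝ≥0∞) (N : ℕ) (x : X) :
    lipschitzApprox G N x ≤ min (G x) N :=
  (iInf_le _ x).trans (by simp)

theorem continuous_lipschitzApprox (G : X → ℝ≥0∞) (N : ℕ) : Continuous (lipschitzApprox G N) := by
  refine continuous_of_le_add_edist N (by simp) fun x z => ?_
  rw [lipschitzApprox, lipschitzApprox, ENNReal.iInf_add]
  refine le_iInf fun y => (iInf_le _ y).trans ?_
  rw [add_assoc, ← mul_add, add_comm (edist z y)]
  gcongr
  exact edist_triangle _ _ _

theorem monotone_lipschitzApprox (G : X → ℝ≥0∞) (x : X) :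
    Monotone fun N => lipschitzApprox G N x := fun N M h => by
  refine le_iInf fun y => (iInf_le _ y).trans ?_
  gcongr

/-- For `d < G x`, lower semicontinuity keeps `G` above `d` on a ball around `x`; outside that ball
the penalty `N * edist x y` exceeds `d` once `N` is large. -/
theorem iSup_lipschitzApprox {G : X → ℝ≥0∞} (hG : LowerSemicontinuous G) (x : X) :
    ⨆ N, lipschitzApprox G N x = G x := by
  refine le_antisymm (iSup_le fun N => (lipschitzApprox_le G N x).trans (min_le_left _ _)) ?_
  refine le_of_forall_lt fun c hc => ?_
  obtain ⟨d, hcd, hd⟩ := exists_between hc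
  refine hcd.trans_le ?_
  obtain ⟨ε, hε, hball⟩ := Metric.nhds_basis_eball.eventually_iff.1 (hG x d hd)
  obtain ⟨N, hN⟩ := ENNReal.exists_nat_gt (r := max d (d / ε))
    (max_lt hd.lt_top (ENNReal.div_lt_top hd.ne_top hε.ne')).ne
  refine le_iSup_of_le N (le_iInf fun y => ?_)
  by_cases hy : edist y x < ε
  · exact (le_min (hball hy).le ((le_max_left _ _).trans hN.le)).trans le_self_add
  · rw [not_lt, edist_comm] at hy
    refine le_trans ?_ le_add_self
    calc d ≤ N * ε := by
          have := ((le_max_right d (d / ε)).trans hN.le)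
          rcases eq_or_ne ε ∞ with rfl | h
          · rcases eq_or_ne N 0 with rfl | hN0
            · have : d < 0 := by simpa using (le_max_left _ _).trans_lt hN
              simp at this
            · rw [ENNReal.mul_top (by simpa using hN0)]; exact le_top
          · rwa [ENNReal.div_le_iff hε.ne' h] at this
      _ ≤ _ := by gcongr

end LipschitzApprox

/-! ### Averages of nonnegative functions, and extension to lower semicontinuous functions. -/

section PositiveAverage

variable {n : ℕ} {σ : Measure (EuclideanSpace ℝ (Fin n))} {p : EuclideanSpace ℝ (Fin n) → ℝ≥0∞}

/-- The maximal average `sup_{t > 0} ∫ g(x - t y) dσ(y)` of a function with values in `[0, ∞]`. -/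
noncomputable def posAverage (σ : Measure (EuclideanSpace ℝ (Fin n)))
    (g : EuclideanSpace ℝ (Fin n) → ℝ≥0∞) (x : EuclideanSpace ℝ (Fin n)) : ℝ≥0∞ :=
  ⨆ (t : ℝ) (_ : 0 < t), ∫⁻ y, g (x - t • y) ∂σ

theorem posAverage_mono {g h : EuclideanSpace ℝ (Fin n) → ℝ≥0∞} (hgh : ∀ x, g x ≤ h x)
    (x : EuclideanSpace ℝ (Fin n)) : posAverage σ g x ≤ posAverage σ h x := by
  unfold posAverage
  gcongr
  exact hgh _

theorem posAverage_const_mul {c : ℝ≥0∞} (hc : c ≠ ∞) (g : EuclideanSpace ℝ (Fin n) → ℝ≥0∞)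
    (x : EuclideanSpace ℝ (Fin n)) :
    posAverage σ (fun y => c * g y) x = c * posAverage σ g x := by
  simp only [posAverage, lintegral_const_mul' _ _ hc, ENNReal.mul_iSup]

theorem maximalAverage_le_posAverage (f : EuclideanSpace ℝ (Fin n) → ℂ)
    (x : EuclideanSpace ℝ (Fin n)) :
    maximalAverage σ f x ≤ posAverage σ (fun y => ‖f y‖ₑ) x :=
  iSup₂_mono fun _ _ => enorm_integral_le_lintegral_enorm _

theorem lowerSemicontinuous_maximalAverage [IsFiniteMeasure σ]
    {f : EuclideanSpace ℝ (Fin n) → ℂ} (hf : Continuous f) {M : ℝ} (hM : ∀ x, ‖f x‖ ≤ M) :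
    LowerSemicontinuous (maximalAverage σ f) := by
  refine lowerSemicontinuous_iSup fun t => lowerSemicontinuous_iSup fun _ => ?_
  refine (Continuous.enorm ?_).lowerSemicontinuous
  refine continuous_of_dominated (bound := fun _ => M) (fun x => ?_)
    (fun x => Filter.Eventually.of_forall fun y => hM _) (integrable_const _)
    (Filter.Eventually.of_forall fun y => by fun_prop)
  exact Continuous.aestronglyMeasurable (by fun_prop)

theorem posAverage_eq_maximalAverage [IsFiniteMeasure σ]
    {g : EuclideanSpace ℝ (Fin n) → ℝ≥0∞} (hg : Continuous g) {N : ℕ} (hN : ∀ x, g x ≤ N) :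
    posAverage σ g = maximalAverage σ fun x => ((g x).toReal : ℂ) := by
  have hfin : ∀ x, g x ≠ ∞ := fun x => ((hN x).trans_lt (by simp)).ne
  ext x
  refine iSup_congr fun t => iSup_congr fun _ => ?_
  have hm : AEMeasurable (fun y => g (x - t • y)) σ :=
    (Continuous.measurable (by fun_prop)).aemeasurable
  change _ = ‖∫ y, ((g (x - t • y)).toReal : ℂ) ∂σ‖ₑ
  rw [integral_complex_ofReal, ← ofReal_norm, Complex.norm_real, Real.norm_of_nonneg
    (integral_nonneg fun _ => ENNReal.toReal_nonneg), integral_toReal hm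
    (Filter.Eventually.of_forall fun y => (hfin _).lt_top), ENNReal.ofReal_toReal]
  refine ((lintegral_mono fun y => hN _).trans_lt ?_).ne
  rw [lintegral_const]
  exact ENNReal.mul_lt_top (by simp) (measure_lt_top _ _)

theorem posAverage_iSup {g : ℕ → EuclideanSpace ℝ (Fin n) → ℝ≥0∞} (hg : ∀ N, Measurable (g N))
    (hm : ∀ x, Monotone fun N => g N x) (x : EuclideanSpace ℝ (Fin n)) :
    posAverage σ (fun y => ⨆ N, g N y) x = ⨆ N, posAverage σ (g N) x := by
  simp only [posAverage]
  rw [iSup_comm]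
  refine iSup_congr fun t => ?_
  rw [iSup_comm]
  refine iSup_congr fun _ => ?_
  exact lintegral_iSup (fun N => (hg N).comp (by fun_prop)) fun N M h y => hm _ h

/-- By monotone convergence the average is a supremum of averages of bounded continuous functions.
This supplies measurability despite the uncountable supremum over `t`. -/
theorem lowerSemicontinuous_posAverage [IsFiniteMeasure σ] {G : EuclideanSpace ℝ (Fin n) → ℝ≥0∞}
    (hG : LowerSemicontinuous G) : LowerSemicontinuous (posAverage σ G) := by
  have h : posAverage σ G = fun x => ⨆ N, posAverage σ (lipschitzApprox G N) x := by
    ext x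
    rw [← posAverage_iSup (fun N => (continuous_lipschitzApprox G N).measurable)
      (monotone_lipschitzApprox G)]
    simp only [iSup_lipschitzApprox hG]
  rw [h]
  refine lowerSemicontinuous_iSup fun N => ?_
  have hb : ∀ x, lipschitzApprox G N x ≤ N := fun x =>
    (lipschitzApprox_le G N x).trans (min_le_right _ _)
  rw [posAverage_eq_maximalAverage (continuous_lipschitzApprox G N) hb]
  refine lowerSemicontinuous_maximalAverage (M := N) ?_ fun x => ?_
  · refine Complex.continuous_ofReal.comp (ENNReal.continuousOn_toReal.comp_continuous
      (continuous_lipschitzApprox G N) fun x => ((hb x).trans_lt (by simp)).ne)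
  · rw [Complex.norm_real, Real.norm_of_nonneg ENNReal.toReal_nonneg]
    simpa using ENNReal.toReal_mono (by simp) (hb x)

theorem expPow_iSup {ι : Type*} (s : ι → ℝ≥0∞) {r : ℝ≥0∞} (h1 : 1 ≤ r) (hr : r ≠ ∞) :
    expPow (⨆ i, s i) r = ⨆ i, expPow (s i) r := by
  have h0 : 0 < r.toReal := ENNReal.toReal_pos (one_pos.trans_le h1).ne' hr
  simp only [expPow_of_ne_top hr]
  exact (ENNReal.orderIsoRpow r.toReal h0).map_iSup s

theorem measurable_expPow (hp : Measurable p) {g : EuclideanSpace ℝ (Fin n) → ℝ≥0∞}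
    (hg : Measurable g) : Measurable fun x => expPow (g x) (p x) := by
  unfold expPow
  refine Measurable.ite (hp (measurableSet_singleton _)) ?_ (hg.pow hp.ennreal_toReal)
  exact Measurable.ite (measurableSet_le hg measurable_const) measurable_const measurable_const

/-- A bound for maximal averages of bounded continuous functions extends to lower semicontinuous
functions. -/
theorem modular_posAverage_le_of_lowerSemicontinuous [IsFiniteMeasure σ] (hp : IsExponent p)
    (hpt : ∀ x, p x ≠ ∞) {C : ℝ≥0}
    (hC : ∀ (f : EuclideanSpace ℝ (Fin n) → ℂ) (M : ℝ), Continuous f → (∀ x, ‖f x‖ ≤ M) →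
      modular p (fun x => ‖f x‖ₑ) ≤ 1 → modular p (fun x => maximalAverage σ f x / C) ≤ 1)
    {G : EuclideanSpace ℝ (Fin n) → ℝ≥0∞} (hG : LowerSemicontinuous G) (hG1 : modular p G ≤ 1) :
    modular p (fun x => posAverage σ G x / C) ≤ 1 := by
  have h : posAverage σ G = fun x => ⨆ N, posAverage σ (lipschitzApprox G N) x := by
    ext x
    rw [← posAverage_iSup (fun N => (continuous_lipschitzApprox G N).measurable)
      (monotone_lipschitzApprox G)]
    simp only [iSup_lipschitzApprox hG]
  have hb : ∀ N x, lipschitzApprox G N x ≤ N := fun N x =>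
    (lipschitzApprox_le G N x).trans (min_le_right _ _)
  have hfin : ∀ N x, lipschitzApprox G N x ≠ ∞ := fun N x => ((hb N x).trans_lt (by simp)).ne
  rw [h, modular]
  simp only [ENNReal.iSup_div, expPow_iSup _ (hp.2 _) (hpt _)]
  rw [lintegral_iSup]
  · refine iSup_le fun N => ?_
    rw [posAverage_eq_maximalAverage (continuous_lipschitzApprox G N) (hb N)]
    refine hC _ N ?_ (fun x => ?_) ?_
    · refine Complex.continuous_ofReal.comp (ENNReal.continuousOn_toReal.comp_continuous
        (continuous_lipschitzApprox G N) (hfin N))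
    · rw [Complex.norm_real, Real.norm_of_nonneg ENNReal.toReal_nonneg]
      simpa using ENNReal.toReal_mono (by simp) (hb N x)
    · refine (modular_mono fun x => ?_).trans hG1
      rw [← ofReal_norm, Complex.norm_real, Real.norm_of_nonneg ENNReal.toReal_nonneg,
        ENNReal.ofReal_toReal (hfin N x)]
      exact (lipschitzApprox_le G N x).trans (min_le_left _ _)
  · exact fun N => measurable_expPow hp.1 ((lowerSemicontinuous_posAverage
      (continuous_lipschitzApprox G N).lowerSemicontinuous).measurable.div_const _)
  · refine fun N M hNM x => expPow_mono (ENNReal.div_le_div_right ?_ _) _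
    exact posAverage_mono (fun y => monotone_lipschitzApprox G y hNM) x

end PositiveAverage

/-! ### Lower semicontinuous majorants in the unit ball. -/

section Majorant

variable {n : ℕ} {p : EuclideanSpace ℝ (Fin n) → ℝ≥0∞}

theorem tsum_two_zpow_rpow_lt_le (s : ℝ≥0∞) {r : ℝ} (hr : 1 ≤ r) :
    ∑' k : ℤ, (if (2 : ℝ≥0∞) ^ k < s then ((2 : ℝ≥0∞) ^ k) ^ r else 0) ≤ 2 * s ^ r := by
  have h0 : 0 ≤ r - 1 := by linarith
  have hsplit : ∀ t : ℝ≥0∞, t ^ r = t ^ (r - 1) * t := fun t => by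
    conv_rhs => rw [← ENNReal.rpow_one t, ← ENNReal.rpow_mul, one_mul]
    rw [← ENNReal.rpow_add_of_nonneg _ _ h0 zero_le_one, sub_add_cancel]
  calc ∑' k : ℤ, (if (2 : ℝ≥0∞) ^ k < s then ((2 : ℝ≥0∞) ^ k) ^ r else 0)
      ≤ ∑' k : ℤ, s ^ (r - 1) * (if (2 : ℝ≥0∞) ^ k < s then (2 : ℝ≥0∞) ^ k else 0) := by
        refine ENNReal.tsum_le_tsum fun k => ?_
        split_ifs with h
        · rw [hsplit]
          gcongr
        · simp
    _ ≤ s ^ (r - 1) * (2 * s) := by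
        rw [ENNReal.tsum_mul_left]
        exact mul_le_mul_right (tsum_two_zpow_lt_le s) _
    _ = 2 * s ^ r := by rw [hsplit s]; ring

theorem expPow_div_le {s r : ℝ≥0∞} {c : ℝ≥0} (hc : 1 ≤ c) (h1 : 1 ≤ r) (hr : r ≠ ∞) :
    expPow (s / c) r ≤ expPow s r / c := by
  have hP1 : 1 ≤ r.toReal := by
    rwa [← ENNReal.ofReal_le_iff_le_toReal hr, ENNReal.ofReal_one]
  rw [expPow_of_ne_top hr, expPow_of_ne_top hr, ENNReal.div_rpow_of_nonneg _ _ (by positivity)]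
  refine ENNReal.div_le_div_left ?_ _
  conv_lhs => rw [← ENNReal.rpow_one (c : ℝ≥0∞)]
  exact ENNReal.rpow_le_rpow_of_exponent_le (by exact_mod_cast hc) hP1

theorem modular_div_le {g : EuclideanSpace ℝ (Fin n) → ℝ≥0∞} {c : ℝ≥0} (hc : 1 ≤ c)
    (hp : IsExponent p) (hpt : ∀ x, p x ≠ ∞) :
    modular p (fun x => g x / c) ≤ modular p g / c := by
  rw [modular, modular, div_eq_mul_inv, ← lintegral_mul_const' _ _ (by simp; positivity)]
  exact lintegral_mono fun x => expPow_div_le hc (hp.2 x) (hpt x)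

/-- Functions in the unit ball of a variable exponent space with bounded exponent have lower
semicontinuous majorants in a multiple of the unit ball. -/
theorem exists_lowerSemicontinuous_majorant (hp : IsExponent p) {L : ℝ}
    (hpL : ∀ x, p x ≤ ENNReal.ofReal L) :
    ∃ C : ℝ≥0, 0 < C ∧ ∀ f : EuclideanSpace ℝ (Fin n) → ℝ≥0∞, AEMeasurable f →
      modular p f ≤ 1 → ∃ G : EuclideanSpace ℝ (Fin n) → ℝ≥0∞, LowerSemicontinuous G ∧
        (∀ x, f x ≤ G x) ∧ modular p (fun x => G x / C) ≤ 1 := by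
  have hpt : ∀ x, p x ≠ ∞ := fun x => ((hpL x).trans_lt ENNReal.ofReal_lt_top).ne
  have hP1 : ∀ x, 1 ≤ (p x).toReal := fun x => by
    rw [← ENNReal.ofReal_le_iff_le_toReal (hpt x), ENNReal.ofReal_one]; exact hp.2 x
  have hL0 : 0 ≤ L := by
    by_contra! h
    have := (hp.2 0).trans (hpL 0)
    rw [ENNReal.ofReal_of_nonpos h.le] at this
    simp at this
  have hPL : ∀ x, (p x).toReal ≤ L := fun x => ENNReal.toReal_le_of_le_ofReal hL0 (hpL x)
  have hpm : Measurable fun x => (p x).toReal := hp.1.ennreal_toReal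
  -- `2 ^ L` comes from using the height `2^(k+1)` over the level `2^k`, 2 from the dyadic sum of
  -- powers, and 1 from the total excess of the open neighbourhoods.
  set c : ℝ≥0 := 2 ^ L * 2 + 1
  have hc1 : 1 ≤ c := le_add_self
  refine ⟨c, one_pos.trans_le hc1, fun f hf hf1 => ?_⟩
  -- The majorant must dominate everywhere, because `σ` may charge Lebesgue-null sets. Hence the
  -- value `∞` is placed on a null set containing all points where `f` differs from its measurable
  -- version.
  obtain ⟨F, hF, hfF, hFf⟩ : ∃ F : EuclideanSpace ℝ (Fin n) → ℝ≥0∞, Measurable F ∧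
      (∀ x, f x ≤ F x) ∧ F =ᵐ[volume] f := by
    set Z := toMeasurable volume {x | f x ≠ hf.mk f x}
    have hZ : volume Z = 0 := by rw [measure_toMeasurable]; exact hf.ae_eq_mk
    have hZm : MeasurableSet Z := measurableSet_toMeasurable _ _
    refine ⟨fun x => hf.mk f x + Z.indicator (fun _ => ∞) x,
      hf.measurable_mk.add (measurable_const.indicator hZm), fun x => ?_, ?_⟩
    · by_cases hx : x ∈ Z
      · simp [hx]
      · have : f x = hf.mk f x := by
          by_contra h
          exact hx (subset_toMeasurable _ _ h)
        simp [this]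
    · have : ∀ᵐ x, x ∉ Z := measure_eq_zero_iff_ae_notMem.1 hZ
      filter_upwards [this, hf.ae_eq_mk] with x hx hx'
      simp [hx, hx']
  have hF1 : modular p F ≤ 1 := by
    refine le_trans (le_of_eq (lintegral_congr_ae ?_)) hf1
    filter_upwards [hFf] with x hx
    rw [hx]
  have hzpow : ∀ k : ℤ, (2 : ℝ≥0∞) ^ k ≠ ∞ := fun k => ENNReal.zpow_ne_top (by norm_num) (by norm_num) k
  set w : ℤ → EuclideanSpace ℝ (Fin n) → ℝ≥0∞ := fun k x => ((2 : ℝ≥0∞) ^ (k + 1)) ^ (p x).toReal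
  have hwm : ∀ k, Measurable (w k) := fun k => measurable_const.pow hpm
  have hwb : ∀ k, ∃ B : ℝ≥0∞, B ≠ ∞ ∧ ∀ x, w k x ≤ B := fun k => by
    refine ⟨max 1 ((2 : ℝ≥0∞) ^ (k + 1)) ^ L, ENNReal.rpow_ne_top_of_nonneg hL0
      (max_lt (by simp) (hzpow _).lt_top).ne, fun x => ?_⟩
    calc w k x ≤ max 1 ((2 : ℝ≥0∞) ^ (k + 1)) ^ (p x).toReal :=
          ENNReal.rpow_le_rpow (le_max_right _ _) ENNReal.toReal_nonneg
      _ ≤ _ := ENNReal.rpow_le_rpow_of_exponent_le (le_max_left _ _) (hPL x)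
  -- Each level set `{F > 2^k}` is enclosed in an open set with small excess for the measure of
  -- density `w k`. Boundedness of `p` makes this measure locally finite, hence outer regular.
  obtain ⟨ε, hε0, hε⟩ := ENNReal.exists_pos_sum_of_countable (ε := 1) one_ne_zero ℤ
  have hO : ∀ k : ℤ, ∃ U : Set (EuclideanSpace ℝ (Fin n)), {x | (2 : ℝ≥0∞) ^ k < F x} ⊆ U ∧
      IsOpen U ∧ ∫⁻ x in U, w k x ≤ (∫⁻ x in {x | (2 : ℝ≥0∞) ^ k < F x}, w k x) + ε k := fun k => by
    obtain ⟨B, hB, hwB⟩ := hwb k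
    have hle : volume.withDensity (w k) ≤ B • volume := by
      rw [← withDensity_const]
      exact withDensity_mono (Filter.Eventually.of_forall hwB)
    have : IsLocallyFiniteMeasure (volume.withDensity (w k)) := by
      have : IsLocallyFiniteMeasure (B • (volume : Measure (EuclideanSpace ℝ (Fin n)))) := by
        lift B to ℝ≥0 using hB
        change IsLocallyFiniteMeasure (B • (volume : Measure (EuclideanSpace ℝ (Fin n))))
        infer_instance
      exact ⟨fun x => (Measure.finiteAt_nhds _ x).measure_mono hle⟩
    obtain ⟨U, hU, hUo, h⟩ := Set.exists_isOpen_le_add {x | (2 : ℝ≥0∞) ^ k < F x}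
      (volume.withDensity (w k)) (ε := ε k) (by simpa using (hε0 k).ne')
    refine ⟨U, hU, hUo, ?_⟩
    rwa [withDensity_apply _ hUo.measurableSet,
      withDensity_apply _ (measurableSet_lt measurable_const hF)] at h
  choose U hFU hUo hU using hO
  refine ⟨fun x => ⨆ k : ℤ, (U k).indicator (fun _ => (2 : ℝ≥0∞) ^ (k + 1)) x,
    lowerSemicontinuous_iSup fun k => (hUo k).lowerSemicontinuous_indicator zero_le,
    fun x => (hfF x).trans ?_, (modular_div_le hc1 hp hpt).trans ?_⟩
  · rcases eq_or_ne (F x) 0 with h0 | h0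
    · simp [h0]
    have hmem : ∀ k : ℤ, (2 : ℝ≥0∞) ^ k < F x →
        (2 : ℝ≥0∞) ^ (k + 1) ≤ ⨆ k : ℤ, (U k).indicator (fun _ => (2 : ℝ≥0∞) ^ (k + 1)) x :=
      fun k hk => le_iSup_of_le k (by rw [indicator_of_mem (hFU k hk)])
    rcases eq_or_ne (F x) ∞ with ht | ht
    · rw [ht]
      refine le_of_forall_lt fun b hb => ?_
      obtain ⟨N, hN⟩ := ENNReal.exists_nat_gt hb.ne
      refine hN.trans_le (le_trans ?_ (hmem N (by rw [ht]; exact (hzpow _).lt_top)))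
      rw [← Nat.cast_succ, zpow_natCast]
      exact_mod_cast (Nat.lt_two_pow_self.le.trans (Nat.pow_le_pow_right two_pos (Nat.le_succ N)))
    · obtain ⟨k, hk1, hk2⟩ := ENNReal.exists_mem_Ioc_zpow h0 ht (y := 2) (by norm_num) (by norm_num)
      exact hk2.trans (hmem k hk1)
  · refine ENNReal.div_le_of_le_mul ?_
    rw [one_mul]
    calc modular p (fun x => ⨆ k : ℤ, (U k).indicator (fun _ => (2 : ℝ≥0∞) ^ (k + 1)) x)
        ≤ ∫⁻ x, ∑' k : ℤ, (U k).indicator (w k) x := by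
          refine lintegral_mono fun x => ?_
          have hx1 := hP1 x
          simp only
          rw [expPow_iSup _ (hp.2 x) (hpt x)]
          refine iSup_le fun k => le_trans ?_ (ENNReal.le_tsum k)
          rw [expPow_of_ne_top (hpt x)]
          by_cases hx : x ∈ U k
          · simp [hx, w]
          · simp only [hx, not_false_eq_true, indicator_of_notMem]
            rw [ENNReal.zero_rpow_of_pos (by linarith)]
      _ = ∑' k : ℤ, ∫⁻ x in U k, w k x := by
          rw [lintegral_tsum fun k => ((hwm k).indicator (hUo k).measurableSet).aemeasurable]
          congr 1; ext k
          rw [lintegral_indicator (hUo k).measurableSet]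
      _ ≤ ∑' k : ℤ, ((∫⁻ x in {x | (2 : ℝ≥0∞) ^ k < F x}, w k x) + ε k) :=
          ENNReal.tsum_le_tsum hU
      _ = (∫⁻ x, ∑' k : ℤ, {x | (2 : ℝ≥0∞) ^ k < F x}.indicator (w k) x) + ∑' k, (ε k : ℝ≥0∞) := by
          have hms : ∀ k : ℤ, MeasurableSet {x | (2 : ℝ≥0∞) ^ k < F x} := fun k =>
            measurableSet_lt measurable_const hF
          rw [ENNReal.tsum_add, lintegral_tsum fun k => ((hwm k).indicator (hms k)).aemeasurable]
          congr 2; ext k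
          rw [lintegral_indicator (hms k)]
      _ ≤ (∫⁻ x, 2 ^ L * 2 * expPow (F x) (p x)) + 1 := by
          refine add_le_add (lintegral_mono fun x => ?_) hε.le
          have hx1 := hP1 x
          rw [expPow_of_ne_top (hpt x), mul_assoc]
          calc ∑' k : ℤ, {x | (2 : ℝ≥0∞) ^ k < F x}.indicator (w k) x
              ≤ ∑' k : ℤ, 2 ^ L * (if (2 : ℝ≥0∞) ^ k < F x then
                  ((2 : ℝ≥0∞) ^ k) ^ (p x).toReal else 0) := by
                refine ENNReal.tsum_le_tsum fun k => ?_
                simp only [indicator_apply, mem_ofPred_eq]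
                split_ifs with h
                · simp only [w]
                  rw [ENNReal.zpow_add (by norm_num) (by norm_num), zpow_one, mul_comm,
                    ENNReal.mul_rpow_of_nonneg _ _ (by positivity)]
                  refine mul_le_mul_left ?_ _
                  exact ENNReal.rpow_le_rpow_of_exponent_le (by norm_num) (hPL x)
                · exact zero_le
            _ ≤ _ := by
                rw [ENNReal.tsum_mul_left]
                exact mul_le_mul_right (tsum_two_zpow_rpow_lt_le _ hx1) _
      _ ≤ 2 ^ L * 2 * 1 + 1 := by
          rw [lintegral_const_mul' _ _ (ENNReal.mul_ne_top
            (ENNReal.rpow_ne_top_of_nonneg hL0 (by norm_num)) (by norm_num))]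
          gcongr
          exact hF1
      _ = c := by
          simp only [c]
          push_cast [ENNReal.coe_rpow_of_nonneg _ hL0]
          ring

end Majorant

/-! ### Density of bounded continuous functions. -/

section Density

open Filter

variable {n : ℕ} {p : EuclideanSpace ℝ (Fin n) → ℝ≥0∞}

/-- The radial retraction onto the disc of radius `k` moves `w` by `‖w‖ - k` when `w` lies outside,
which is at most its distance to any `z` in the disc. It turns an `L¹` approximant into a bounded
one at the cost of a factor 2. -/
theorem exists_norm_sub_clip_le {k : ℝ} (hk : 0 < k) :
    ∃ ρ : ℂ → ℂ, Continuous ρ ∧ (∀ w, ‖ρ w‖ ≤ k) ∧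
      ∀ z w : ℂ, ‖z‖ ≤ k → ‖z - ρ w‖ ≤ 2 * ‖z - w‖ := by
  have hm : ∀ w : ℂ, 0 < max ‖w‖ k := fun w => hk.trans_le (le_max_right _ _)
  refine ⟨fun w => ((k / max ‖w‖ k : ℝ) : ℂ) * w, ?_, fun w => ?_, fun z w hz => ?_⟩
  · refine (Complex.continuous_ofReal.comp ?_).mul continuous_id
    exact continuous_const.div (by fun_prop) fun w => (hm w).ne'
  · rw [norm_mul, Complex.norm_real, Real.norm_of_nonneg (div_pos hk (hm w)).le,
      div_mul_eq_mul_div, div_le_iff₀ (hm w)]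
    gcongr
    exact le_max_left _ _
  · rcases le_total ‖w‖ k with h | h
    · simp only
      rw [max_eq_right h, div_self hk.ne', Complex.ofReal_one, one_mul]
      linarith [norm_nonneg (z - w)]
    · simp only
      rw [max_eq_left h]
      have hw : 0 < ‖w‖ := hk.trans_le h
      have h1 : ‖w - ((k / ‖w‖ : ℝ) : ℂ) * w‖ = ‖w‖ - k := by
        have : w - ((k / ‖w‖ : ℝ) : ℂ) * w = ((1 - k / ‖w‖ : ℝ) : ℂ) * w := by push_cast; ring
        rw [this, norm_mul, Complex.norm_real, Real.norm_of_nonneg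
          (sub_nonneg.2 ((div_le_one hw).2 h)), sub_mul, one_mul, div_mul_cancel₀ _ hw.ne']
      have h2 : ‖w‖ ≤ ‖z - w‖ + ‖z‖ := by
        have := norm_sub_le z (z - w)
        rw [sub_sub_cancel] at this
        linarith
      calc ‖z - ((k / ‖w‖ : ℝ) : ℂ) * w‖ ≤ ‖z - w‖ + ‖w - ((k / ‖w‖ : ℝ) : ℂ) * w‖ :=
            norm_sub_le_norm_sub_add_norm_sub _ _ _
        _ ≤ _ := by rw [h1]; linarith

/-- Bounded continuous functions are dense in variable exponent spaces with bounded exponent. -/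
theorem exists_continuous_modular_sub_le (hp : IsExponent p) {L : ℝ} (hL : 0 ≤ L)
    (hpL : ∀ x, p x ≤ ENNReal.ofReal L) {f : EuclideanSpace ℝ (Fin n) → ℂ} (hf : AEMeasurable f)
    (hfin : modular p (fun x => ‖f x‖ₑ) ≠ ∞) {ε : ℝ≥0∞} (hε : ε ≠ 0) :
    ∃ (g : EuclideanSpace ℝ (Fin n) → ℂ) (M : ℝ), Continuous g ∧ (∀ x, ‖g x‖ ≤ M) ∧
      modular p (fun x => ‖f x - g x‖ₑ) ≤ ε := by
  have hpt : ∀ x, p x ≠ ∞ := fun x => ((hpL x).trans_lt ENNReal.ofReal_lt_top).ne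
  have hP1 : ∀ x, 1 ≤ (p x).toReal := fun x => by
    rw [← ENNReal.ofReal_le_iff_le_toReal (hpt x), ENNReal.ofReal_one]; exact hp.2 x
  have hPL : ∀ x, (p x).toReal ≤ L := fun x => ENNReal.toReal_le_of_le_ofReal hL (hpL x)
  wlog hfm : Measurable f generalizing f
  · obtain ⟨g, M, hg, hM, h⟩ := this hf.measurable_mk.aemeasurable (f := hf.mk f) (by
      refine ne_of_eq_of_ne (lintegral_congr_ae ?_) hfin
      filter_upwards [hf.ae_eq_mk] with x hx
      rw [hx]) hf.measurable_mk
    refine ⟨g, M, hg, hM, le_trans (le_of_eq (lintegral_congr_ae ?_)) h⟩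
    filter_upwards [hf.ae_eq_mk] with x hx
    rw [hx]
  set c : ℝ≥0∞ := 2 ^ L
  have hc0 : c ≠ 0 := by simp [c]
  have hct : c ≠ ∞ := ENNReal.rpow_ne_top_of_nonneg hL (by norm_num)
  -- The error is split between truncation and approximation of the truncated function; `c = 2 ^ L`
  -- bounds the constant in `(s + t)^p ≤ 2^(p-1) (s^p + t^p)`.
  set η : ℝ≥0∞ := ε / c / 2
  have hη : c * (η + η) = ε := by
    rw [ENNReal.add_halves, ENNReal.mul_div_cancel hc0 hct]
  have hη0 : η ≠ 0 := (ENNReal.div_pos (ENNReal.div_pos hε hct).ne' (by norm_num)).ne'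
  set s : ℕ → Set (EuclideanSpace ℝ (Fin n)) := fun k => {x | ‖f x‖ ≤ k ∧ ‖x‖ ≤ k}
  have hs : ∀ k, MeasurableSet (s k) := fun k =>
    (measurableSet_le hfm.norm measurable_const).inter
      (measurableSet_le measurable_norm measurable_const)
  have hmod : Measurable fun x => expPow ‖f x‖ₑ (p x) := measurable_expPow hp.1 hfm.enorm
  have hlim : Tendsto (fun k => ∫⁻ x, (s k)ᶜ.indicator (fun x => expPow ‖f x‖ₑ (p x)) x) atTop
      (nhds (∫⁻ _ : EuclideanSpace ℝ (Fin n), 0)) := by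
    refine tendsto_lintegral_of_dominated_convergence (fun x => expPow ‖f x‖ₑ (p x))
      (fun k => hmod.indicator (hs k).compl)
      (fun k => Eventually.of_forall fun x => indicator_le_self _ _ _) hfin
      (Eventually.of_forall fun x => ?_)
    obtain ⟨K, hK⟩ := exists_nat_ge (max ‖f x‖ ‖x‖)
    refine tendsto_const_nhds.congr' ?_
    filter_upwards [eventually_ge_atTop K] with k hk
    have hkK : (K : ℝ) ≤ k := by exact_mod_cast hk
    rw [indicator_of_notMem]
    simp only [mem_compl_iff, not_not]
    exact ⟨((le_max_left _ _).trans hK).trans hkK, ((le_max_right _ _).trans hK).trans hkK⟩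
  rw [lintegral_zero] at hlim
  obtain ⟨k, hk, hk1⟩ := ((hlim.eventually_lt_const (pos_iff_ne_zero.2 hη0)).and
    (eventually_ge_atTop 1)).exists
  have hk0 : (0 : ℝ) < k := by exact_mod_cast hk1
  have hk1' : (1 : ℝ) ≤ k := by exact_mod_cast hk1
  set h : EuclideanSpace ℝ (Fin n) → ℂ := (s k).indicator f
  have hhk : ∀ x, ‖h x‖ ≤ k := fun x => by
    by_cases hx : x ∈ s k
    · simp only [h, indicator_of_mem hx]; exact hx.1
    · simp [h, indicator_of_notMem hx]
  have hhm : Measurable h := hfm.indicator (hs k)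
  have hsk : s k ⊆ Metric.closedBall 0 k := fun x hx => by simpa using hx.2
  have hhi : Integrable h := by
    rw [integrable_indicator_iff (hs k)]
    exact Measure.integrableOn_of_bounded (M := k)
      ((measure_mono hsk).trans_lt measure_closedBall_lt_top).ne hfm.aestronglyMeasurable
      ((ae_restrict_iff' (hs k)).2 (Eventually.of_forall fun x hx => hx.1))
  obtain ⟨ρ, hρc, hρk, hρ⟩ := exists_norm_sub_clip_le hk0
  -- Both the truncated function and the clipped approximant are bounded by `k`, so the `p`-th power
  -- of their difference is at most `(2k)^(p-1)` times the difference: the modular is controlled by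
  -- the `L¹` distance.
  set D : ℝ≥0∞ := ENNReal.ofReal (2 * k) ^ L * 2
  have hD0 : D ≠ 0 := by
    have : ENNReal.ofReal (2 * k) ≠ 0 := by
      simp only [ne_eq, ENNReal.ofReal_eq_zero, not_le]; positivity
    refine mul_ne_zero ?_ two_ne_zero
    exact (ENNReal.rpow_pos (pos_iff_ne_zero.2 this) ENNReal.ofReal_ne_top).ne'
  have hDt : D ≠ ∞ := ENNReal.mul_ne_top
    (ENNReal.rpow_ne_top_of_nonneg hL ENNReal.ofReal_ne_top) (by norm_num)
  obtain ⟨w, -, hw, hwc, -⟩ := hhi.exists_hasCompactSupport_lintegral_sub_le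
    (ε := η / D) (ENNReal.div_pos hη0 hDt).ne'
  refine ⟨fun x => ρ (w x), k, hρc.comp hwc, fun x => hρk _, ?_⟩
  have hA : ∀ x, expPow ‖f x - h x‖ₑ (p x) = (s k)ᶜ.indicator (fun x => expPow ‖f x‖ₑ (p x)) x :=
    fun x => by
      have hx1 := hP1 x
      by_cases hx : x ∈ s k
      · rw [indicator_of_notMem (by simpa using hx)]
        simp only [h, indicator_of_mem hx, sub_self, enorm_zero]
        rw [expPow_of_ne_top (hpt x), ENNReal.zero_rpow_of_pos (by linarith)]
      · rw [indicator_of_mem (by simpa using hx)]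
        simp [h, indicator_of_notMem hx]
  have hB : ∀ x, expPow ‖h x - ρ (w x)‖ₑ (p x) ≤ D * ‖h x - w x‖ₑ := fun x => by
    have hx1 := hP1 x
    have hb : ‖h x - ρ (w x)‖ₑ ≤ ENNReal.ofReal (2 * k) := by
      rw [← ofReal_norm]
      refine ENNReal.ofReal_le_ofReal ((norm_sub_le _ _).trans ?_)
      linarith [hhk x, hρk (w x)]
    have hb' : ‖h x - ρ (w x)‖ₑ ≤ 2 * ‖h x - w x‖ₑ := by
      have h2 : (2 : ℝ≥0∞) = ENNReal.ofReal 2 := by simp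
      rw [← ofReal_norm, ← ofReal_norm, h2, ← ENNReal.ofReal_mul zero_le_two]
      exact ENNReal.ofReal_le_ofReal (hρ _ _ (hhk x))
    rw [expPow_of_ne_top (hpt x)]
    calc ‖h x - ρ (w x)‖ₑ ^ (p x).toReal
        = ‖h x - ρ (w x)‖ₑ ^ ((p x).toReal - 1) * ‖h x - ρ (w x)‖ₑ := by
          conv_rhs => rw [← ENNReal.rpow_one ‖h x - ρ (w x)‖ₑ, ← ENNReal.rpow_mul, one_mul]
          rw [← ENNReal.rpow_add_of_nonneg _ _ (by linarith) zero_le_one, sub_add_cancel]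
      _ ≤ ENNReal.ofReal (2 * k) ^ L * (2 * ‖h x - w x‖ₑ) := by
          refine mul_le_mul' ?_ hb'
          refine (ENNReal.rpow_le_rpow hb (by linarith)).trans ?_
          refine ENNReal.rpow_le_rpow_of_exponent_le ?_ (by linarith [hPL x])
          rw [← ENNReal.ofReal_one]
          exact ENNReal.ofReal_le_ofReal (by linarith)
      _ = _ := by rw [mul_assoc]
  calc modular p (fun x => ‖f x - ρ (w x)‖ₑ)
      ≤ ∫⁻ x, c * ((s k)ᶜ.indicator (fun x => expPow ‖f x‖ₑ (p x)) x + D * ‖h x - w x‖ₑ) := by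
        refine lintegral_mono fun x => ?_
        simp only
        rw [← hA]
        refine le_trans ?_ (mul_le_mul_right (add_le_add_right (hB x) _) _)
        have htri : ‖f x - ρ (w x)‖ₑ ≤ ‖f x - h x‖ₑ + ‖h x - ρ (w x)‖ₑ := by
          have : f x - ρ (w x) = (f x - h x) + (h x - ρ (w x)) := by ring
          rw [this]
          exact enorm_add_le _ _
        refine (expPow_mono htri _).trans ?_
        simp only [expPow_of_ne_top (hpt x)]
        refine (ENNReal.rpow_add_le_mul_rpow_add_rpow _ _ (hP1 x)).trans (mul_le_mul_left ?_ _)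
        exact ENNReal.rpow_le_rpow_of_exponent_le (by norm_num) (by linarith [hPL x])
    _ = c * ((∫⁻ x, (s k)ᶜ.indicator (fun x => expPow ‖f x‖ₑ (p x)) x) +
          D * ∫⁻ x, ‖h x - w x‖ₑ) := by
        rw [lintegral_const_mul' _ _ hct, lintegral_add_left (hmod.indicator (hs k).compl),
          lintegral_const_mul' _ _ hDt]
    _ ≤ c * (η + D * (η / D)) := by gcongr
    _ = ε := by rw [ENNReal.mul_div_cancel hD0 hDt, hη]

end Density

/-! ### General functions: norm bound, integrability and measurability. -/

section General

open Filter

variable {n : ℕ} {p : EuclideanSpace ℝ (Fin n) → ℝ≥0∞}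
  {σ : Measure (EuclideanSpace ℝ (Fin n))}

theorem exists_modular_div_le_one (hp : IsExponent p) (hpt : ∀ x, p x ≠ ∞)
    {f : EuclideanSpace ℝ (Fin n) → ℂ} (hf : MemLpVar p f) :
    ∃ c : ℝ≥0, 0 < c ∧ modular p (fun x => ‖f x‖ₑ / c) ≤ 1 := by
  obtain ⟨-, c, hc, h⟩ := hf
  set k : ℝ≥0 := max 1 (modular p fun x => ‖f x‖ₑ / c).toNNReal
  have hk1 : 1 ≤ k := le_max_left _ _
  refine ⟨c * k, by positivity, ?_⟩
  have e : ∀ x, ‖f x‖ₑ / (c * k : ℝ≥0) = ‖f x‖ₑ / c / k := fun x => by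
    rw [ENNReal.coe_mul, div_eq_mul_inv, ENNReal.mul_inv (by simp) (by simp), ← mul_assoc]; rfl
  simp only [e]
  refine (modular_div_le hk1 hp hpt).trans (ENNReal.div_le_of_le_mul ?_)
  rw [one_mul, ← ENNReal.coe_toNNReal h.ne]
  exact_mod_cast le_max_right _ _

/-- A bound for positive maximal averages on the unit ball, with measurable majorants. -/
def PosAverageBound (σ : Measure (EuclideanSpace ℝ (Fin n)))
    (p : EuclideanSpace ℝ (Fin n) → ℝ≥0∞) (C : ℝ≥0) : Prop :=
  0 < C ∧ ∀ f : EuclideanSpace ℝ (Fin n) → ℝ≥0∞, AEMeasurable f → modular p f ≤ 1 →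
    ∃ F : EuclideanSpace ℝ (Fin n) → ℝ≥0∞, Measurable F ∧ (∀ x, posAverage σ f x ≤ F x) ∧
      modular p (fun x => F x / C) ≤ 1

/-- The lower semicontinuous majorant `G` of `f` reduces everything to the semicontinuous case, and
the average of `G` serves as the measurable `F`; the average of `f` itself is not known to be
measurable. -/
theorem exists_posAverageBound [IsFiniteMeasure σ] (hp : IsExponent p) {L : ℝ}
    (hpL : ∀ x, p x ≤ ENNReal.ofReal L) {C : ℝ≥0} (hC0 : 0 < C)
    (hC : ∀ (f : EuclideanSpace ℝ (Fin n) → ℂ) (M : ℝ), Continuous f → (∀ x, ‖f x‖ ≤ M) →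
      modular p (fun x => ‖f x‖ₑ) ≤ 1 → modular p (fun x => maximalAverage σ f x / C) ≤ 1) :
    ∃ C' : ℝ≥0, PosAverageBound σ p C' := by
  have hpt : ∀ x, p x ≠ ∞ := fun x => ((hpL x).trans_lt ENNReal.ofReal_lt_top).ne
  obtain ⟨c, hc, h⟩ := exists_lowerSemicontinuous_majorant hp hpL
  have hc0 : (c : ℝ≥0∞) ≠ 0 := by simpa using hc.ne'
  refine ⟨c * C, by positivity, fun f hf hf1 => ?_⟩
  obtain ⟨G, hG, hfG, hG1⟩ := h f hf hf1
  refine ⟨posAverage σ G, (lowerSemicontinuous_posAverage hG).measurable,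
    fun x => posAverage_mono hfG x, ?_⟩
  have hG' : LowerSemicontinuous fun x => G x / c := by
    simp only [ENNReal.div_eq_inv_mul]
    exact (ENNReal.continuous_const_mul (by simp [hc.ne'])).comp_lowerSemicontinuous hG
      fun a b hab => mul_le_mul_right hab _
  have := modular_posAverage_le_of_lowerSemicontinuous hp hpt hC hG' hG1
  refine le_trans (le_of_eq ?_) this
  congr 1; ext x
  simp only [ENNReal.div_eq_inv_mul]
  rw [posAverage_const_mul (by simp [hc.ne']), ENNReal.coe_mul,
    ENNReal.mul_inv (by simp) (by simp), ← mul_assoc, mul_comm (c : ℝ≥0∞)⁻¹]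

variable {C : ℝ≥0}

theorem PosAverageBound.modular_div_le (hN : PosAverageBound σ p C)
    {f : EuclideanSpace ℝ (Fin n) → ℝ≥0∞} (hf : AEMeasurable f) {c : ℝ≥0} (hc : 0 < c)
    (h : modular p (fun x => f x / c) ≤ 1) :
    ∃ F : EuclideanSpace ℝ (Fin n) → ℝ≥0∞, Measurable F ∧ (∀ x, posAverage σ f x ≤ F x) ∧
      modular p (fun x => F x / (C * c : ℝ≥0)) ≤ 1 := by
  have hc0 : (c : ℝ≥0∞) ≠ 0 := by simpa using hc.ne'
  obtain ⟨F, hF, hfF, hF1⟩ := hN.2 _ (hf.div_const _) h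
  refine ⟨fun x => c * F x, hF.const_mul _, fun x => ?_, ?_⟩
  · refine le_trans (le_of_eq ?_) (mul_le_mul_right (hfF x) _)
    rw [← posAverage_const_mul ENNReal.coe_ne_top]
    congr 1; ext y
    rw [ENNReal.mul_div_cancel hc0 ENNReal.coe_ne_top]
  · refine le_trans (le_of_eq ?_) hF1
    congr 1; ext x
    have hC0 : (C : ℝ≥0∞) ≠ 0 := by simpa using hN.1.ne'
    rw [ENNReal.coe_mul, mul_comm (C : ℝ≥0∞),
      ENNReal.mul_div_mul_left _ _ hc0 ENNReal.coe_ne_top]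

theorem PosAverageBound.luxNorm_le (hN : PosAverageBound σ p C)
    {f : EuclideanSpace ℝ (Fin n) → ℝ≥0∞} (hf : AEMeasurable f) :
    luxNorm p (posAverage σ f) ≤ C * luxNorm p f := by
  have hC0 : (C : ℝ≥0∞) ≠ 0 := by simpa using hN.1.ne'
  conv_rhs => simp only [luxNorm, ENNReal.mul_iInf_of_ne hC0 ENNReal.coe_ne_top]
  refine le_iInf fun c => le_iInf fun hc => le_iInf fun h => ?_
  obtain ⟨F, -, hfF, hF⟩ := hN.modular_div_le hf hc h
  rw [← ENNReal.coe_mul]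
  refine luxNorm_le_of_modular_le_one (mul_pos hN.1 hc) ((modular_mono fun x => ?_).trans hF)
  exact ENNReal.div_le_div_right (hfF x) _

theorem luxNorm_mono {g h : EuclideanSpace ℝ (Fin n) → ℝ≥0∞} (hgh : ∀ x, g x ≤ h x) :
    luxNorm p g ≤ luxNorm p h := by
  refine le_iInf fun c => le_iInf fun hc => le_iInf fun h' => ?_
  refine luxNorm_le_of_modular_le_one hc ((modular_mono fun x => ?_).trans h')
  exact ENNReal.div_le_div_right (hgh x) _

theorem ae_lt_top_of_modular_div_le (hp : IsExponent p) (hpt : ∀ x, p x ≠ ∞) {c : ℝ≥0}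
    {F : EuclideanSpace ℝ (Fin n) → ℝ≥0∞} (hF : Measurable F)
    (h : modular p (fun x => F x / c) ≤ 1) : ∀ᵐ x, F x < ∞ := by
  filter_upwards [ae_lt_top (measurable_expPow hp.1 (hF.div_const c))
    (h.trans_lt ENNReal.one_lt_top).ne] with x hx
  rw [lt_top_iff_ne_top]
  intro htop
  have hx1 : 0 < (p x).toReal := ENNReal.toReal_pos (one_pos.trans_le (hp.2 x)).ne' (hpt x)
  rw [htop, ENNReal.top_div_coe, expPow_of_ne_top (hpt x), ENNReal.top_rpow_of_pos hx1] at hx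
  exact lt_irrefl _ hx

theorem PosAverageBound.ae_lt_top (hN : PosAverageBound σ p C) (hp : IsExponent p)
    (hpt : ∀ x, p x ≠ ∞) {f : EuclideanSpace ℝ (Fin n) → ℝ≥0∞} (hf : AEMeasurable f) {c : ℝ≥0}
    (hc : 0 < c) (h : modular p (fun x => f x / c) ≤ 1) : ∀ᵐ x, posAverage σ f x < ∞ := by
  obtain ⟨F, hF, hfF, hF1⟩ := hN.modular_div_le hf hc h
  filter_upwards [ae_lt_top_of_modular_div_le hp hpt hF hF1] with x hx
  exact (hfF x).trans_lt hx

/-- Translated dilates of null sets are null for `σ`. -/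
theorem PosAverageBound.ae_ae_notMem (hN : PosAverageBound σ p C) (hp : IsExponent p)
    (hpt : ∀ x, p x ≠ ∞) {Z : Set (EuclideanSpace ℝ (Fin n))} (hZ : volume Z = 0) :
    ∀ᵐ x, ∀ t : ℝ, 0 < t → ∀ᵐ y ∂σ, x - t • y ∉ Z := by
  set Z' := toMeasurable volume Z
  have hZm : MeasurableSet Z' := measurableSet_toMeasurable _ _
  have hZ' : volume Z' = 0 := by rw [measure_toMeasurable]; exact hZ
  -- This function has modular 0, so its maximal average is finite for almost every `x`. A finite
  -- integral of `∞` times an indicator forces the set to be null, for all `t` at once.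
  set f : EuclideanSpace ℝ (Fin n) → ℝ≥0∞ := Z'.indicator fun _ => ∞
  have hf : Measurable f := measurable_const.indicator hZm
  have h1 : modular p (fun x => f x / (1 : ℝ≥0)) ≤ 1 := by
    have : modular p (fun x => f x / (1 : ℝ≥0)) = 0 := by
      rw [modular, lintegral_eq_zero_iff' (measurable_expPow hp.1 (hf.div_const _)).aemeasurable]
      filter_upwards [measure_eq_zero_iff_ae_notMem.1 hZ'] with x hx
      have hx1 : 0 < (p x).toReal := ENNReal.toReal_pos (one_pos.trans_le (hp.2 x)).ne' (hpt x)
      simp [f, hx, expPow_of_ne_top (hpt x), hx1]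
    rw [this]; exact zero_le
  filter_upwards [hN.ae_lt_top hp hpt hf.aemeasurable one_pos h1] with x hx t ht
  have hfin : ∫⁻ y, f (x - t • y) ∂σ < ∞ := (le_iSup₂_of_le t ht le_rfl).trans_lt hx
  filter_upwards [MeasureTheory.ae_lt_top (hf.comp (by fun_prop : Measurable fun y => x - t • y))
    hfin.ne] with y hy hyZ
  have : x - t • y ∈ Z' := subset_toMeasurable _ _ hyZ
  simp [f, this] at hy

/-- Finiteness comes from the maximal bound. Measurability with respect to `σ` is the subtler point,
as `f` is only almost everywhere equal to a Borel function; the exceptional null set is avoided for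
almost every `x` and all `t`. -/
theorem PosAverageBound.ae_integrable (hN : PosAverageBound σ p C) (hp : IsExponent p)
    (hpt : ∀ x, p x ≠ ∞) {f : EuclideanSpace ℝ (Fin n) → ℂ} (hf : MemLpVar p f) :
    ∀ᵐ x, ∀ t : ℝ, 0 < t → Integrable (fun y => f (x - t • y)) σ := by
  obtain ⟨c, hc, hfc⟩ := exists_modular_div_le_one hp hpt hf
  have hZ : volume {x | f x ≠ hf.1.mk f x} = 0 := hf.1.ae_eq_mk
  filter_upwards [hN.ae_lt_top hp hpt hf.1.enorm hc hfc, hN.ae_ae_notMem hp hpt hZ] with x hx hx' t ht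
  refine ⟨?_, (le_iSup₂_of_le t ht le_rfl).trans_lt hx⟩
  refine ⟨fun y => hf.1.mk f (x - t • y),
    (hf.1.measurable_mk.comp (by fun_prop)).stronglyMeasurable, ?_⟩
  filter_upwards [hx' t ht] with y hy
  simpa using hy

theorem expPow_mul_le {s r : ℝ≥0∞} {c : ℝ≥0∞} {L : ℝ} (hc : 1 ≤ c) (hr : r ≠ ∞)
    (hrL : r.toReal ≤ L) : expPow (c * s) r ≤ c ^ L * expPow s r := by
  rw [expPow_of_ne_top hr, expPow_of_ne_top hr, ENNReal.mul_rpow_of_nonneg _ _ ENNReal.toReal_nonneg]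
  gcongr

theorem maximalAverage_le_add {f g : EuclideanSpace ℝ (Fin n) → ℂ} {x : EuclideanSpace ℝ (Fin n)}
    (hf : ∀ t : ℝ, 0 < t → Integrable (fun y => f (x - t • y)) σ)
    (hg : ∀ t : ℝ, 0 < t → Integrable (fun y => g (x - t • y)) σ) :
    maximalAverage σ f x ≤ maximalAverage σ g x + posAverage σ (fun y => ‖f y - g y‖ₑ) x := by
  refine iSup₂_le fun t ht => ?_
  have : ∫ y, f (x - t • y) ∂σ =
      (∫ y, g (x - t • y) ∂σ) + ∫ y, (f (x - t • y) - g (x - t • y)) ∂σ := by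
    rw [integral_sub (hf t ht) (hg t ht)]; ring
  rw [this]
  refine (enorm_add_le _ _).trans (add_le_add (le_iSup₂_of_le t ht le_rfl) ?_)
  exact (enorm_integral_le_lintegral_enorm _).trans
    (le_iSup₂_of_le (f := fun (t : ℝ) (_ : 0 < t) =>
      ∫⁻ y, (fun y => ‖f y - g y‖ₑ) (x - t • y) ∂σ) t ht le_rfl)

/-- The supremum over uncountably many `t` is measurable for bounded continuous functions, by
semicontinuity. For general `f` it is an almost everywhere limit of such suprema, along approximants
converging so fast that a Borel–Cantelli argument controls the maximal average of the error. -/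
theorem PosAverageBound.aemeasurable_maximalAverage [IsFiniteMeasure σ]
    (hN : PosAverageBound σ p C) (hp : IsExponent p) {L : ℝ} (hL : 0 ≤ L)
    (hpL : ∀ x, p x ≤ ENNReal.ofReal L) {f : EuclideanSpace ℝ (Fin n) → ℂ} (hf : MemLpVar p f) :
    AEMeasurable (maximalAverage σ f) := by
  have hpt : ∀ x, p x ≠ ∞ := fun x => ((hpL x).trans_lt ENNReal.ofReal_lt_top).ne
  have hPL : ∀ x, (p x).toReal ≤ L := fun x => ENNReal.toReal_le_of_le_ofReal hL (hpL x)
  have hfin : modular p (fun x => ‖f x‖ₑ) ≠ ∞ := by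
    obtain ⟨-, c, hc, h⟩ := hf
    refine ne_top_of_le_ne_top (ENNReal.mul_ne_top (ENNReal.rpow_ne_top_of_nonneg hL
      (ENNReal.coe_ne_top (r := max 1 c))) h.ne) (b := ((max 1 c : ℝ≥0) : ℝ≥0∞) ^ L * _) ?_
    rw [modular, modular, ← lintegral_const_mul' _ _
      (ENNReal.rpow_ne_top_of_nonneg hL ENNReal.coe_ne_top)]
    refine lintegral_mono fun x => ?_
    refine le_trans (expPow_mono ?_ _) (expPow_mul_le (by exact_mod_cast le_max_left _ _)
      (hpt x) (hPL x))
    calc ‖f x‖ₑ = c * (‖f x‖ₑ / c) :=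
          (ENNReal.mul_div_cancel (by simpa using hc.ne') ENNReal.coe_ne_top).symm
      _ ≤ _ := mul_le_mul_left (by exact_mod_cast le_max_right _ _) _
  set a : ℕ → ℝ≥0∞ := fun i => 2 ^ i
  have ha1 : ∀ i, 1 ≤ a i := fun i => one_le_pow₀ (by norm_num)
  have hat : ∀ i, a i ≠ ∞ := fun i => by simp [a]
  have haL0 : ∀ i, a i ^ L ≠ 0 := fun i =>
    (ENNReal.rpow_pos (one_pos.trans_le (ha1 i)) (hat i)).ne'
  have haLt : ∀ i, a i ^ L ≠ ∞ := fun i => ENNReal.rpow_ne_top_of_nonneg hL (hat i)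
  -- The tolerance is chosen so that `4^i ‖f - g i‖` still lies in the unit ball.
  choose g M hg hM hgf using fun i => exists_continuous_modular_sub_le hp hL hpL hf.1 hfin
    (ε := 1 / (a (2 * i)) ^ L) (by simp [haLt])
  have hh1 : ∀ i, modular p (fun x => a (2 * i) * ‖f x - g i x‖ₑ) ≤ 1 := fun i => by
    calc modular p (fun x => a (2 * i) * ‖f x - g i x‖ₑ)
        ≤ a (2 * i) ^ L * modular p (fun x => ‖f x - g i x‖ₑ) := by
          rw [modular, modular, ← lintegral_const_mul' _ _ (haLt _)]
          exact lintegral_mono fun x => expPow_mul_le (ha1 _) (hpt x) (hPL x)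
      _ ≤ a (2 * i) ^ L * (1 / a (2 * i) ^ L) := mul_le_mul_right (hgf i) _
      _ = 1 := ENNReal.mul_div_cancel (haL0 _) (haLt _)
  have hmeas : ∀ i, AEMeasurable fun x => ‖f x - g i x‖ₑ := fun i =>
    (hf.1.sub (hg i).measurable.aemeasurable).enorm
  choose F hFm hfF hF using fun i => hN.2 _ ((hmeas i).const_mul (a (2 * i))) (hh1 i)
  -- The modulars are at most `2^(-i)`, hence the terms tend to 0 almost everywhere and `F i x ≤ C
  -- 2^i` eventually. As `F i` dominates `4^i` times the maximal average of the error, that average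
  -- is at most `C 2^(-i)`.
  have hsum : ∀ᵐ x, ∑' i, expPow (F i x / C / (2 ^ i : ℝ≥0)) (p x) < ∞ := by
    have hm : ∀ i, Measurable fun x => expPow (F i x / C / (2 ^ i : ℝ≥0)) (p x) := fun i =>
      measurable_expPow hp.1 (((hFm i).div_const _).div_const _)
    refine MeasureTheory.ae_lt_top (Measurable.tsum hm) ?_
    rw [lintegral_tsum fun i => (hm i).aemeasurable]
    refine ne_top_of_le_ne_top (b := ∑' i : ℕ, (2⁻¹ : ℝ≥0∞) ^ i) (by simp) ?_
    refine ENNReal.tsum_le_tsum fun i => ?_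
    refine (VarLp.modular_div_le (g := fun x => F i x / C) (one_le_pow₀ one_le_two) hp hpt).trans ?_
    refine (ENNReal.div_le_div_right (hF i) _).trans (le_of_eq ?_)
    rw [one_div, ENNReal.coe_pow, ENNReal.coe_ofNat, ENNReal.inv_pow]
  refine aemeasurable_of_tendsto_metrizable_ae atTop (f := fun i => maximalAverage σ (g i))
    (fun i => (lowerSemicontinuous_maximalAverage (hg i) (hM i)).measurable.aemeasurable) ?_
  obtain ⟨c, hc, hfc⟩ := exists_modular_div_le_one hp hpt hf
  filter_upwards [hsum, hN.ae_lt_top hp hpt hf.1.enorm hc hfc, hN.ae_integrable hp hpt hf]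
    with x hx hxf hxi
  have hgi : ∀ i (t : ℝ), 0 < t → Integrable (fun y => g i (x - t • y)) σ := fun i t _ =>
    Integrable.of_bound (Continuous.aestronglyMeasurable (by have := hg i; fun_prop)) (M i)
      (Eventually.of_forall fun y => hM i _)
  have hlim : Tendsto (fun i => posAverage σ (fun y => ‖f y - g i y‖ₑ) x) atTop (nhds 0) := by
    have h0 : Tendsto (fun i => expPow (F i x / C / (2 ^ i : ℝ≥0)) (p x)) atTop (nhds 0) :=
      ENNReal.tendsto_atTop_zero_of_tsum_ne_top hx.ne
    have hCpow : Tendsto (fun i : ℕ => (C : ℝ≥0∞) * (2⁻¹ : ℝ≥0∞) ^ i) atTop (nhds 0) := by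
      have := ENNReal.Tendsto.const_mul (a := (C : ℝ≥0∞))
        (ENNReal.tendsto_pow_atTop_nhds_zero_of_lt_one (r := 2⁻¹) (by simp))
        (Or.inr ENNReal.coe_ne_top)
      simpa using this
    refine tendsto_of_tendsto_of_tendsto_of_le_of_le' tendsto_const_nhds hCpow
      (Eventually.of_forall fun _ => zero_le) ?_
    filter_upwards [h0.eventually_lt_const one_pos] with i hi
    have hx1 : 0 < (p x).toReal := ENNReal.toReal_pos (one_pos.trans_le (hp.2 x)).ne' (hpt x)
    rw [expPow_of_ne_top (hpt x)] at hi
    replace hi := lt_of_not_ge fun h => hi.not_ge (ENNReal.one_le_rpow h hx1)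
    have hC0 : (C : ℝ≥0∞) ≠ 0 := by simpa using hN.1.ne'
    have h2i : ((2 ^ i : ℝ≥0) : ℝ≥0∞) = a i := by simp [a]
    rw [h2i] at hi
    have hai0 : a i ≠ 0 := (one_pos.trans_le (ha1 i)).ne'
    have hFi : F i x ≤ C * a i := by
      have := hi.le
      rw [ENNReal.div_le_iff hai0 (hat i), one_mul, ENNReal.div_le_iff hC0 ENNReal.coe_ne_top] at this
      rwa [mul_comm]
    have hle := (hfF i x).trans hFi
    rw [posAverage_const_mul (hat _)] at hle
    have hsq : a (2 * i) = a i * a i := by simp only [a]; rw [← pow_add, two_mul]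
    rw [hsq, mul_comm (C : ℝ≥0∞), mul_assoc, ENNReal.mul_le_mul_iff_right hai0 (hat i)] at hle
    calc posAverage σ (fun y => ‖f y - g i y‖ₑ) x
        = (a i)⁻¹ * (a i * posAverage σ (fun y => ‖f y - g i y‖ₑ) x) := by
          rw [← mul_assoc, ENNReal.inv_mul_cancel hai0 (hat i), one_mul]
      _ ≤ (a i)⁻¹ * C := mul_le_mul_right hle _
      _ = _ := by simp only [a]; rw [mul_comm, ENNReal.inv_pow]
  have hMf : maximalAverage σ f x ≠ ∞ := ((maximalAverage_le_posAverage f x).trans_lt hxf).ne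
  have hup : Tendsto (fun i => maximalAverage σ f x + posAverage σ (fun y => ‖f y - g i y‖ₑ) x)
      atTop (nhds (maximalAverage σ f x)) := by
    simpa using tendsto_const_nhds.add hlim
  have hlo : Tendsto (fun i => maximalAverage σ f x - posAverage σ (fun y => ‖f y - g i y‖ₑ) x)
      atTop (nhds (maximalAverage σ f x)) := by
    simpa using ENNReal.Tendsto.sub tendsto_const_nhds hlim (Or.inl hMf)
  refine tendsto_of_tendsto_of_tendsto_of_le_of_le hlo hup (fun i => ?_) fun i => ?_
  · exact tsub_le_iff_right.2 (maximalAverage_le_add hxi (hgi i))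
  · have := maximalAverage_le_add (hgi i) hxi
    simpa only [enorm_sub_rev] using this

end General

/-! ### Translation of the hypotheses on `σ` and `m`. -/

section Assembly

open Metric

variable {n : ℕ} {p : EuclideanSpace ℝ (Fin n) → ℝ≥0∞}
  {σ : Measure (EuclideanSpace ℝ (Fin n))} {m : EuclideanSpace ℝ (Fin n) → ℂ}

theorem isFiniteMeasure_of_locallyDimensional {β : ℝ} (hσ : CompactlySupported σ)
    (hdim : LocallyDimensional β σ) : IsFiniteMeasure σ := by
  obtain ⟨K, hK, hσK⟩ := hσ
  obtain ⟨C, hC⟩ := hdim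
  have : IsLocallyFiniteMeasure σ := ⟨fun x => ⟨ball x 1, ball_mem_nhds x one_pos,
    (hC x 1 one_pos le_rfl).trans_lt (ENNReal.mul_lt_top ENNReal.coe_lt_top ENNReal.ofReal_lt_top)⟩⟩
  refine ⟨?_⟩
  calc σ univ = σ (K ∪ Kᶜ) := by rw [union_compl_self]
    _ ≤ σ K + σ Kᶜ := measure_union_le _ _
    _ < ∞ := by rw [hσK, add_zero]; exact hK.measure_lt_top

theorem CompactlySupported.exists_closedBall (hσ : CompactlySupported σ) :
    ∃ R : ℝ, 0 ≤ R ∧ σ (closedBall 0 R)ᶜ = 0 := by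
  obtain ⟨K, hK, hσK⟩ := hσ
  obtain ⟨R, hR⟩ := hK.isBounded.subset_closedBall 0
  refine ⟨max R 0, le_max_right _ _, measure_mono_null (compl_subset_compl.2 ?_) hσK⟩
  exact hR.trans (closedBall_subset_closedBall (le_max_left _ _))

/-- For radii above 1 the total mass of `σ` suffices, since `ρ ^ β ≥ 1` when `β ≥ 0`. -/
theorem LocallyDimensional.exists_forall_le [IsFiniteMeasure σ] {β : ℝ} (hβ : 0 ≤ β)
    (hdim : LocallyDimensional β σ) : ∃ C : ℝ, 0 ≤ C ∧
      ∀ (x : EuclideanSpace ℝ (Fin n)) (ρ : ℝ), 0 < ρ → σ.real (ball x ρ) ≤ C * ρ ^ β := by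
  obtain ⟨C, hC⟩ := hdim
  refine ⟨C + σ.real univ, by positivity, fun x ρ hρ => ?_⟩
  have h0 : 0 ≤ ρ ^ β := Real.rpow_nonneg hρ.le _
  have h1 : 0 ≤ σ.real univ := measureReal_nonneg
  rcases le_total ρ 1 with h | h
  · have := ENNReal.toReal_mono (ENNReal.mul_ne_top ENNReal.coe_ne_top ENNReal.ofReal_ne_top)
      (hC x ρ hρ h)
    rw [ENNReal.toReal_mul, ENNReal.toReal_ofReal h0, ENNReal.coe_toReal] at this
    refine this.trans ?_
    gcongr
    linarith
  · have h2 : 1 ≤ ρ ^ β := Real.one_le_rpow h hβ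
    have h3 : σ.real (ball x ρ) ≤ σ.real univ := measureReal_mono (subset_univ _)
    have : 0 ≤ (C : ℝ) := C.2
    nlinarith

theorem contDiff_fourierMeasure [IsFiniteMeasure σ] {R : ℝ} (hσ : σ (closedBall 0 R)ᶜ = 0) :
    ContDiff ℝ 1 (fourierMeasure σ) := by
  have h : fourierMeasure σ = VectorFourier.fourierIntegral Real.fourierChar σ
      (innerSL ℝ : EuclideanSpace ℝ (Fin n) →L[ℝ] _).toLinearMap₁₂ (fun _ => (1 : ℂ)) := by
    ext ξ
    simp only [fourierMeasure, VectorFourier.fourierIntegral, Circle.smul_def, smul_eq_mul, mul_one]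
    rfl
  rw [h]
  refine VectorFourier.contDiff_fourierIntegral (N := 1) _ fun k _ => ?_
  refine Integrable.of_bound (C := R ^ k) (by fun_prop) ?_
  filter_upwards [measure_eq_zero_iff_ae_notMem.1 hσ] with y hy
  simp only [mem_compl_iff, mem_closedBall_zero_iff, not_not] at hy
  simp only [norm_one, mul_one, norm_pow, norm_norm]
  gcongr

theorem norm_fderiv_le_norm_grad (ξ : EuclideanSpace ℝ (Fin n)) :
    ‖fderiv ℝ m ξ‖ ≤ ‖grad m ξ‖ := by
  refine ContinuousLinearMap.opNorm_le_bound _ (norm_nonneg _) fun v => ?_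
  have hv : fderiv ℝ m ξ v = ∑ i, v i • fderiv ℝ m ξ (EuclideanSpace.single i 1) := by
    conv_lhs => rw [← (EuclideanSpace.basisFun (Fin n) ℝ).sum_repr v]
    simp
  rw [hv, EuclideanSpace.norm_eq, EuclideanSpace.norm_eq]
  refine (norm_sum_le _ _).trans ?_
  simp only [norm_smul]
  refine (Real.sum_mul_le_sqrt_mul_sqrt _ _ _).trans (le_of_eq ?_)
  rw [mul_comm]
  rfl

theorem continuous_grad (hm : ContDiff ℝ 1 m) : Continuous (grad m) := by
  refine (PiLp.continuous_toLp 2 _).comp (continuous_pi fun i => ?_)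
  exact (hm.continuous_fderiv one_ne_zero).clm_apply continuous_const

theorem lintegral_enorm_sq_le_of_sqrt_le {F : Type*} [NormedAddCommGroup F]
    {g : EuclideanSpace ℝ (Fin n) → F} (hg : Continuous g) {α C : ℝ}
    (h : ∀ ξ, √(∫ t in (1 : ℝ)..2, ‖g (t • ξ)‖ ^ 2) ≤ C * (1 + ‖ξ‖) ^ (-α))
    (ξ : EuclideanSpace ℝ (Fin n)) :
    ∫⁻ s in Ioc (1 : ℝ) 2, ‖g (s • ξ)‖ₑ ^ 2 ≤
      ENNReal.ofReal (C ^ 2 * (1 + ‖ξ‖) ^ (-(2 * α))) := by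
  have hc : Continuous fun s : ℝ => ‖g (s • ξ)‖ ^ 2 := by fun_prop
  have hint : IntegrableOn (fun s : ℝ => ‖g (s • ξ)‖ ^ 2) (Ioc 1 2) :=
    (intervalIntegrable_iff_integrableOn_Ioc_of_le one_le_two).1 (hc.intervalIntegrable _ _)
  have h1 : ∫⁻ s in Ioc (1 : ℝ) 2, ‖g (s • ξ)‖ₑ ^ 2 =
      ENNReal.ofReal (∫ t in (1 : ℝ)..2, ‖g (t • ξ)‖ ^ 2) := by
    rw [intervalIntegral.integral_of_le one_le_two,
      ofReal_integral_eq_lintegral_ofReal hint (Filter.Eventually.of_forall fun s => by positivity)]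
    refine lintegral_congr fun s => ?_
    rw [ENNReal.ofReal_pow (norm_nonneg _), ofReal_norm]
  rw [h1]
  refine ENNReal.ofReal_le_ofReal ?_
  have hx : 0 < 1 + ‖ξ‖ := by positivity
  calc ∫ t in (1 : ℝ)..2, ‖g (t • ξ)‖ ^ 2 ≤ (C * (1 + ‖ξ‖) ^ (-α)) ^ 2 := by
        exact (Real.sqrt_le_left ((Real.sqrt_nonneg _).trans (h ξ))).1 (h ξ)
    _ = _ := by
        rw [mul_pow, ← Real.rpow_natCast ((1 + ‖ξ‖) ^ (-α)), ← Real.rpow_mul hx.le]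
        congr 2
        push_cast; ring

/-- After division by a bound for the supremum the values are at most 1, where `s ^ p ≤ s` because
`p ≥ 1`; integrability does the rest. -/
theorem memLpVar_schwartz (hp : IsExponent p) (hpt : ∀ x, p x ≠ ∞)
    (f : 𝓢(EuclideanSpace ℝ (Fin n), ℂ)) : MemLpVar p f := by
  obtain ⟨M, hM⟩ := f.toBoundedContinuousFunction.isBounded_range.exists_norm_le
  have hM' : ∀ x, ‖f x‖ ≤ M := fun x => hM _ ⟨x, rfl⟩
  set c : ℝ≥0 := M.toNNReal + 1
  have hc0 : (c : ℝ≥0∞) ≠ 0 := by simp [c]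
  refine ⟨f.continuous.measurable.aemeasurable, c, by positivity, ?_⟩
  have hle : ∀ x, ‖f x‖ₑ / c ≤ 1 := fun x => by
    rw [ENNReal.div_le_iff hc0 ENNReal.coe_ne_top, one_mul, ← ofReal_norm]
    refine (ENNReal.ofReal_le_ofReal (hM' x)).trans ?_
    rw [ENNReal.ofReal]
    exact_mod_cast le_self_add
  calc modular p (fun x => ‖f x‖ₑ / c) ≤ ∫⁻ x, ‖f x‖ₑ / c := by
        refine lintegral_mono fun x => ?_
        have hP1 : 1 ≤ (p x).toReal := by
          rw [← ENNReal.ofReal_le_iff_le_toReal (hpt x), ENNReal.ofReal_one]; exact hp.2 x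
        simp only
        rw [expPow_of_ne_top (hpt x)]
        exact ENNReal.rpow_le_self_of_le_one (hle x) hP1
    _ < ∞ := by
        simp only [div_eq_mul_inv]
        rw [lintegral_mul_const' _ _ (by simp [hc0])]
        exact ENNReal.mul_lt_top f.integrable.2 (by simp [pos_iff_ne_zero, hc0])

theorem maximalMultiplier_eq_maximalAverage [IsFiniteMeasure σ]
    (f : 𝓢(EuclideanSpace ℝ (Fin n), ℂ)) :
    maximalMultiplier (fourierMeasure σ) f = maximalAverage σ f := by
  ext x
  refine iSup_congr fun t => iSup_congr fun _ => ?_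
  have := fourierInv_mul_fourier_eq σ (integrable_const (1 : ℂ)) f x t
  simp only [mul_one] at this
  rw [← this]
  rfl

end Assembly

end VarLp

/-! ### The main theorem. -/

theorem theorem2p1 (n : ℕ) (hn : 1 ≤ n)
    (p : EuclideanSpace ℝ (Fin n) → ℝ≥0∞) (hp : VarLp.IsExponent p)
    (σ : Measure (EuclideanSpace ℝ (Fin n))) (hσ : VarLp.CompactlySupported σ)
    (m : EuclideanSpace ℝ (Fin n) → ℂ) (hm : m = VarLp.fourierMeasure σ)
    (α β θ : ℝ) (hβ0 : 0 ≤ β) (hβn : β ≤ n) (hα : 1 / 2 < α)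
    (hdim : VarLp.LocallyDimensional β σ)
    (hdecay : ∃ C : ℝ, ∀ ξ : EuclideanSpace ℝ (Fin n),
      √(∫ t in (1 : ℝ)..2, ‖m (t • ξ)‖ ^ 2) ≤ C * (1 + ‖ξ‖) ^ (-α))
    (hgrad : ∃ C : ℝ, ∀ ξ : EuclideanSpace ℝ (Fin n),
      √(∫ t in (1 : ℝ)..2, ‖VarLp.grad m (t • ξ)‖ ^ 2) ≤ C * (1 + ‖ξ‖) ^ (-α))
    (hθ0 : 0 < θ) (hθ : θ < (2 * α - 1) / (2 * α - 1 + 2 * n - 2 * β))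
    (hpθ : ∀ x, ENNReal.ofReal (1 - θ) * p x ≤ 2)
    (hB : VarLp.ClassB (VarLp.interpExponent θ p)) :
    ∃ C : ℝ≥0,
      (∀ f : 𝓢(EuclideanSpace ℝ (Fin n), ℂ),
        AEMeasurable (VarLp.maximalMultiplier m f) ∧
        VarLp.luxNorm p (VarLp.maximalMultiplier m f) ≤
          C * VarLp.luxNorm p (fun x => ‖f x‖ₑ)) ∧
      (∀ f : EuclideanSpace ℝ (Fin n) → ℂ, VarLp.MemLpVar p f →
        (∀ᵐ x, ∀ t : ℝ, 0 < t → Integrable (fun y => f (x - t • y)) σ) ∧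
        AEMeasurable (VarLp.maximalAverage σ f) ∧
        VarLp.luxNorm p (VarLp.maximalAverage σ f) ≤
          C * VarLp.luxNorm p (fun x => ‖f x‖ₑ)) := by
  have hfin := VarLp.isFiniteMeasure_of_locallyDimensional hσ hdim
  have hnt : Nontrivial (EuclideanSpace ℝ (Fin n)) :=
    Module.nontrivial_of_finrank_pos (R := ℝ) (by rw [finrank_euclideanSpace_fin]; exact hn)
  obtain ⟨R, hR, hσR⟩ := hσ.exists_closedBall
  obtain ⟨Cβ, hCβ, hball⟩ := hdim.exists_forall_le hβ0
  have hγ : 0 < 2 * α - 1 := by linarith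
  have hden : 0 < 2 * α - 1 + 2 * n - 2 * β := by linarith
  have hθ' : θ * (2 * α - 1 + 2 * n - 2 * β) < 2 * α - 1 := (lt_div_iff₀ hden).1 hθ
  have hθ1 : θ < 1 := by
    refine hθ.trans_le ((div_le_one hden).2 ?_)
    linarith
  -- The upper bound on `θ`, cleared of its denominator, is the convergence condition for the sum
  -- over the pieces with growth `n - β` and decay `2α - 1`.
  have hcond : 2 * θ * (Module.finrank ℝ (EuclideanSpace ℝ (Fin n)) - β) <
      (1 - θ) * (2 * α - 1) := by
    rw [finrank_euclideanSpace_fin]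
    linarith
  subst hm
  have hC1 : ContDiff ℝ 1 (VarLp.fourierMeasure σ) := VarLp.contDiff_fourierMeasure hσR
  obtain ⟨C₁, hC₁⟩ := hdecay
  obtain ⟨C₂, hC₂⟩ := hgrad
  have hd1 := VarLp.lintegral_enorm_sq_le_of_sqrt_le hC1.continuous hC₁
  have hd2 := VarLp.lintegral_enorm_sq_le_of_sqrt_le (VarLp.continuous_grad hC1) hC₂
  obtain ⟨C, hC⟩ := VarLp.exists_iSup_average_le (α := α) (B := C₁ ^ 2 + C₂ ^ 2) hR hσR hCβ hball
    (fun ξ => rfl) (hC1.differentiable one_ne_zero) (by linarith) (by positivity)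
    (fun ξ => (hd1 ξ).trans (ENNReal.ofReal_le_ofReal (by gcongr; nlinarith [sq_nonneg C₂])))
    (fun ξ => by
      refine le_trans (lintegral_mono fun s => ?_) ((hd2 ξ).trans
        (ENNReal.ofReal_le_ofReal (by gcongr; nlinarith [sq_nonneg C₁])))
      refine pow_le_pow_left₀ zero_le ?_ 2
      rw [← ofReal_norm, ← ofReal_norm]
      exact ENNReal.ofReal_le_ofReal (VarLp.norm_fderiv_le_norm_grad _))
    hθ0 hθ1 hcond
  obtain ⟨C', hC'0, hC'⟩ := VarLp.exists_modular_maximalAverage_le hp hθ0 hθ1 hpθ hB hC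
  have hexp := fun x => VarLp.interpExponent_eq hθ0 hθ1 (hp.2 x) (hpθ x)
  have h1θ : 0 < 1 - θ := by linarith
  -- The restriction `(1 - θ) p ≤ 2` makes the exponent bounded, as required by the majorant and
  -- density arguments.
  have hpL : ∀ x, p x ≤ ENNReal.ofReal (2 / (1 - θ)) := fun x => by
    rw [ENNReal.le_ofReal_iff_toReal_le (hexp x).1 (by positivity), le_div_iff₀ h1θ, mul_comm]
    exact (hexp x).2.1
  have hpt : ∀ x, p x ≠ ∞ := fun x => (hexp x).1
  obtain ⟨C'', hN⟩ := VarLp.exists_posAverageBound hp hpL hC'0 hC'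
  have hmain : ∀ f : EuclideanSpace ℝ (Fin n) → ℂ, VarLp.MemLpVar p f →
      (∀ᵐ x, ∀ t : ℝ, 0 < t → Integrable (fun y => f (x - t • y)) σ) ∧
      AEMeasurable (VarLp.maximalAverage σ f) ∧
      VarLp.luxNorm p (VarLp.maximalAverage σ f) ≤
        C'' * VarLp.luxNorm p (fun x => ‖f x‖ₑ) := fun f hf =>
    ⟨hN.ae_integrable hp hpt hf, hN.aemeasurable_maximalAverage hp (by positivity) hpL hf,
      (VarLp.luxNorm_mono (VarLp.maximalAverage_le_posAverage f)).trans (hN.luxNorm_le hf.1.enorm)⟩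
  refine ⟨C'', fun f => ?_, hmain⟩
  -- On Schwartz functions the multiplier form coincides with the average over `σ`, so this case is
  -- contained in the general one.
  rw [VarLp.maximalMultiplier_eq_maximalAverage]
  exact (hmain f (VarLp.memLpVar_schwartz hp hpt f)).2
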